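/- Model. Consider a unit-cost RAM with $w$-bit words, whose instructions are loading constants, copying, addition, subtraction, multiplication (modulo $2^w$), bitwise boolean operations, shifts (right shifts unsigned), indirect loads and stores, reads of a read-only input, jumps, and conditional jumps on (unsigned) comparisons. Programs are fixed, i.e. do not depend on $w$ or on the input, except that they may use a constant number of words that depend on $w$ only. Space is counted in words and does not include the input. Automata. Regular expressions over an alphabet $\Sigma$ are built from the characters $\alpha\in\Sigma$ by concatenation, union and star. A Thompson-NFA (TNFA) is an automaton obtained from a regular expression by the following rules, each of which adds a new start state $\theta$ and a new accepting state $\phi$: for a character $\alpha$, an $\alpha$-transition $(\theta,\phi)$; for $S\cdot T$, $\epsilon$-transitions $(\theta,\theta_S),(\phi_S,\theta_T),(\phi_T,\phi)$; for $S|T$, $\epsilon$-transitions $(\theta,\theta_S),(\theta,\theta_T),(\phi_S,\phi),(\phi_T,\phi)$; for $S^*$, $\epsilon$-transitions $(\theta,\theta_S),(\theta,\phi),(\phi_S,\phi),(\phi_S,\theta_S)$. Here characters are $w$-bit words, and a TNFA with $m$ states, named $0,\dots,m-1$ arbitrarily, is given as input by $m$, the number of its transitions, its start and accepting state, and a list of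 its labelled transitions in arbitrary order. Statement. For every constant $C$ there are constants $K$ and $w_0$ and programs for preprocessing and for the operations Move, Close, Member and Insert (depending only on $C$) such that the following holds for every $w\ge w_0$ and every TNFA $A$ with $m\le C\sqrt{w}$ states. From any initial memory contents, the preprocessing on input $A$ takes at most $Km^2$ steps, uses only $Km$ words of memory, and leaves in them a data structure for which each of the following operations takes at most $K=O(1)$ steps, accesses only these $Km$ words of memory (and not the input), and leaves the data structure unchanged. State-sets $S$ are represented as bitstrings of length $m$, with respect to some order of the states chosen by the data structure, and are stored in one word. 1. $\mathrm{Move}(S,\alpha)$, for any character $\alpha$, returns the set of states reachable from $S$ via a single $\alpha$-transition. 2. $\mathrm{Close}(S)$ returns the set of states reachable from $S$ via $0$ or more $\epsilon$-transitions. 3. $\mathrm{Member}(S,s)$, for any state $s$, returns whether $s\in S$. 4. $\mathrm{Insert}(S,s)$, for any state $s$, returns $S\cup\{s\}$. -/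

import Mathlib

/-! ## Regular expressions, finite automata, Thompson's construction -/

/-- Regular expressions over `α`: characters, concatenation, union and star. -/
inductive RegExp (α : Type) : Type
  | char (a : α)
  | cat (R S : RegExp α)
  | union (R S : RegExp α)
  | star (R : RegExp α)

/-- A finite automaton with state set `V` and labels in `Σ ∪ {ε}`; the label `none` is `ε`. -/
structure Automaton (V α : Type) where
  /-- `step p l q`: there is a transition from `p` to `q` labelled `l`. -/
  step : V → Option α → V → Prop
  /-- the start state -/
  start : V
  /-- the accepting state -/
  accept : V

/-- The two states (start and accepting) that each rule of Thompson's construction adds. -/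
inductive Pole : Type
  | start
  | accept

namespace Automaton

/-- Transitions of the automaton of a single character. -/
inductive CharStep {α : Type} (a : α) : Pole → Option α → Pole → Prop
  | read : CharStep a Pole.start (some a) Pole.accept

/-- Transitions of the automaton of a concatenation. -/
inductive CatStep {V W α : Type} (A : Automaton V α) (B : Automaton W α) :
    Pole ⊕ (V ⊕ W) → Option α → Pole ⊕ (V ⊕ W) → Prop
  | left {p l q} : A.step p l q → CatStep A B (.inr (.inl p)) l (.inr (.inl q))
  | right {p l q} : B.step p l q → CatStep A B (.inr (.inr p)) l (.inr (.inr q))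
  | enter : CatStep A B (.inl .start) none (.inr (.inl A.start))
  | middle : CatStep A B (.inr (.inl A.accept)) none (.inr (.inr B.start))
  | leave : CatStep A B (.inr (.inr B.accept)) none (.inl .accept)

/-- Transitions of the automaton of a union. -/
inductive UnionStep {V W α : Type} (A : Automaton V α) (B : Automaton W α) :
    Pole ⊕ (V ⊕ W) → Option α → Pole ⊕ (V ⊕ W) → Prop
  | left {p l q} : A.step p l q → UnionStep A B (.inr (.inl p)) l (.inr (.inl q))
  | right {p l q} : B.step p l q → UnionStep A B (.inr (.inr p)) l (.inr (.inr q))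
  | enterLeft : UnionStep A B (.inl .start) none (.inr (.inl A.start))
  | enterRight : UnionStep A B (.inl .start) none (.inr (.inr B.start))
  | leaveLeft : UnionStep A B (.inr (.inl A.accept)) none (.inl .accept)
  | leaveRight : UnionStep A B (.inr (.inr B.accept)) none (.inl .accept)

/-- Transitions of the automaton of a star; `back` is the back transition. -/
inductive StarStep {V α : Type} (A : Automaton V α) :
    Pole ⊕ V → Option α → Pole ⊕ V → Prop
  | inner {p l q} : A.step p l q → StarStep A (.inr p) l (.inr q)
  | enter : StarStep A (.inl .start) none (.inr A.start)
  | skip : StarStep A (.inl .start) none (.inl .accept)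
  | leave : StarStep A (.inr A.accept) none (.inl .accept)
  | back : StarStep A (.inr A.accept) none (.inr A.start)

end Automaton

/-- The states of the Thompson automaton `N(R)`: two for each node of the parse tree of `R`. -/
def RegExp.State {α : Type} : RegExp α → Type
  | .char _ => Pole
  | .cat R S => Pole ⊕ (R.State ⊕ S.State)
  | .union R S => Pole ⊕ (R.State ⊕ S.State)
  | .star R => Pole ⊕ R.State

/-- Thompson's automaton `N(R)`. -/
def RegExp.thompson {α : Type} : (R : RegExp α) → Automaton R.State α
  | .char a => ⟨Automaton.CharStep a, Pole.start, Pole.accept⟩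
  | .cat R S => ⟨Automaton.CatStep R.thompson S.thompson, .inl .start, .inl .accept⟩
  | .union R S => ⟨Automaton.UnionStep R.thompson S.thompson, .inl .start, .inl .accept⟩
  | .star R => ⟨Automaton.StarStep R.thompson, .inl .start, .inl .accept⟩

namespace Automaton

/-- `A` is a Thompson-NFA (TNFA): up to the names of its states, `A = N(R)` for some `R`. -/
def IsTNFA {V α : Type} (A : Automaton V α) : Prop :=
  ∃ (R : RegExp α) (e : R.State ≃ V),
    (∀ p l q, R.thompson.step p l q ↔ A.step (e p) l (e q)) ∧
      e R.thompson.start = A.start ∧ e R.thompson.accept = A.accept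

/-- The states reachable from `S` via a single `a`-transition. -/
def move {V α : Type} (A : Automaton V α) (S : Set V) (a : α) : Set V :=
  {q | ∃ p ∈ S, A.step p (some a) q}

/-- The states reachable from `S` via zero or more `ε`-transitions. -/
def close {V α : Type} (A : Automaton V α) (S : Set V) : Set V :=
  {q | ∃ p ∈ S, Relation.ReflTransGen (fun x y => A.step x none y) p q}

/-- `E` lists the transitions of `A`, in some order and without repetition. -/
def IsTransitionList {V α : Type} (A : Automaton V α) (E : List (V × Option α × V)) : Prop :=
  E.Nodup ∧ ∀ p l q, (p, l, q) ∈ E ↔ A.step p l q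

end Automaton

/-! ## The unit-cost RAM with `w`-bit words -/

/-- Instructions. All arguments called `d`, `a`, `b`, `s` are numbers of registers. Arithmetic is
modulo `2 ^ w`, comparisons and right shifts are unsigned. -/
inductive Instr : Type
  /-- load the literal `n` (the same for all word lengths) -/
  | lit (d n : ℕ)
  /-- load the `i`-th of the constants that depend on the word length -/
  | wconst (d i : ℕ)
  | mov (d a : ℕ)
  | add (d a b : ℕ)
  | sub (d a b : ℕ)
  | mul (d a b : ℕ)
  | band (d a b : ℕ)
  | bor (d a b : ℕ)
  | bxor (d a b : ℕ)
  | bnot (d a : ℕ)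
  | shl (d a b : ℕ)
  | shr (d a b : ℕ)
  /-- `d := mem[a]` -/
  | load (d a : ℕ)
  /-- `mem[a] := s` -/
  | store (a s : ℕ)
  /-- `d := inp[a]`, where `inp` is the read-only input -/
  | read (d a : ℕ)
  | jump (target : ℕ)
  /-- jump if `a = b` -/
  | jeq (a b target : ℕ)
  /-- jump if `a < b` -/
  | jlt (a b target : ℕ)
  | halt

/-- What stays fixed during a run on a RAM with `w`-bit words: the constants depending on the word
length, the read-only input, and the number of available words of memory. -/
structure RamEnv (w : ℕ) where
  const : ℕ → BitVec w
  inp : List (BitVec w)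
  space : ℕ

/-- A configuration: program counter, registers, memory. -/
structure RamConfig (w : ℕ) where
  pc : ℕ
  reg : ℕ → BitVec w
  mem : ℕ → BitVec w

namespace RamConfig

/-- Write `x` to register `d` and go to the next instruction. -/
def put {w : ℕ} (c : RamConfig w) (d : ℕ) (x : BitVec w) : RamConfig w :=
  ⟨c.pc + 1, Function.update c.reg d x, c.mem⟩

/-- Go to `target` if `b` holds, and to the next instruction otherwise. -/
def branch {w : ℕ} (c : RamConfig w) (b : Prop) [Decidable b] (target : ℕ) : RamConfig w :=
  ⟨if b then target else c.pc + 1, c.reg, c.mem⟩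

/-- The configuration in which a program is called: arguments in the registers `0, 1, …`,
all other registers `0`. -/
def call {w : ℕ} (args : List (BitVec w)) (mem : ℕ → BitVec w) : RamConfig w :=
  ⟨0, fun i => args.getD i 0, mem⟩

end RamConfig

/-- Execution of one instruction; `none` if the machine has halted or the instruction is illegal,
such as an access to memory beyond the available space. -/
def Instr.exec {w : ℕ} (env : RamEnv w) (c : RamConfig w) : Instr → Option (RamConfig w)
  | lit d n => some (c.put d (BitVec.ofNat w n))
  | wconst d i => some (c.put d (env.const i))
  | mov d a => some (c.put d (c.reg a))
  | add d a b => some (c.put d (c.reg a + c.reg b))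
  | sub d a b => some (c.put d (c.reg a - c.reg b))
  | mul d a b => some (c.put d (c.reg a * c.reg b))
  | band d a b => some (c.put d (c.reg a &&& c.reg b))
  | bor d a b => some (c.put d (c.reg a ||| c.reg b))
  | bxor d a b => some (c.put d (c.reg a ^^^ c.reg b))
  | bnot d a => some (c.put d (~~~ c.reg a))
  | shl d a b => some (c.put d (c.reg a <<< (c.reg b).toNat))
  | shr d a b => some (c.put d (c.reg a >>> (c.reg b).toNat))
  | load d a =>
      if (c.reg a).toNat < env.space then some (c.put d (c.mem (c.reg a).toNat)) else none
  | store a s =>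
      if (c.reg a).toNat < env.space then
        some ⟨c.pc + 1, c.reg, Function.update c.mem (c.reg a).toNat (c.reg s)⟩
      else none
  | read d a => (env.inp[(c.reg a).toNat]?).map (c.put d)
  | jump target => some (c.branch True target)
  | jeq a b target => some (c.branch (c.reg a = c.reg b) target)
  | jlt a b target => some (c.branch ((c.reg a).toNat < (c.reg b).toNat) target)
  | halt => none

/-- The configuration after exactly `n` steps of the program `P` from `c`. -/
def ramRun {w : ℕ} (env : RamEnv w) (P : List Instr) : ℕ → RamConfig w → Option (RamConfig w)
  | 0, c => some c
  | n + 1, c => ((P[c.pc]?).bind (Instr.exec env c)).bind (ramRun env P n)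

/-- Started in `c`, the program `P` halts in configuration `c'` after at most `t` steps. -/
def RamHalts {w : ℕ} (env : RamEnv w) (P : List Instr) (c : RamConfig w) (t : ℕ)
    (c' : RamConfig w) : Prop :=
  ∃ n ≤ t, ramRun env P n c = some c' ∧ P[c'.pc]? = some Instr.halt

/-- Called with arguments `args` on memory `μ`, the program `P` halts after at most `t` steps with
`out` in register `0` and with the memory as it was. -/
def RamComputes {w : ℕ} (env : RamEnv w) (P : List Instr) (μ : ℕ → BitVec w) (t : ℕ)
    (args : List (BitVec w)) (out : BitVec w) : Prop :=
  ∃ c', RamHalts env P (RamConfig.call args μ) t c' ∧ c'.reg 0 = out ∧ c'.mem = μ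

/-! ## Simulation data structures -/

/-- The input of the preprocessing: number of states, number of transitions, start state, accepting
state, and for each transition its two endpoints, a word that tells whether it is an `ε`-transition
(`0`) or not (`1`), and its character (`0` for an `ε`-transition). -/
def automatonInput {w m : ℕ} (A : Automaton (Fin m) (BitVec w))
    (E : List (Fin m × Option (BitVec w) × Fin m)) : List (BitVec w) :=
  [BitVec.ofNat w m, BitVec.ofNat w E.length,
    BitVec.ofNat w A.start, BitVec.ofNat w A.accept] ++
  E.flatMap fun e =>
    [BitVec.ofNat w e.1, BitVec.ofNat w e.2.2,
      if e.2.1.isSome then 1 else 0, e.2.1.getD 0]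

open Classical in
/-- The state-set `S` as a bitstring in one word: state `s` owns the bit at position `σ s`, and
the bits at positions `m, m + 1, …` are `0`. -/
noncomputable def stateWord {m : ℕ} (w : ℕ) (σ : Equiv.Perm (Fin m)) (S : Set (Fin m)) :
    BitVec w :=
  BitVec.ofFnLE fun i => decide (∃ s ∈ S, (σ s : ℕ) = i)

/-- The programs of a simulation data structure: preprocessing and the four operations. -/
structure SimulationPrograms where
  preprocess : List Instr
  move : List Instr
  close : List Instr
  member : List Instr
  insert : List Instr

open Classical in
/-- The memory contents `μ` is a simulation data structure for `A`: with respect to some order of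
the states, each operation, called with state-sets represented as bitstrings in one word, takes at
most `t` steps, is correct, and leaves the data structure as it was. -/
def SimulationPrograms.Supports {w m : ℕ} (Q : SimulationPrograms) (env : RamEnv w)
    (A : Automaton (Fin m) (BitVec w)) (t : ℕ) (μ : ℕ → BitVec w) : Prop :=
  m ≤ w ∧ ∃ σ : Equiv.Perm (Fin m), ∀ S : Set (Fin m),
    (∀ a : BitVec w,
      RamComputes env Q.move μ t [stateWord w σ S, a] (stateWord w σ (A.move S a))) ∧
    RamComputes env Q.close μ t [stateWord w σ S] (stateWord w σ (A.close S)) ∧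
    (∀ s : Fin m, RamComputes env Q.member μ t [stateWord w σ S, BitVec.ofNat w s]
      (if s ∈ S then 1 else 0)) ∧
    (∀ s : Fin m, RamComputes env Q.insert μ t [stateWord w σ S, BitVec.ofNat w s]
      (stateWord w σ (S ∪ {s})))

/-! ## A structured language compiled to the RAM -/

/-! Masks. In a Thompson automaton all character transitions into a state carry the same character
(`RegExp.thompson_step_unique`). So a state q has a label, a mask `pred q` of the states with a
character transition to q, and a mask `cl q` of the states from which q is ε-reachable. Close(S)
consists of the q with `S &&& cl q ≠ 0`, and Move(S, α) of the q with `S &&& pred q ≠ 0` and label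
α. The masks have m = O(√w) bits, so a word has room for Θ(√w) of them and a constant number n of
words holds all m. Multiplying S by a word with a one in every field copies S into all fields. A
fieldwise AND, an addition that carries out of every nonzero field, and a multiplication that moves
the carries together then give the answer in constant time (`parCmd_spec`).

Labels. These have w bits and cannot be packed. They are replaced by hash values of O(√w) bits that
can be compared in parallel by XOR. The hash function must be injective on the labels, computable in
constant time, and found deterministically in O(m²) steps. A key is cut into chunks of `ck` = Θ(√w)
bits, and its hash value is a pair of linear combinations of the chunks. An inner product is a digit
of the product of two packed words (`pack_mul_digit`), so a combination takes four multiplications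
(`mul_part`). A character that is no label may share the hash value of a label. By injectivity all
states that pass the hash test have one label, so comparing the character with the label of one of
them settles the matter (`wp_checkCmd`).

Coefficients. Call the lowest chunk in which two keys differ their class. The coefficients are 0 or
powers 2^t with t < m, chosen from the highest chunk downwards. Setting the coefficient of chunk b
does not matter for pairs of higher class, which agree in chunk b. A pair of class b collides for at
most one t, because the lowest bit in which two values differ determines t (`low_of_collision`).
Hence some t < m makes at most one m-th of the pairs of class b collide (`bad_step`). After a full
pass at most one m-th of the fewer than m² pairs collide, which is fewer than m. A second pass that
looks only at these leaves fewer than one, so the two combinations together are injective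
(`hash_injOn`).

Time. With the keys sorted lexicographically from the lowest bit, the class of a pair is the minimum
of the classes of the adjacent pairs between them (`cls_three`). So there are fewer than m classes
to treat, and the partners of a key in a given class form an interval that is maintained in a single
scan (`Run`). A class costs O(m) plus the number of its pairs, and every pair has one class, so a
pass takes O(m²) steps. Lowest differing bits are located in constant time by multiplications
(`eval_lgE`). The masks `cl` come from Warshall's algorithm on bit vectors.

All programs are written in a small structured language whose semantics counts machine steps.
`Cmd.Eval.run_code` transfers these counts to the machine, and `Tr` and `wp` are the Hoare logic for
them. -/

namespace WordRam

/-- Binary word operations. -/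
inductive BinOp | add | sub | mul | and | or | xor | shl | shr

/-- Word operations on natural numbers below `2 ^ w`. -/
def BinOp.eval (w : ℕ) : BinOp → ℕ → ℕ → ℕ
  | add, a, b => (a + b) % 2 ^ w
  | sub, a, b => (2 ^ w - b + a) % 2 ^ w
  | mul, a, b => (a * b) % 2 ^ w
  | and, a, b => a &&& b
  | or, a, b => a ||| b
  | xor, a, b => a ^^^ b
  | shl, a, b => (a <<< b) % 2 ^ w
  | shr, a, b => a >>> b

def BinOp.instr : BinOp → ℕ → ℕ → ℕ → Instr
  | add => Instr.add
  | sub => Instr.sub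
  | mul => Instr.mul
  | and => Instr.band
  | or => Instr.bor
  | xor => Instr.bxor
  | shl => Instr.shl
  | shr => Instr.shr

/-- Expressions over variables, literals and the constants depending on the word length. -/
inductive Expr
  | lit (n : ℕ)
  | wc (i : ℕ)
  | var (r : ℕ)
  | bin (o : BinOp) (a b : Expr)

/-- States of the structured language: variables and memory. -/
structure St where
  reg : ℕ → ℕ
  mem : ℕ → ℕ

namespace St

def set (σ : St) (r v : ℕ) : St := ⟨Function.update σ.reg r v, σ.mem⟩
def setMem (σ : St) (a v : ℕ) : St := ⟨σ.reg, Function.update σ.mem a v⟩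

theorem set_reg (σ : St) (r v r' : ℕ) : (σ.set r v).reg r' = if r' = r then v else σ.reg r' := by
  simp [set, Function.update_apply]
@[simp] theorem set_mem (σ : St) (r v : ℕ) : (σ.set r v).mem = σ.mem := rfl
@[simp] theorem setMem_reg (σ : St) (a v : ℕ) : (σ.setMem a v).reg = σ.reg := rfl
theorem setMem_mem (σ : St) (a v a' : ℕ) :
    (σ.setMem a v).mem a' = if a' = a then v else σ.mem a' := by
  simp [setMem, Function.update_apply]

end St

def Expr.eval {w : ℕ} (env : RamEnv w) (σ : St) : Expr → ℕ
  | lit n => n % 2 ^ w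
  | wc i => (env.const i).toNat
  | var r => σ.reg r
  | bin o a b => o.eval w (a.eval env σ) (b.eval env σ)

/-- Code that leaves the value of the expression in the machine register `2 * t + 1`. -/
def Expr.code : Expr → ℕ → List Instr
  | lit n, t => [Instr.lit (2 * t + 1) n]
  | wc i, t => [Instr.wconst (2 * t + 1) i]
  | var r, t => [Instr.mov (2 * t + 1) (2 * r)]
  | bin o a b, t => a.code t ++ b.code (t + 1) ++ [o.instr (2 * t + 1) (2 * t + 1) (2 * t + 3)]

def Expr.len : Expr → ℕ
  | lit _ => 1
  | wc _ => 1
  | var _ => 1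
  | bin _ a b => a.len + b.len + 1

@[simp] theorem Expr.length_code (e : Expr) (t : ℕ) : (e.code t).length = e.len := by
  induction e generalizing t with
  | bin o a b iha ihb => simp [code, len, iha, ihb]; try omega
  | _ => rfl

/-- Conditions: `a < b` (if `lt`) or `a = b` (otherwise). -/
structure Cond where
  lt : Bool
  a : Expr
  b : Expr

def Cond.holds {w : ℕ} (env : RamEnv w) (σ : St) (c : Cond) : Prop :=
  if c.lt then c.a.eval env σ < c.b.eval env σ else c.a.eval env σ = c.b.eval env σ

instance {w : ℕ} (env : RamEnv w) (σ : St) (c : Cond) : Decidable (c.holds env σ) := by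
  unfold Cond.holds; infer_instance

def Cond.code (c : Cond) (target : ℕ) : List Instr :=
  c.a.code 0 ++ c.b.code 1 ++ [if c.lt then Instr.jlt 1 3 target else Instr.jeq 1 3 target]

def Cond.len (c : Cond) : ℕ := c.a.len + c.b.len + 1

@[simp] theorem Cond.length_code (c : Cond) (t : ℕ) : (c.code t).length = c.len := by
  simp [code, len]; omega

/-- Commands. -/
inductive Cmd
  | assign (r : ℕ) (e : Expr)
  | load (r : ℕ) (a : Expr)
  | store (a e : Expr)
  | read (r : ℕ) (a : Expr)
  | seq (a b : Cmd)
  | ite (c : Cond) (a b : Cmd)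
  | loop (c : Cond) (b : Cmd)

namespace Cmd

def len : Cmd → ℕ
  | assign _ e => e.len + 1
  | load _ a => a.len + 1
  | store a e => a.len + e.len + 1
  | read _ a => a.len + 1
  | seq a b => a.len + b.len
  | ite c a b => c.len + b.len + 1 + a.len
  | loop c b => c.len + 1 + b.len + 1

/-- The code of a command, to be placed at position `p`. -/
def code : Cmd → ℕ → List Instr
  | assign r e, _ => e.code 0 ++ [Instr.mov (2 * r) 1]
  | load r a, _ => a.code 0 ++ [Instr.load (2 * r) 1]
  | store a e, _ => a.code 0 ++ e.code 1 ++ [Instr.store 1 3]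
  | read r a, _ => a.code 0 ++ [Instr.read (2 * r) 1]
  | seq a b, p => a.code p ++ b.code (p + a.len)
  | ite c a b, p => c.code (p + c.len + b.len + 1) ++ b.code (p + c.len) ++
      [Instr.jump (p + c.len + b.len + 1 + a.len)] ++ a.code (p + c.len + b.len + 1)
  | loop c b, p => c.code (p + c.len + 1) ++ [Instr.jump (p + c.len + 1 + b.len + 1)] ++
      b.code (p + c.len + 1) ++ [Instr.jump p]

@[simp] theorem length_code (c : Cmd) (p : ℕ) : (c.code p).length = c.len := by
  induction c generalizing p with
  | assign r e => simp [code, len]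
  | load r e => simp [code, len]
  | store r e => simp [code, len]; omega
  | read r e => simp [code, len]
  | seq a b iha ihb => simp [code, len, iha, ihb]; try omega
  | ite c a b iha ihb => simp [code, len, iha, ihb]; omega
  | loop c b ihb => simp [code, len, ihb]; omega

/-- Big-step semantics: `c.Eval env σ n σ'` if `c` takes `σ` to `σ'` in `n` machine steps. -/
inductive Eval {w : ℕ} (env : RamEnv w) : Cmd → St → ℕ → St → Prop
  | assign {r e σ} : Eval env (assign r e) σ (e.len + 1) (σ.set r (e.eval env σ))
  | load {r a σ} : a.eval env σ < env.space →
      Eval env (load r a) σ (a.len + 1) (σ.set r (σ.mem (a.eval env σ)))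
  | store {a e σ} : a.eval env σ < env.space →
      Eval env (store a e) σ (a.len + e.len + 1) (σ.setMem (a.eval env σ) (e.eval env σ))
  | read {r a σ x} : env.inp[a.eval env σ]? = some x →
      Eval env (read r a) σ (a.len + 1) (σ.set r x.toNat)
  | seq {a b σ σ' σ'' n n'} : Eval env a σ n σ' → Eval env b σ' n' σ'' →
      Eval env (seq a b) σ (n + n') σ''
  | iteT {c a b σ σ' n} : c.holds env σ → Eval env a σ n σ' →
      Eval env (ite c a b) σ (c.len + n) σ'
  | iteF {c a b σ σ' n} : ¬ c.holds env σ → Eval env b σ n σ' →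
      Eval env (ite c a b) σ (c.len + (n + 1)) σ'
  | loopT {c b σ σ' σ'' n n'} : c.holds env σ → Eval env b σ n σ' →
      Eval env (loop c b) σ' n' σ'' → Eval env (loop c b) σ (c.len + (n + (1 + n'))) σ''
  | loopF {c b σ} : ¬ c.holds env σ → Eval env (loop c b) σ (c.len + 1) σ

end Cmd

/-- The machine configuration `c` represents the state `σ`. -/
def Rep {w : ℕ} (c : RamConfig w) (σ : St) : Prop :=
  (∀ r, (c.reg (2 * r)).toNat = σ.reg r) ∧ ∀ a, (c.mem a).toNat = σ.mem a

/-! ### Correctness of the compiled code. -/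

theorem ramRun_add {w : ℕ} (env : RamEnv w) (P : List Instr) (n n' : ℕ) (c : RamConfig w) :
    ramRun env P (n + n') c = (ramRun env P n c).bind (ramRun env P n') := by
  induction n generalizing c with
  | zero => simp [ramRun]
  | succ n ih =>
    rw [Nat.succ_add, ramRun, ramRun]
    simp only [Option.bind_assoc, ih]

theorem ramRun_one {w : ℕ} (env : RamEnv w) {P pre post : List Instr} {i : Instr}
    (hP : P = pre ++ [i] ++ post) {c : RamConfig w} (hc : c.pc = pre.length) :
    ramRun env P 1 c = i.exec env c := by
  subst hP
  simp [ramRun, hc]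

theorem ramRun_trans {w : ℕ} {env : RamEnv w} {P : List Instr} {n n' : ℕ} {c c' : RamConfig w}
    {r : Option (RamConfig w)}
    (h : ramRun env P n c = some c') (h' : ramRun env P n' c' = r) :
    ramRun env P (n + n') c = r := by
  rw [ramRun_add, h]; exact h'

/-- Variables live in even registers and temporaries in odd ones, so evaluation changes no variable.
Temporaries below `t` survive too, which keeps the left operand of a binary operation safe while the
right one is evaluated at level `t + 1`. -/
theorem Expr.run_code {w : ℕ} {env : RamEnv w} (e : Expr) (t : ℕ) {P pre post : List Instr}
    (hP : P = pre ++ e.code t ++ post) {c : RamConfig w} {σ : St} (hc : c.pc = pre.length)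
    (hr : ∀ r, (c.reg (2 * r)).toNat = σ.reg r) :
    ∃ c', ramRun env P e.len c = some c' ∧ c'.pc = pre.length + e.len ∧ c'.mem = c.mem ∧
      (c'.reg (2 * t + 1)).toNat = e.eval env σ ∧ (∀ r, c'.reg (2 * r) = c.reg (2 * r)) ∧
      ∀ r < t, c'.reg (2 * r + 1) = c.reg (2 * r + 1) := by
  induction e generalizing t pre post c with
  | lit n =>
    refine ⟨_, (ramRun_one env hP hc).trans rfl, ?_, rfl, ?_, fun r => ?_, fun r hr => ?_⟩
    · simp [RamConfig.put, hc, len]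
    · simp [RamConfig.put, eval]
    · exact Function.update_of_ne (by omega) _ _
    · exact Function.update_of_ne (by omega) _ _
  | wc n =>
    refine ⟨_, (ramRun_one env hP hc).trans rfl, ?_, rfl, ?_, fun r => ?_, fun r hr => ?_⟩
    · simp [RamConfig.put, hc, len]
    · simp [RamConfig.put, eval]
    · exact Function.update_of_ne (by omega) _ _
    · exact Function.update_of_ne (by omega) _ _
  | var n =>
    refine ⟨_, (ramRun_one env hP hc).trans rfl, ?_, rfl, ?_, fun r => ?_, fun r hr => ?_⟩
    · simp [RamConfig.put, hc, len]
    · simp [RamConfig.put, eval, hr]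
    · exact Function.update_of_ne (by omega) _ _
    · exact Function.update_of_ne (by omega) _ _
  | bin o a b iha ihb =>
    obtain ⟨c1, h1, pc1, m1, v1, e1, o1⟩ := iha t (pre := pre)
      (post := b.code (t + 1) ++ [o.instr (2 * t + 1) (2 * t + 1) (2 * t + 3)] ++ post)
      (by simp [hP, code]) hc hr
    obtain ⟨c2, h2, pc2, m2, v2, e2, o2⟩ := ihb (t + 1) (pre := pre ++ a.code t)
      (post := [o.instr (2 * t + 1) (2 * t + 1) (2 * t + 3)] ++ post) (c := c1)
      (by simp [hP, code]) (by simp [pc1]) (fun r => by rw [e1, hr])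
    have h3 := ramRun_one env (P := P) (pre := pre ++ a.code t ++ b.code (t + 1))
      (i := o.instr (2 * t + 1) (2 * t + 1) (2 * t + 3)) (post := post) (c := c2)
      (by simp [hP, code]) (by simp [pc2]; omega)
    have v1' : (c2.reg (2 * t + 1)).toNat = a.eval env σ := by rw [o2 t (by omega), v1]
    have v2' : (c2.reg (2 * t + 3)).toNat = b.eval env σ := v2
    obtain ⟨x, hx, hxv⟩ : ∃ x, (o.instr (2 * t + 1) (2 * t + 1) (2 * t + 3)).exec env c2
        = some (c2.put (2 * t + 1) x) ∧ x.toNat = (Expr.bin o a b).eval env σ := by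
      simp only [eval, ← v1', ← v2']
      cases o <;> refine ⟨_, rfl, ?_⟩ <;> simp [BinOp.eval]
    refine ⟨_, ramRun_trans (ramRun_trans h1 h2) (h3.trans hx), ?_, ?_, ?_, fun r => ?_,
      fun r hr => ?_⟩
    · simp [RamConfig.put, pc2, len]; omega
    · simp [RamConfig.put, m2, m1]
    · simp [RamConfig.put, hxv]
    · exact (Function.update_of_ne (by omega) _ _).trans ((e2 r).trans (e1 r))
    · exact (Function.update_of_ne (by omega) _ _).trans
        ((o2 r (by omega)).trans (o1 r hr))

theorem Cond.run_code {w : ℕ} {env : RamEnv w} (b : Cond) (target : ℕ) {P pre post : List Instr}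
    (hP : P = pre ++ b.code target ++ post) {c : RamConfig w} {σ : St} (hc : c.pc = pre.length)
    (hr : Rep c σ) :
    ∃ c', ramRun env P b.len c = some c' ∧ Rep c' σ ∧
      c'.pc = if b.holds env σ then target else pre.length + b.len := by
  obtain ⟨c1, h1, pc1, m1, v1, e1, o1⟩ := b.a.run_code (env := env) 0 (P := P) (pre := pre)
    (post := b.b.code 1 ++ [if b.lt then Instr.jlt 1 3 target else Instr.jeq 1 3 target] ++ post)
    (by simp [hP, code]) hc hr.1
  obtain ⟨c2, h2, pc2, m2, v2, e2, o2⟩ := b.b.run_code (env := env) 1 (P := P)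
    (pre := pre ++ b.a.code 0)
    (post := [if b.lt then Instr.jlt 1 3 target else Instr.jeq 1 3 target] ++ post) (c := c1)
    (by simp [hP, code]) (by simp [pc1]) (fun r => by rw [e1, hr.1])
  have h3 := ramRun_one env (P := P) (pre := pre ++ b.a.code 0 ++ b.b.code 1)
    (i := if b.lt then Instr.jlt 1 3 target else Instr.jeq 1 3 target) (post := post) (c := c2)
    (by simp [hP, code]) (by simp [pc2]; omega)
  have v1' : (c2.reg 1).toNat = b.a.eval env σ := by rw [o2 0 (by omega), v1]
  have v2' : (c2.reg 3).toNat = b.b.eval env σ := v2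
  have hrep : ∀ pc, Rep (⟨pc, c2.reg, c2.mem⟩ : RamConfig w) σ := fun pc =>
    ⟨fun r => by simp only [e2, e1, hr.1], fun a => by simp only [m2, m1, hr.2]⟩
  cases hl : b.lt with
  | true =>
    rw [hl] at h3
    refine ⟨_, ramRun_trans (ramRun_trans h1 h2) (h3.trans rfl), hrep _, ?_⟩
    simp only [RamConfig.branch, holds, hl, if_true, v1', v2', pc2]
    congr 1
    simp [len]; omega
  | false =>
    rw [hl] at h3
    refine ⟨_, ramRun_trans (ramRun_trans h1 h2) (h3.trans rfl), hrep _, ?_⟩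
    simp only [RamConfig.branch, holds, hl, BitVec.toNat_eq, v1', v2', pc2]
    congr 1
    simp [len]; omega

theorem Rep.put {w : ℕ} {c c' : RamConfig w} {σ : St} (h : Rep c σ)
    (he : ∀ r, c'.reg (2 * r) = c.reg (2 * r)) (hm : c'.mem = c.mem) (r : ℕ) (x : BitVec w)
    {v : ℕ} (hv : x.toNat = v) : Rep (c'.put (2 * r) x) (σ.set r v) := by
  subst hv
  refine ⟨fun r' => ?_, fun a => by simp [RamConfig.put, hm, h.2]⟩
  rw [St.set_reg]
  by_cases hr : r' = r
  · simp [hr, RamConfig.put]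
  · rw [if_neg hr, ← h.1, ← he]
    congr 1
    exact Function.update_of_ne (by omega) _ _

/-- Compiled code simulates the big-step semantics. -/
theorem Cmd.Eval.run_code {w : ℕ} {env : RamEnv w} {cmd : Cmd} {σ σ' : St} {n : ℕ}
    (h : cmd.Eval env σ n σ') {P pre post : List Instr}
    (hP : P = pre ++ cmd.code pre.length ++ post) {c : RamConfig w} (hc : c.pc = pre.length)
    (hr : Rep c σ) :
    ∃ c', ramRun env P n c = some c' ∧ Rep c' σ' ∧ c'.pc = pre.length + cmd.len := by
  induction h generalizing pre post c with
  | @assign r e σ =>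
    obtain ⟨c1, h1, pc1, m1, v1, e1, -⟩ := e.run_code (env := env) 0 (P := P) (pre := pre)
      (post := [Instr.mov (2 * r) 1] ++ post) (by simp [hP, code]) hc hr.1
    have h3 := ramRun_one env (P := P) (pre := pre ++ e.code 0) (i := Instr.mov (2 * r) 1)
      (post := post) (c := c1) (by simp [hP, code]) (by simp [pc1])
    exact ⟨_, ramRun_trans h1 (h3.trans rfl), hr.put e1 m1 _ _ v1,
      by simp [RamConfig.put, pc1, len]; omega⟩
  | @load r e σ hs =>
    obtain ⟨c1, h1, pc1, m1, v1, e1, -⟩ := e.run_code (env := env) 0 (P := P) (pre := pre)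
      (post := [Instr.load (2 * r) 1] ++ post) (by simp [hP, code]) hc hr.1
    have h3 := ramRun_one env (P := P) (pre := pre ++ e.code 0) (i := Instr.load (2 * r) 1)
      (post := post) (c := c1) (by simp [hP, code]) (by simp [pc1])
    have v1' : (c1.reg 1).toNat = e.eval env σ := v1
    have h4 : (Instr.load (2 * r) 1).exec env c1
        = some (c1.put (2 * r) (c1.mem (c1.reg 1).toNat)) := by
      simp [Instr.exec, v1', hs]
    exact ⟨_, ramRun_trans h1 (h3.trans h4), hr.put e1 m1 _ _ (by rw [v1', m1, hr.2]),
      by simp [RamConfig.put, pc1, len]; omega⟩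
  | @store a e σ hs =>
    obtain ⟨c1, h1, pc1, m1, v1, e1, o1⟩ := a.run_code (env := env) 0 (P := P) (pre := pre)
      (post := e.code 1 ++ [Instr.store 1 3] ++ post) (by simp [hP, code]) hc hr.1
    obtain ⟨c2, h2, pc2, m2, v2, e2, o2⟩ := e.run_code (env := env) 1 (P := P)
      (pre := pre ++ a.code 0)
      (post := [Instr.store 1 3] ++ post) (c := c1) (σ := σ)
      (by simp [hP, code]) (by simp [pc1]) (fun r => by rw [e1, hr.1])
    have h3 := ramRun_one env (P := P) (pre := pre ++ a.code 0 ++ e.code 1)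
      (i := Instr.store 1 3)
      (post := post) (c := c2) (by simp [hP, code]) (by simp [pc2]; omega)
    have v1' : (c2.reg 1).toNat = a.eval env σ := by rw [o2 0 (by omega), v1]
    have v2' : (c2.reg 3).toNat = e.eval env σ := v2
    have h4 : (Instr.store 1 3).exec env c2
        = some ⟨c2.pc + 1, c2.reg, Function.update c2.mem (c2.reg 1).toNat (c2.reg 3)⟩ := by
      simp [Instr.exec, v1', hs]
    refine ⟨_, ramRun_trans (ramRun_trans h1 h2) (h3.trans h4), ⟨fun r => ?_, fun x => ?_⟩,
      by simp [pc2, len]; omega⟩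
    · simp only [e2, e1, hr.1, St.setMem_reg]
    · rw [St.setMem_mem]
      simp only [Function.update_apply, v1']
      split
      · exact v2'
      · rw [m2, m1, hr.2]
  | @read r e σ x hx =>
    obtain ⟨c1, h1, pc1, m1, v1, e1, -⟩ := e.run_code (env := env) 0 (P := P) (pre := pre)
      (post := [Instr.read (2 * r) 1] ++ post) (by simp [hP, code]) hc hr.1
    have h3 := ramRun_one env (P := P) (pre := pre ++ e.code 0) (i := Instr.read (2 * r) 1)
      (post := post) (c := c1) (by simp [hP, code]) (by simp [pc1])
    have v1' : (c1.reg 1).toNat = e.eval env σ := v1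
    have h4 : (Instr.read (2 * r) 1).exec env c1 = some (c1.put (2 * r) x) := by
      simp [Instr.exec, v1', hx]
    exact ⟨_, ramRun_trans h1 (h3.trans h4), hr.put e1 m1 _ _ rfl,
      by simp [RamConfig.put, pc1, len]; omega⟩
  | @seq a b _ _ _ _ _ _ _ iha ihb =>
    obtain ⟨c1, h1, r1, pc1⟩ := iha (pre := pre) (post := b.code (pre.length + a.len) ++ post)
      (by simp [hP, code]) hc hr
    obtain ⟨c2, h2, r2, pc2⟩ := ihb (pre := pre ++ a.code pre.length) (post := post)
      (by simp [hP, code]) (by simp [pc1]) r1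
    exact ⟨c2, ramRun_trans h1 h2, r2, by simp [pc2, len]; omega⟩
  | @iteT b x y σ σ' n hb _ ih =>
    obtain ⟨c1, h1, r1, pc1⟩ := b.run_code (env := env) (pre.length + b.len + y.len + 1) (P := P)
      (pre := pre) (post := y.code (pre.length + b.len) ++
      [Instr.jump (pre.length + b.len + y.len + 1 + x.len)] ++
        x.code (pre.length + b.len + y.len + 1) ++ post)
      (by simp [hP, code]) hc hr
    rw [if_pos hb] at pc1
    obtain ⟨c2, h2, r2, pc2⟩ := ih (pre := pre ++ b.code (pre.length + b.len + y.len + 1) ++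
      y.code (pre.length + b.len) ++ [Instr.jump (pre.length + b.len + y.len + 1 + x.len)])
      (post := post) (by simp [hP, code, Nat.add_assoc]) (by simp [pc1]; omega) r1
    exact ⟨c2, ramRun_trans h1 h2, r2, by simp [pc2, len]; omega⟩
  | @iteF b x y σ σ' n hb _ ih =>
    obtain ⟨c1, h1, r1, pc1⟩ := b.run_code (env := env) (pre.length + b.len + y.len + 1) (P := P)
      (pre := pre) (post := y.code (pre.length + b.len) ++
      [Instr.jump (pre.length + b.len + y.len + 1 + x.len)] ++
        x.code (pre.length + b.len + y.len + 1) ++ post)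
      (by simp [hP, code]) hc hr
    rw [if_neg hb] at pc1
    obtain ⟨c2, h2, r2, pc2⟩ := ih (pre := pre ++ b.code (pre.length + b.len + y.len + 1))
      (post := [Instr.jump (pre.length + b.len + y.len + 1 + x.len)] ++
        x.code (pre.length + b.len + y.len + 1) ++ post)
      (by simp [hP, code, Nat.add_assoc]) (by simp [pc1]) r1
    have h3 := ramRun_one env (P := P) (pre := pre ++ b.code (pre.length + b.len + y.len + 1) ++
      y.code (pre.length + b.len))
      (i := Instr.jump (pre.length + b.len + y.len + 1 + x.len))
      (post := x.code (pre.length + b.len + y.len + 1) ++ post) (c := c2)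
      (by simp [hP, code, Nat.add_assoc]) (by simp [pc2]; omega)
    exact ⟨_, ramRun_trans h1 (ramRun_trans h2 (h3.trans rfl)), r2,
      by simp [RamConfig.branch, len]; omega⟩
  | @loopT b x σ σ' σ'' n n' hb _ _ ih ih' =>
    obtain ⟨c1, h1, r1, pc1⟩ := b.run_code (env := env) (pre.length + b.len + 1) (P := P)
      (pre := pre) (post := [Instr.jump (pre.length + b.len + 1 + x.len + 1)] ++
      x.code (pre.length + b.len + 1) ++ [Instr.jump pre.length] ++ post)
      (by simp [hP, code]) hc hr
    rw [if_pos hb] at pc1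
    obtain ⟨c2, h2, r2, pc2⟩ := ih (pre := pre ++ b.code (pre.length + b.len + 1) ++
      [Instr.jump (pre.length + b.len + 1 + x.len + 1)])
      (post := [Instr.jump pre.length] ++ post) (by simp [hP, code, Nat.add_assoc])
      (by simp [pc1]; omega) r1
    have h3 := ramRun_one env (P := P) (pre := pre ++ b.code (pre.length + b.len + 1) ++
      [Instr.jump (pre.length + b.len + 1 + x.len + 1)] ++ x.code (pre.length + b.len + 1))
      (i := Instr.jump pre.length) (post := post) (c := c2)
      (by simp [hP, code, Nat.add_assoc]) (by simp [pc2]; omega)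
    -- The back jump returns to the first instruction of the same loop, so the second induction
    -- hypothesis applies at the same place in the program.
    obtain ⟨c4, h4, r4, pc4⟩ := ih' (pre := pre) (post := post) (c := ⟨pre.length, c2.reg, c2.mem⟩)
      hP rfl r2
    exact ⟨c4, ramRun_trans h1 (ramRun_trans h2 (ramRun_trans (h3.trans (by
      simp [Instr.exec, RamConfig.branch])) h4)), r4, pc4⟩
  | @loopF b x σ hb =>
    obtain ⟨c1, h1, r1, pc1⟩ := b.run_code (env := env) (pre.length + b.len + 1) (P := P)
      (pre := pre) (post := [Instr.jump (pre.length + b.len + 1 + x.len + 1)] ++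
      x.code (pre.length + b.len + 1) ++ [Instr.jump pre.length] ++ post)
      (by simp [hP, code]) hc hr
    rw [if_neg hb] at pc1
    have h3 := ramRun_one env (P := P) (pre := pre ++ b.code (pre.length + b.len + 1))
      (i := Instr.jump (pre.length + b.len + 1 + x.len + 1))
      (post := x.code (pre.length + b.len + 1) ++ [Instr.jump pre.length] ++ post) (c := c1)
      (by simp [hP, code, Nat.add_assoc]) (by simp [pc1])
    exact ⟨_, ramRun_trans h1 (h3.trans rfl), r1, by simp [RamConfig.branch, len]; omega⟩

/-- The program of a command: its variables `0` and `1` receive the arguments. -/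
def Cmd.program (cmd : Cmd) : List Instr := [Instr.mov 2 1] ++ cmd.code 1 ++ [Instr.halt]

/-- Register 1 is a temporary, so the second argument is first moved to register 2, the home of
variable 1. This is the extra step in `n + 1 ≤ t`. -/
theorem Cmd.Eval.halts {w : ℕ} {env : RamEnv w} {cmd : Cmd} {σ σ' : St} {n t : ℕ}
    {args : List (BitVec w)} {μ : ℕ → BitVec w}
    (h : cmd.Eval env σ n σ') (hn : n + 1 ≤ t) (h0 : (args.getD 0 0).toNat = σ.reg 0)
    (h1 : (args.getD 1 0).toNat = σ.reg 1)
    (hz : ∀ r, 2 ≤ r → (args.getD (2 * r) 0).toNat = σ.reg r)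
    (hm : ∀ a, (μ a).toNat = σ.mem a) :
    ∃ c', RamHalts env cmd.program (RamConfig.call args μ) t c' ∧ Rep c' σ' := by
  have e1 := ramRun_one env (P := cmd.program) (pre := []) (i := Instr.mov 2 1)
    (post := cmd.code 1 ++ [Instr.halt]) (c := RamConfig.call args μ) (by simp [program]) rfl
  obtain ⟨c', h2, r2, pc2⟩ := h.run_code (P := cmd.program) (pre := [Instr.mov 2 1])
    (post := [Instr.halt]) (c := (RamConfig.call args μ).put 2 ((RamConfig.call args μ).reg 1))
    (by simp [program]) (by simp [RamConfig.put, RamConfig.call]) (by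
      refine ⟨fun r => ?_, fun a => hm a⟩
      rcases r with - | - | r
      · simpa [RamConfig.put, RamConfig.call] using h0
      · simpa [RamConfig.put, RamConfig.call] using h1
      · rw [← hz _ (by omega)]
        simp [RamConfig.put, RamConfig.call])
  refine ⟨c', ⟨1 + n, by omega, ramRun_trans (e1.trans rfl) h2, ?_⟩, r2⟩
  rw [pc2, program, List.getElem?_append_right (by simp [Nat.add_comm])]
  simp [Nat.add_comm]

end WordRam

/-! ## Reasoning about commands -/

namespace WordRam

section
variable {w : ℕ} (env : RamEnv w)

/-- Total correctness within `t` machine steps. -/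
def Tr (c : Cmd) (σ : St) (t : ℕ) (Q : St → Prop) : Prop :=
  ∃ n ≤ t, ∃ τ, c.Eval env σ n τ ∧ Q τ

/-- An upper bound on the running time of a command without loops. -/
def Cmd.cost : Cmd → ℕ
  | seq a b => a.cost + b.cost
  | ite c a b => c.len + (a.cost + b.cost + 1)
  | c => c.len

/-- Weakest preconditions of commands without loops. -/
def wp : Cmd → (St → Prop) → St → Prop
  | .assign r e, Q, σ => Q (σ.set r (e.eval env σ))
  | .load r a, Q, σ => a.eval env σ < env.space ∧ Q (σ.set r (σ.mem (a.eval env σ)))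
  | .store a e, Q, σ => a.eval env σ < env.space ∧ Q (σ.setMem (a.eval env σ) (e.eval env σ))
  | .read r a, Q, σ => ∃ x, env.inp[a.eval env σ]? = some x ∧ Q (σ.set r x.toNat)
  | .seq a b, Q, σ => wp a (wp b Q) σ
  | .ite c a b, Q, σ => (c.holds env σ → wp a Q σ) ∧ (¬ c.holds env σ → wp b Q σ)
  | .loop _ _, _, _ => False

/-- The command never assigns the variable `r`. -/
def Cmd.keeps (r : ℕ) : Cmd → Bool
  | assign r' _ => !Nat.beq r r'
  | load r' _ => !Nat.beq r r'
  | store _ _ => true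
  | read r' _ => !Nat.beq r r'
  | seq a b => a.keeps r && b.keeps r
  | ite _ a b => a.keeps r && b.keeps r
  | loop _ b => b.keeps r

/-- The command never writes to memory. -/
def Cmd.noStore : Cmd → Bool
  | store _ _ => false
  | seq a b => a.noStore && b.noStore
  | ite _ a b => a.noStore && b.noStore
  | loop _ b => b.noStore
  | _ => true

/-- Variables and memory that `c` cannot change agree in `σ` and `σ'`. -/
def Frame (c : Cmd) (σ σ' : St) : Prop :=
  (∀ r, c.keeps r = true → σ'.reg r = σ.reg r) ∧ (c.noStore = true → σ'.mem = σ.mem)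

/-- The command `for i = lo, …, hi - 1 do body`. -/
def Cmd.for (i : ℕ) (lo hi : Expr) (body : Cmd) : Cmd :=
  .seq (.assign i lo) (.loop ⟨true, .var i, hi⟩
    (.seq body (.assign i (.bin .add (.var i) (.lit 1)))))

/-! ### Soundness of the frame conditions and of the proof rules. -/

variable {env}

/-- Specifications can thus be silent about what a command does not touch: for a concrete command
and variable the syntactic test holds by `rfl`. -/
theorem Cmd.Eval.frame {c : Cmd} {σ σ' : St} {n : ℕ} (h : c.Eval env σ n σ') : Frame c σ σ' := by
  induction h with
  | assign => exact ⟨fun r hr => by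
      rw [St.set_reg, if_neg]; rintro rfl; simp [Cmd.keeps] at hr, fun _ => rfl⟩
  | load => exact ⟨fun r hr => by
      rw [St.set_reg, if_neg]; rintro rfl; simp [Cmd.keeps] at hr, fun _ => rfl⟩
  | read => exact ⟨fun r hr => by
      rw [St.set_reg, if_neg]; rintro rfl; simp [Cmd.keeps] at hr, fun _ => rfl⟩
  | store => exact ⟨fun r hr => rfl, fun h => by simp [Cmd.noStore] at h⟩
  | seq _ _ ih ih' =>
    refine ⟨fun r hr => ?_, fun h => ?_⟩
    · simp only [Cmd.keeps, Bool.and_eq_true] at hr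
      rw [ih'.1 r hr.2, ih.1 r hr.1]
    · simp only [Cmd.noStore, Bool.and_eq_true] at h
      rw [ih'.2 h.2, ih.2 h.1]
  | iteT _ _ ih =>
    refine ⟨fun r hr => ?_, fun h => ?_⟩
    · simp only [Cmd.keeps, Bool.and_eq_true] at hr
      rw [ih.1 r hr.1]
    · simp only [Cmd.noStore, Bool.and_eq_true] at h
      rw [ih.2 h.1]
  | iteF _ _ ih =>
    refine ⟨fun r hr => ?_, fun h => ?_⟩
    · simp only [Cmd.keeps, Bool.and_eq_true] at hr
      rw [ih.1 r hr.2]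
    · simp only [Cmd.noStore, Bool.and_eq_true] at h
      rw [ih.2 h.2]
  | loopT _ _ _ ih ih' =>
    exact ⟨fun r hr => (ih'.1 r hr).trans (ih.1 r hr), fun h => (ih'.2 h).trans (ih.2 h)⟩
  | loopF => exact ⟨fun _ _ => rfl, fun _ => rfl⟩

theorem Tr.frame {c : Cmd} {σ : St} {t : ℕ} {Q : St → Prop} (h : Tr env c σ t Q) :
    Tr env c σ t (fun σ' => Q σ' ∧ Frame c σ σ') := by
  obtain ⟨n, hn, σ', e, q⟩ := h
  exact ⟨n, hn, σ', e, q, e.frame⟩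

theorem Tr.mono {c : Cmd} {σ : St} {t t' : ℕ} {Q Q' : St → Prop} (h : Tr env c σ t Q)
    (ht : t ≤ t') (hQ : ∀ σ', Q σ' → Q' σ') : Tr env c σ t' Q' := by
  obtain ⟨n, hn, σ', e, q⟩ := h
  exact ⟨n, hn.trans ht, σ', e, hQ _ q⟩

theorem Tr.seq {a b : Cmd} {σ : St} {t t' : ℕ} {Q R : St → Prop} (h : Tr env a σ t R)
    (h' : ∀ σ', R σ' → Frame a σ σ' → Tr env b σ' t' Q) : Tr env (.seq a b) σ (t + t') Q := by
  obtain ⟨n, hn, σ', e, q⟩ := h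
  obtain ⟨n', hn', σ'', e', q'⟩ := h' σ' q e.frame
  exact ⟨n + n', by omega, σ'', .seq e e', q'⟩

theorem wp_sound {c : Cmd} {Q : St → Prop} {σ : St} (h : wp env c Q σ) : Tr env c σ c.cost Q := by
  induction c generalizing Q σ with
  | assign r e => exact ⟨_, le_rfl, _, .assign, h⟩
  | load r e => exact ⟨_, le_rfl, _, .load h.1, h.2⟩
  | store r e => exact ⟨_, le_rfl, _, .store h.1, h.2⟩
  | read r e =>
    obtain ⟨x, hx, h⟩ := h
    exact ⟨_, le_rfl, _, .read hx, h⟩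
  | seq a b iha ihb => exact Tr.seq (iha h) fun σ' h' _ => ihb h'
  | ite c a b iha ihb =>
    by_cases hc : c.holds env σ
    · obtain ⟨n, hn, σ', e, q⟩ := iha (h.1 hc)
      exact ⟨_, by simp only [Cmd.cost]; omega, σ', .iteT hc e, q⟩
    · obtain ⟨n, hn, σ', e, q⟩ := ihb (h.2 hc)
      exact ⟨_, by simp only [Cmd.cost]; omega, σ', .iteF hc e, q⟩
  | loop => exact h.elim

theorem wp_mono {c : Cmd} {Q Q' : St → Prop} {σ : St} (h : wp env c Q σ)
    (hQ : ∀ σ', Q σ' → Frame c σ σ' → Q' σ') : wp env c Q' σ := by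
  induction c generalizing Q Q' σ with
  | assign r e => exact hQ _ h Cmd.Eval.assign.frame
  | load r e => exact ⟨h.1, hQ _ h.2 (Cmd.Eval.load h.1).frame⟩
  | store r e => exact ⟨h.1, hQ _ h.2 (Cmd.Eval.store h.1).frame⟩
  | read r e =>
    obtain ⟨x, hx, h⟩ := h
    exact ⟨x, hx, hQ _ h (Cmd.Eval.read hx).frame⟩
  | seq a b iha ihb =>
    refine iha h fun σ' h' f => ihb h' fun σ'' h'' f' => hQ _ h'' ⟨fun r hr => ?_, fun hs => ?_⟩
    · simp only [Cmd.keeps, Bool.and_eq_true] at hr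
      rw [f'.1 r hr.2, f.1 r hr.1]
    · simp only [Cmd.noStore, Bool.and_eq_true] at hs
      rw [f'.2 hs.2, f.2 hs.1]
  | ite c a b iha ihb =>
    refine ⟨fun hc => iha (h.1 hc) fun σ' h' f => hQ _ h' ⟨fun r hr => ?_, fun hs => ?_⟩,
      fun hc => ihb (h.2 hc) fun σ' h' f => hQ _ h' ⟨fun r hr => ?_, fun hs => ?_⟩⟩
    · simp only [Cmd.keeps, Bool.and_eq_true] at hr
      exact f.1 r hr.1
    · simp only [Cmd.noStore, Bool.and_eq_true] at hs
      exact f.2 hs.1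
    · simp only [Cmd.keeps, Bool.and_eq_true] at hr
      exact f.1 r hr.2
    · simp only [Cmd.noStore, Bool.and_eq_true] at hs
      exact f.2 hs.2
  | loop => exact h.elim

theorem wp_seq {a b : Cmd} {Q R : St → Prop} {σ : St} (ha : wp env a R σ)
    (hb : ∀ σ', R σ' → Frame a σ σ' → wp env b Q σ') : wp env (.seq a b) Q σ := by
  show wp env a (wp env b Q) σ
  exact wp_mono ha hb

/-- Loops, with the remaining time `φ` as a ghost variable of the invariant. -/
theorem Tr.loop {I : ℕ → St → Prop} {c : Cond} {b : Cmd}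
    (hstep : ∀ φ σ, I φ σ → c.holds env σ → ∃ t, Tr env b σ t
      (fun σ' => ∃ φ', I φ' σ' ∧ φ' + t + c.len + 1 ≤ φ)) {φ : ℕ} {σ : St} (hI : I φ σ) :
    Tr env (.loop c b) σ (φ + c.len + 1) (fun σ' => (∃ φ', I φ' σ') ∧ ¬ c.holds env σ') := by
  induction φ using Nat.strong_induction_on generalizing σ with
  | _ φ ih =>
  by_cases hc : c.holds env σ
  · obtain ⟨t, n, hn, σ', e, φ', hI', hφ⟩ := hstep φ σ hI hc
    obtain ⟨n', hn', σ'', e', q'⟩ := ih φ' (by omega) hI'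
    exact ⟨_, by omega, σ'', .loopT hc e e', q'⟩
  · exact ⟨_, by omega, σ, .loopF hc, ⟨φ, hI⟩, hc⟩

/-- The loop invariant carries the frame facts through all iterations, and its ghost time is the
cost of the iterations still to come. The cost of the body may depend on `k`: in the enumeration of
pairs only the sum over all iterations is small. -/
theorem Tr.for' {i : ℕ} {lo hi : Expr} {body : Cmd} {σ : St} {l n : ℕ} (I : ℕ → St → Prop)
    (B : ℕ → ℕ) (hln : l ≤ n) (hn : n < 2 ^ w) (hlo : lo.eval env σ = l) (hi0 : body.keeps i = true)
    (hhi : ∀ σ', (∀ r, body.keeps r = true → r ≠ i → σ'.reg r = σ.reg r) → hi.eval env σ' = n)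
    (hI : I l (σ.set i l))
    (hstep : ∀ k σ', l ≤ k → k < n → I k σ' → σ'.reg i = k →
      (∀ r, body.keeps r = true → r ≠ i → σ'.reg r = σ.reg r) →
      (body.noStore = true → σ'.mem = σ.mem) →
      Tr env body σ' (B k) (fun σ'' => I (k + 1) (σ''.set i (k + 1)))) :
    Tr env (.for i lo hi body) σ
      (lo.len + hi.len + 4 + ∑ k ∈ Finset.Ico l n, (B k + (hi.len + 8)))
      (fun σ' => I n σ' ∧ σ'.reg i = n) := by
  set J : ℕ → St → Prop := fun φ σ' => ∃ k, l ≤ k ∧ k ≤ n ∧ I k σ' ∧ σ'.reg i = k ∧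
    (∀ r, body.keeps r = true → r ≠ i → σ'.reg r = σ.reg r) ∧
    (body.noStore = true → σ'.mem = σ.mem) ∧
    φ = ∑ k ∈ Finset.Ico k n, (B k + (hi.len + 8)) with hJ
  have key := Tr.loop (env := env) (I := J) (c := ⟨true, .var i, hi⟩)
    (b := .seq body (.assign i (.bin .add (.var i) (.lit 1)))) (φ := ∑ k ∈ Finset.Ico l n,
      (B k + (hi.len + 8))) (σ := σ.set i l) ?_
    ⟨l, le_rfl, hln, hI, by simp [St.set_reg], fun r _ hr => by simp [St.set_reg, hr],
      fun _ => rfl, rfl⟩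
  · have h1 : Tr env (.assign i lo) σ (lo.len + 1) (fun σ' => σ' = σ.set i l) :=
      ⟨_, le_rfl, _, .assign, by rw [hlo]⟩
    refine (h1.seq (Q := fun σ' => (∃ φ, J φ σ') ∧ ¬ (⟨true, .var i, hi⟩ : Cond).holds env σ')
      fun σ' h _ => h ▸ key).mono ?_ ?_
    · simp only [Cond.len, Expr.len]; omega
    · rintro σ' ⟨⟨φ, k, -, hkn, hIk, hik, hr, -, -⟩, hc⟩
      have : hi.eval env σ' = n := hhi σ' hr
      simp only [Cond.holds, if_true, Expr.eval, this, hik, not_lt] at hc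
      obtain rfl : k = n := by omega
      exact ⟨hIk, hik⟩
  · rintro φ σ' ⟨k, hlk, hkn, hIk, hik, hr, hm, hφ⟩ hc
    have : hi.eval env σ' = n := hhi σ' hr
    simp only [Cond.holds, if_true, Expr.eval, this, hik] at hc
    have h2 := (hstep k σ' hlk hc hIk hik hr hm).frame.seq
      (b := .assign i (.bin .add (.var i) (.lit 1))) (t' := 4) (Q := fun σ'' => ∃ φ', J φ' σ'' ∧
        φ' = ∑ k ∈ Finset.Ico (k + 1) n, (B k + (hi.len + 8))) (fun σ'' h _ => by
      have hik' : σ''.reg i = k := (h.2.1 i hi0).trans hik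
      have he : (Expr.bin .add (.var i) (.lit 1)).eval env σ'' = k + 1 := by
        simp only [Expr.eval, BinOp.eval, hik', Nat.add_mod_mod]
        exact Nat.mod_eq_of_lt (by omega)
      refine ⟨_, le_rfl, _, .assign, _, ⟨k + 1, by omega, hc, ?_, by simp [St.set_reg, he],
        fun r hr1 hr2 => ?_, fun hs => ?_, rfl⟩, rfl⟩
      · rw [he]; exact h.1
      · rw [St.set_reg, if_neg hr2, h.2.1 r hr1, hr r hr1 hr2]
      · rw [St.set_mem, h.2.2 hs, hm hs])
    refine ⟨_, h2.mono le_rfl ?_⟩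
    rintro σ'' ⟨φ', hJ', hφ'⟩
    refine ⟨φ', hJ', ?_⟩
    rw [hφ, hφ', Finset.sum_eq_sum_Ico_succ_bot hc]
    simp only [Cond.len, Expr.len]
    omega

theorem Tr.for {i : ℕ} {lo hi : Expr} {body : Cmd} {σ : St} {l n : ℕ} (I : ℕ → St → Prop)
    (B : ℕ) (hln : l ≤ n) (hn : n < 2 ^ w) (hlo : lo.eval env σ = l) (hi0 : body.keeps i = true)
    (hhi : ∀ σ', (∀ r, body.keeps r = true → r ≠ i → σ'.reg r = σ.reg r) → hi.eval env σ' = n)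
    (hI : I l (σ.set i l))
    (hstep : ∀ k σ', l ≤ k → k < n → I k σ' → σ'.reg i = k →
      (∀ r, body.keeps r = true → r ≠ i → σ'.reg r = σ.reg r) →
      (body.noStore = true → σ'.mem = σ.mem) →
      Tr env body σ' B (fun σ'' => I (k + 1) (σ''.set i (k + 1)))) :
    Tr env (.for i lo hi body) σ ((B + hi.len + lo.len + 8) * (n - l + 1))
      (fun σ' => I n σ' ∧ σ'.reg i = n) := by
  refine (Tr.for' I (fun _ => B) hln hn hlo hi0 hhi hI hstep).mono ?_ fun _ h => h
  rw [Finset.sum_const, Nat.card_Ico, smul_eq_mul]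
  have h1 : (n - l) * (B + (hi.len + 8)) ≤ (n - l) * (B + hi.len + lo.len + 8) :=
    Nat.mul_le_mul_left _ (by omega)
  have h2 : (B + hi.len + lo.len + 8) * (n - l + 1)
      = (n - l) * (B + hi.len + lo.len + 8) + (B + hi.len + lo.len + 8) := by ring
  omega

end
end WordRam

/-! ## Packed words -/

namespace WordRam

open Finset

/-- The number with digits `y 0, …, y (n - 1)` in base `2 ^ F`. -/
def pack (F n : ℕ) (y : ℕ → ℕ) : ℕ := ∑ i ∈ range n, y i * 2 ^ (F * i)

theorem pack_succ (F n : ℕ) (y : ℕ → ℕ) : pack F (n + 1) y = 2 ^ (F * n) * y n + pack F n y := by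
  rw [pack, sum_range_succ, ← pack]; ring

theorem pack_congr {F n : ℕ} {y z : ℕ → ℕ} (h : ∀ i < n, y i = z i) : pack F n y = pack F n z :=
  sum_congr rfl fun i hi => by rw [h i (mem_range.1 hi)]

theorem pack_lt {F n : ℕ} {y : ℕ → ℕ} (h : ∀ i < n, y i < 2 ^ F) : pack F n y < 2 ^ (F * n) := by
  induction n with
  | zero => simp [pack]
  | succ n ih =>
    rw [pack_succ, mul_add, mul_one, pow_add]
    have h1 := ih fun i hi => h i (by omega)
    have h2 := h n (by omega)
    have h3 : 2 ^ (F * n) * (y n + 1) ≤ 2 ^ (F * n) * 2 ^ F := Nat.mul_le_mul_left _ h2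
    rw [mul_add, mul_one] at h3
    omega

/-- Digits below `2 ^ F` do not overlap, so bit `p` is bit `p % F` of digit `p / F`. The bitwise
facts on packed words reduce to this. -/
theorem testBit_pack {F n : ℕ} {y : ℕ → ℕ} (hF : 0 < F) (h : ∀ i < n, y i < 2 ^ F) (p : ℕ) :
    (pack F n y).testBit p = (decide (p / F < n) && (y (p / F)).testBit (p % F)) := by
  induction n with
  | zero => simp [pack]
  | succ n ih =>
    rw [pack_succ, Nat.testBit_two_pow_mul_add _ (pack_lt fun i hi => h i (by omega)),
      ih fun i hi => h i (by omega)]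
    have hp := Nat.div_add_mod p F
    have hp' := Nat.mod_lt p hF
    rcases lt_trichotomy (p / F) n with hlt | rfl | hgt
    · have : p < F * n := by
        calc p < F * (p / F) + F := by omega
          _ = F * (p / F + 1) := by ring
          _ ≤ F * n := Nat.mul_le_mul_left _ hlt
      simp [this, hlt, Nat.lt_succ_of_lt hlt]
    · have h1 : ¬ p < F * (p / F) := by omega
      have h2 : p - F * (p / F) = p % F := by omega
      simp [h1, h2]
    · have h4 : F * (n + 1) ≤ F * (p / F) := Nat.mul_le_mul_left _ hgt
      rw [mul_add, mul_one] at h4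
      have h1 : ¬ p < F * n := by omega
      have h2 : ¬ p / F < n + 1 := by omega
      have h3 : (y n).testBit (p - F * n) = false := by
        refine Nat.testBit_eq_false_of_lt ((h n (by omega)).trans_le ?_)
        exact Nat.pow_le_pow_right (by norm_num) (by omega)
      simp [h1, h2, h3]

theorem pack_digit {F n : ℕ} {y : ℕ → ℕ} (h : ∀ i < n, y i < 2 ^ F) {i : ℕ} (hi : i < n) :
    pack F n y / 2 ^ (F * i) % 2 ^ F = y i := by
  rcases Nat.eq_zero_or_pos F with rfl | hF
  · have := h i hi
    simp at this
    simp [this, Nat.mod_one]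
  refine Nat.eq_of_testBit_eq fun b => ?_
  rw [Nat.testBit_mod_two_pow, Nat.testBit_div_two_pow, testBit_pack hF h]
  by_cases hb : b < F
  · have h1 : (b + F * i) / F = i := by
      rw [Nat.add_mul_div_left _ _ hF, Nat.div_eq_of_lt hb, zero_add]
    have h2 : (b + F * i) % F = b := by
      rw [Nat.add_mul_mod_self_left, Nat.mod_eq_of_lt hb]
    simp [hb, h1, h2, hi]
  · rw [Nat.testBit_eq_false_of_lt ((h i hi).trans_le
      (Nat.pow_le_pow_right (by norm_num) (not_lt.1 hb)))]
    simp [hb]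

theorem pack_land {F n : ℕ} {y z : ℕ → ℕ} (hF : 0 < F) (hy : ∀ i < n, y i < 2 ^ F)
    (hz : ∀ i < n, z i < 2 ^ F) : pack F n y &&& pack F n z = pack F n fun i => y i &&& z i := by
  refine Nat.eq_of_testBit_eq fun b => ?_
  rw [Nat.testBit_land, testBit_pack hF hy, testBit_pack hF hz,
    testBit_pack hF fun i hi => Nat.and_lt_two_pow _ (hz i hi), Nat.testBit_land]
  cases decide (b / F < n) <;> simp

theorem pack_xor {F n : ℕ} {y z : ℕ → ℕ} (hF : 0 < F) (hy : ∀ i < n, y i < 2 ^ F)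
    (hz : ∀ i < n, z i < 2 ^ F) : pack F n y ^^^ pack F n z = pack F n fun i => y i ^^^ z i := by
  refine Nat.eq_of_testBit_eq fun b => ?_
  rw [Nat.testBit_xor, testBit_pack hF hy, testBit_pack hF hz,
    testBit_pack hF fun i hi => Nat.xor_lt_two_pow (hy i hi) (hz i hi), Nat.testBit_xor]
  cases decide (b / F < n) <;> simp

theorem pack_add (F n : ℕ) (y z : ℕ → ℕ) :
    pack F n y + pack F n z = pack F n fun i => y i + z i := by
  rw [pack, pack, pack, ← sum_add_distrib]
  exact sum_congr rfl fun i _ => by ring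

theorem mul_pack (F n x : ℕ) (y : ℕ → ℕ) : x * pack F n y = pack F n fun i => x * y i := by
  rw [pack, pack, mul_sum]
  exact sum_congr rfl fun i _ => by ring

/-- A digit of the product of two packed words. -/
theorem pack_mul_digit {F n w : ℕ} {a b : ℕ → ℕ} (hn : 0 < n) (hw : F * n ≤ w)
    (h : ∀ d < n, ∑ j ∈ range (d + 1), a j * b (d - j) < 2 ^ F) :
    pack F n a * pack F n b % 2 ^ w / 2 ^ (F * (n - 1)) % 2 ^ F
      = ∑ j ∈ range n, a j * b (n - 1 - j) := by
  set c : ℕ → ℕ := fun d => ∑ j ∈ range (d + 1), a j * b (d - j) with hc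
  -- Products of digits `i` and `j` with `i + j ≥ n` are multiples of `2 ^ (F * n)`; the others are
  -- collected by `d = i + j`.
  have hmod : pack F n a * pack F n b ≡ pack F n c [MOD 2 ^ (F * n)] := by
    have h1 : pack F n c = ∑ i ∈ range n, ∑ j ∈ range (n - i),
        a i * 2 ^ (F * i) * (b j * 2 ^ (F * j)) := by
      rw [← Finset.sum_range_diag_flip n (fun i j => a i * 2 ^ (F * i) * (b j * 2 ^ (F * j))), pack]
      refine sum_congr rfl fun d _ => ?_
      rw [hc, sum_mul]
      refine sum_congr rfl fun j hj => ?_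
      have hj' : j ≤ d := by have := mem_range.1 hj; omega
      have : 2 ^ (F * d) = 2 ^ (F * j) * 2 ^ (F * (d - j)) := by
        rw [← pow_add, ← mul_add, Nat.add_sub_cancel' hj']
      rw [this]; ring
    rw [h1, pack, sum_mul]
    refine Nat.ModEq.sum fun i hi => ?_
    have hi' : i < n := mem_range.1 hi
    rw [pack, mul_sum, ← Finset.sum_range_add_sum_Ico _ (Nat.sub_le n i)]
    conv_rhs => rw [← Nat.add_zero (∑ j ∈ range (n - i), _)]
    refine Nat.ModEq.add_left _ ?_
    refine (Nat.modEq_zero_iff_dvd).2 (Finset.dvd_sum fun j hj => ?_)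
    have hj' := (Finset.mem_Ico.1 hj).1
    have : 2 ^ (F * n) ∣ 2 ^ (F * i) * 2 ^ (F * j) := by
      rw [← pow_add, ← mul_add]
      exact pow_dvd_pow _ (Nat.mul_le_mul_left _ (by omega))
    exact this.trans ⟨a i * b j, by ring⟩
  have hP : pack F n c < 2 ^ (F * n) := pack_lt h
  have hFn : F * n = F * (n - 1) + F := by
    obtain ⟨k, rfl⟩ : ∃ k, n = k + 1 := ⟨n - 1, by omega⟩
    simp [mul_add]
  -- Since `F * n ≤ w`, truncation to a word does not affect the first `n` digits, and these are
  -- free of carries by `h`.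
  have e : pack F n a * pack F n b % 2 ^ w % 2 ^ (F * n) = pack F n c := by
    rw [Nat.mod_mod_of_dvd _ (pow_dvd_pow _ hw), hmod, Nat.mod_eq_of_lt hP]
  have hd : ∀ x, x / 2 ^ (F * (n - 1)) % 2 ^ F = x % 2 ^ (F * n) / 2 ^ (F * (n - 1)) := fun x => by
    rw [hFn, pow_add, Nat.mod_mul_right_div_self]
  rw [hd, e]
  have h2 := pack_digit h (i := n - 1) (by omega)
  rw [hd, Nat.mod_eq_of_lt hP] at h2
  rw [h2]
  simp only [Nat.sub_add_cancel hn]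

/-! ## The lowest differing bit -/

/-- The lowest bit in which `x` and `y` differ, and `B` if `x = y`. -/
noncomputable def low (B x y : ℕ) : ℕ :=
  open Classical in if h : x = y then B else Nat.find (Nat.exists_testBit_ne_of_ne h)

theorem low_self (B x : ℕ) : low B x x = B := by simp [low]

theorem low_spec {x y : ℕ} (B : ℕ) (h : x ≠ y) :
    x.testBit (low B x y) ≠ y.testBit (low B x y) ∧
      ∀ i < low B x y, x.testBit i = y.testBit i := by
  classical
  simp only [low, h, dif_neg, not_false_iff]
  exact ⟨Nat.find_spec (Nat.exists_testBit_ne_of_ne h),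
    fun i hi => not_not.1 (Nat.find_min (Nat.exists_testBit_ne_of_ne h) hi)⟩

theorem low_eq {B x y d : ℕ} (h : x.testBit d ≠ y.testBit d)
    (h' : ∀ i < d, x.testBit i = y.testBit i) : low B x y = d := by
  have hne : x ≠ y := by rintro rfl; exact h rfl
  obtain ⟨h1, h2⟩ := low_spec B hne
  rcases lt_trichotomy (low B x y) d with hl | he | hg
  · exact (h1 (h' _ hl)).elim
  · exact he
  · exact (h (h2 _ hg)).elim

theorem low_comm (B x y : ℕ) : low B x y = low B y x := by
  by_cases h : x = y
  · rw [h]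
  · obtain ⟨h1, h2⟩ := low_spec B h
    exact (low_eq h1.symm fun i hi => (h2 i hi).symm).symm

theorem low_lt {B x y n : ℕ} (h : x ≠ y) (hx : x < 2 ^ n) (hy : y < 2 ^ n) : low B x y < n := by
  by_contra hn
  have hp : 2 ^ n ≤ 2 ^ low B x y := Nat.pow_le_pow_right (by norm_num) (not_lt.1 hn)
  refine (low_spec B h).1 ?_
  rw [Nat.testBit_eq_false_of_lt (hx.trans_le hp), Nat.testBit_eq_false_of_lt (hy.trans_le hp)]

theorem low_le {B x y n : ℕ} (hB : n ≤ B) (hx : x < 2 ^ n) (hy : y < 2 ^ n) : low B x y ≤ B := by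
  by_cases h : x = y
  · rw [h, low_self]
  · exact (low_lt h hx hy).le.trans hB

theorem mod_two_pow_eq_iff (x y d : ℕ) :
    x % 2 ^ d = y % 2 ^ d ↔ ∀ i < d, x.testBit i = y.testBit i := by
  constructor
  · intro h i hi
    have := congrArg (fun z => Nat.testBit z i) h
    simpa [Nat.testBit_mod_two_pow, hi] using this
  · intro h
    refine Nat.eq_of_testBit_eq fun i => ?_
    rw [Nat.testBit_mod_two_pow, Nat.testBit_mod_two_pow]
    by_cases hi : i < d <;> simp [hi, h i]

/-- This says that `low` is the 2-adic valuation of the difference, in a form that works with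
congruences and is therefore compatible with addition and with multiplication by powers of two. -/
theorem low_eq_iff_mod {B x y d : ℕ} (h : x ≠ y) :
    low B x y = d ↔ x % 2 ^ d = y % 2 ^ d ∧ x % 2 ^ (d + 1) ≠ y % 2 ^ (d + 1) := by
  rw [mod_two_pow_eq_iff, Ne, mod_two_pow_eq_iff]
  constructor
  · rintro rfl
    obtain ⟨h1, h2⟩ := low_spec B h
    exact ⟨h2, fun h3 => h1 (h3 _ (Nat.lt_succ_self _))⟩
  · rintro ⟨h1, h2⟩
    refine low_eq (fun h3 => h2 fun i hi => ?_) h1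
    rcases Nat.lt_succ_iff_lt_or_eq.1 hi with hi | rfl
    · exact h1 i hi
    · exact h3

/-- The order of bitstrings read from the lowest bit. -/
def RevLe (x y : ℕ) : Prop := x = y ∨ x.testBit (low 0 x y) = false

theorem low_congr {B B' x y : ℕ} (h : x ≠ y) : low B x y = low B' x y := by
  obtain ⟨h1, h2⟩ := low_spec B' h
  exact low_eq h1 h2

theorem revLe_of_not {x y : ℕ} (h : ¬ RevLe x y) : RevLe y x := by
  simp only [RevLe, not_or] at h ⊢
  right
  have := (low_spec 0 h.1).1
  rw [low_comm]
  revert this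
  cases y.testBit (low 0 x y) <;> simp_all

/-- Three keys in order. -/
theorem RevLe.three {B x y z : ℕ} (hxy : RevLe x y) (hyz : RevLe y z) (hB1 : low B x y ≤ B)
    (hB2 : low B y z ≤ B) : RevLe x z ∧ low B x z = min (low B x y) (low B y z) := by
  by_cases h1 : x = y
  · subst h1
    exact ⟨hyz, by rw [low_self, min_eq_right hB2]⟩
  by_cases h2 : y = z
  · subst h2
    exact ⟨hxy, by rw [low_self, min_eq_left hB1]⟩
  have a := hxy.resolve_left h1
  have b := hyz.resolve_left h2
  rw [low_congr (B' := B) h1] at a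
  rw [low_congr (B' := B) h2] at b
  obtain ⟨a1, a2⟩ := low_spec B h1
  obtain ⟨b1, b2⟩ := low_spec B h2
  -- At the smaller of the two positions one adjacent pair differs, upwards from 0 to 1, while the
  -- other pair still agrees. The positions cannot coincide, since the middle key would need both
  -- values there.
  have key : x.testBit (min (low B x y) (low B y z)) = false ∧
      z.testBit (min (low B x y) (low B y z)) = true := by
    rcases lt_trichotomy (low B x y) (low B y z) with h | h | h
    · rw [min_eq_left h.le]
      refine ⟨a, ?_⟩
      rw [← b2 _ h]
      revert a1; rw [a]; cases y.testBit (low B x y) <;> simp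
    · rw [h] at a a1
      simp [a, b] at a1
    · rw [min_eq_right h.le]
      refine ⟨by rw [a2 _ h, b], ?_⟩
      revert b1; rw [b]; cases z.testBit (low B y z) <;> simp
  have hne : x ≠ z := by rintro rfl; simp [key.1] at key
  have hl : low B x z = min (low B x y) (low B y z) := by
    refine low_eq (by rw [key.1, key.2]; simp) fun i hi => ?_
    rw [a2 i (lt_of_lt_of_le hi (min_le_left _ _)), b2 i (lt_of_lt_of_le hi (min_le_right _ _))]
  refine ⟨Or.inr ?_, hl⟩
  rw [low_congr (B' := B) hne, hl, key.1]

end WordRam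

/-! ## Parameters depending on the word length -/

namespace WordRam

open Finset

/-- Parameters are powers of two wherever possible, so that divisions become shifts and remainders
become masks. -/
def lgN (w : ℕ) : ℕ := Nat.log 2 w
def lgS (w : ℕ) : ℕ := lgN w / 2
/-- The width of the chunks for logarithms. -/
def rt (w : ℕ) : ℕ := 2 ^ lgS w
/-- The number of positive multiples of `rt w` below `w`. -/
def rk (w : ℕ) : ℕ := (w - 1) / rt w
/-- The width of the chunks for hashing. -/
def ck (E w : ℕ) : ℕ := 2 ^ (lgS w + E)
/-- The number of fields of width `8 * ck E w`. -/
def gs (E w : ℕ) : ℕ := 2 ^ (lgN w - lgS w - E - 3)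
/-- The number of fields of width `2 * ck E w`. -/
def qs (E w : ℕ) : ℕ := 2 ^ (lgN w - lgS w - E - 1)

/-- The constants depending on the word length. -/
def consts (E w : ℕ) : List ℕ :=
  -- Entries 0 to 5 serve to locate the lowest bit of a word: counting multiples of `rt w`, then
  -- spreading a power of two over the fields and selecting one of them.
  [rt w,
   pack (rt w) (rk w) fun _ => 1,
   rt w * (rk w - 1),
   2 ^ rt w - 1,
   pack (rt w) (rt w) fun _ => 1,
   pack (rt w) (rt w) fun i => 2 ^ i,
   -- Entry 6 stands for the lowest differing bit of equal words. Entries 7 and 8 split a bit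
   -- position into chunk number and offset.
   2 ^ (lgN w + 1),
   lgS w + E,
   ck E w - 1,
   -- Entries 9 to 14 evaluate linear combinations: the mask for every second chunk, the mask and
   -- the position of the digit that holds the inner product, the field width, and the shifts to the
   -- four parts. Entries 15 to 17 deal with chunk numbers: how many there are, and how to split one
   -- at `2 * qs E w`.
   pack (2 * ck E w) (qs E w) fun _ => 2 ^ ck E w - 1,
   2 ^ (2 * ck E w) - 1,
   2 * ck E w * (qs E w - 1),
   2 * ck E w,
   2 ^ lgN w,
   ck E w,
   4 * qs E w,
   2 * qs E w - 1,
   lgN w - lgS w - E,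
   -- Entries 18 to 23 are for the parallel tests: copying to all fields, forcing carries,
   -- extracting and collecting them. Entries 24 to 26 turn the number of a state into a word number
   -- and a shift.
   pack (8 * ck E w) (gs E w) fun _ => 1,
   pack (8 * ck E w) (gs E w) fun _ => 2 ^ (4 * ck E w) - 1,
   4 * ck E w,
   pack (8 * ck E w - 1) (gs E w) fun _ => 1,
   (8 * ck E w - 1) * (gs E w - 1),
   2 ^ gs E w - 1,
   lgN w - lgS w - E - 3,
   gs E w - 1,
   lgS w + E + 3,
   gs E w,
   qs E w - 1,
   2 ^ ck E w - 1]

def wordConsts (E w i : ℕ) : BitVec w := BitVec.ofNat w ((consts E w).getD i 0)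

section
variable {E w : ℕ}

theorem lgN_le (h : w ≠ 0) : 2 ^ lgN w ≤ w := Nat.pow_log_le_self 2 h
theorem lt_lgN : w < 2 ^ (lgN w + 1) := Nat.lt_pow_succ_log_self (by norm_num) w

theorem rt_mul_rt_le (h : w ≠ 0) : rt w * rt w ≤ w := by
  refine le_trans ?_ (lgN_le h)
  rw [rt, ← pow_add]
  exact Nat.pow_le_pow_right (by norm_num) (by unfold lgS; omega)

/-- One factor 2 is lost in rounding the logarithm of `w`, another in halving it when it is odd. So
`rt w` is within a factor 2 of the square root of `w`. -/
theorem lt_rt_mul_rt : w < 4 * (rt w * rt w) := by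
  refine lt_of_lt_of_le lt_lgN ?_
  rw [rt, ← pow_add, show (4 : ℕ) = 2 ^ 2 by norm_num, ← pow_add]
  exact Nat.pow_le_pow_right (by norm_num) (by unfold lgS; omega)

theorem ne_zero_of_lgS (h : E + 3 ≤ lgS w) : w ≠ 0 := by
  rintro rfl; simp [lgS, lgN] at h

theorem field_mul_gs (h : E + 3 ≤ lgS w) : 8 * ck E w * gs E w = 2 ^ lgN w := by
  rw [ck, gs, show (8 : ℕ) = 2 ^ 3 by norm_num, ← pow_add, ← pow_add]
  congr 1; unfold lgS at *; omega

theorem field_mul_qs (h : E + 3 ≤ lgS w) : 2 * ck E w * qs E w = 2 ^ lgN w := by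
  rw [ck, qs, ← pow_succ', ← pow_add]
  congr 1; unfold lgS at *; omega

theorem two_mul_qs (h : E + 3 ≤ lgS w) : 2 * qs E w = 2 ^ (lgN w - lgS w - E) := by
  rw [qs, ← pow_succ']
  congr 1; unfold lgS at *; omega

theorem rt_le_ck : rt w ≤ ck E w := Nat.pow_le_pow_right (by norm_num) (by omega)
theorem ck_pos : 0 < ck E w := by unfold ck; positivity
theorem qs_pos : 0 < qs E w := by unfold qs; positivity
theorem gs_pos : 0 < gs E w := by unfold gs; positivity
theorem rt_pos : 0 < rt w := by unfold rt; positivity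

theorem le_rt (h : E + 3 ≤ lgS w) : 8 ≤ rt w :=
  (show 8 = 2 ^ 3 by norm_num).trans_le (Nat.pow_le_pow_right (by norm_num) (by omega))

theorem gs_le (h : E + 3 ≤ lgS w) : 4 * gs E w ≤ rt w := by
  rw [gs, rt, show (4 : ℕ) = 2 ^ 2 by norm_num, ← pow_add]
  exact Nat.pow_le_pow_right (by norm_num) (by unfold lgS at *; omega)

theorem rk_lt : rk w < 4 * rt w := by
  rw [rk, Nat.div_lt_iff_lt_mul rt_pos]
  have := lt_rt_mul_rt (w := w)
  rw [← mul_assoc] at this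
  omega

theorem rk_pos (h : E + 3 ≤ lgS w) : 0 < rk w := by
  refine Nat.div_pos ?_ rt_pos
  have h1 := rt_mul_rt_le (ne_zero_of_lgS h)
  have := le_rt h
  nlinarith [Nat.le_sub_one_of_lt (lt_of_lt_of_le (show rt w < rt w * rt w by nlinarith) h1)]

theorem rt_mul_rk_lt (h : E + 3 ≤ lgS w) : rt w * rk w < w := by
  have := Nat.mul_div_le (w - 1) (rt w)
  have h1 := ne_zero_of_lgS h
  unfold rk; omega

theorem four_mul_lt_two_pow {n : ℕ} (h : 8 ≤ n) : 16 * n < 2 ^ n := by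
  induction n, h using Nat.le_induction with
  | base => norm_num
  | succ n hn ih => rw [pow_succ]; omega

theorem le_w (h : E + 3 ≤ lgS w) : 64 ≤ w := by
  have := rt_mul_rt_le (ne_zero_of_lgS h)
  have := le_rt h
  nlinarith

theorem lgN_lt (h : E + 3 ≤ lgS w) : 2 ^ (lgN w + 1) < 2 ^ w := by
  have := lgN_le (ne_zero_of_lgS h)
  have := four_mul_lt_two_pow (n := w) (by have := le_w h; omega)
  rw [pow_succ]; omega

/-- Each packed constant occupies at most `w` bits, and the remaining entries are of size O(w) or
are masks of at most `w` bits. -/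
theorem consts_lt (h : E + 3 ≤ lgS w) (i : ℕ) : (consts E w).getD i 0 < 2 ^ w := by
  have hN := lgN_le (ne_zero_of_lgS h)
  have hN2 := lgN_lt h
  have hw := four_mul_lt_two_pow (n := w) (by have := le_w h; omega)
  have hg := field_mul_gs h
  have hq := field_mul_qs h
  have hr := rt_mul_rt_le (ne_zero_of_lgS h)
  have hrk := rt_mul_rk_lt h
  have h8 := le_rt h
  have hk := ck_pos (E := E) (w := w)
  have hqp := qs_pos (E := E) (w := w)
  have hgp := gs_pos (E := E) (w := w)
  have hrkp := rk_pos h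
  have c1 : rt w ≤ w := le_trans (by nlinarith) hr
  have c2 : ck E w ≤ 2 ^ lgN w := by
    calc ck E w ≤ 2 * ck E w * qs E w := by nlinarith
      _ = _ := hq
  have c3 : 8 * ck E w ≤ 2 ^ lgN w := by
    calc 8 * ck E w ≤ 8 * ck E w * gs E w := by nlinarith
      _ = _ := hg
  have c4 : 8 * gs E w ≤ 2 ^ lgN w := by
    calc 8 * gs E w ≤ 8 * ck E w * gs E w := by nlinarith
      _ = _ := hg
  have c5 : 2 * qs E w ≤ 2 ^ lgN w := by
    calc 2 * qs E w ≤ 2 * ck E w * qs E w := by nlinarith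
      _ = _ := hq
  have pk : ∀ {F n : ℕ} {y : ℕ → ℕ}, F * n ≤ w → (∀ i < n, y i < 2 ^ F) → pack F n y < 2 ^ w :=
    fun hF hy => (pack_lt hy).trans_le (Nat.pow_le_pow_right (by norm_num) hF)
  have p2 : ∀ {n : ℕ}, n ≤ w → 2 ^ n - 1 < 2 ^ w := fun {n} hn => by
    have : 2 ^ n ≤ 2 ^ w := Nat.pow_le_pow_right (by norm_num) hn
    have := Nat.one_le_two_pow (n := n)
    omega
  have p1 : ∀ {n : ℕ}, n ≠ 0 → (1 : ℕ) < 2 ^ n := fun hn => Nat.one_lt_two_pow hn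
  have p3 : ∀ {n : ℕ}, 2 ^ n - 1 < 2 ^ n := fun {n} => by
    have := Nat.one_le_two_pow (n := n)
    omega
  have lg1 : lgN w < w := lt_of_lt_of_le Nat.lt_two_pow_self hN
  have hlS : lgS w ≤ lgN w := Nat.div_le_self _ _
  have hE : E + lgS w ≤ lgN w := by unfold lgS at *; omega
  have c6 : 2 * ck E w * (qs E w - 1) ≤ w :=
    le_trans (Nat.mul_le_mul_left _ (Nat.sub_le _ _)) (hq.trans_le hN)
  have c7 : (8 * ck E w - 1) * (gs E w - 1) ≤ w :=
    le_trans (Nat.mul_le_mul (Nat.sub_le _ _) (Nat.sub_le _ _)) (hg.trans_le hN)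
  have c8 : (8 * ck E w - 1) * gs E w ≤ w :=
    le_trans (Nat.mul_le_mul (Nat.sub_le _ _) le_rfl) (hg.trans_le hN)
  have c9 : rt w * (rk w - 1) ≤ w :=
    le_trans (Nat.mul_le_mul_left _ (Nat.sub_le _ _)) hrk.le
  have ww : w < 2 ^ w := Nat.lt_two_pow_self
  by_cases hi : i < 30
  · interval_cases i <;> simp only [consts, List.getD_cons_zero, List.getD_cons_succ]
    · omega
    · exact pk hrk.le fun _ _ => p1 (by omega)
    · omega
    · exact p2 c1
    · exact pk hr fun _ _ => p1 (by omega)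
    · exact pk hr fun i hi => Nat.pow_lt_pow_right (by norm_num) hi
    · omega
    · omega
    · omega
    · refine pk (by omega) fun _ _ => p3.trans_le (Nat.pow_le_pow_right (by norm_num) (by omega))
    · exact p2 (by omega)
    · omega
    · omega
    · omega
    · omega
    · omega
    · omega
    · omega
    · exact pk (by omega) fun _ _ => p1 (by omega)
    · refine pk (by omega) fun _ _ => p3.trans_le (Nat.pow_le_pow_right (by norm_num) (by omega))
    · omega
    · exact pk (by omega) fun _ _ => p1 (by omega)
    · omega
    · exact p2 (by omega)
    · omega
    · omega
    · omega
    · omega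
    · omega
    · exact p2 (by omega)
  · rw [List.getD_eq_default]
    · positivity
    · simp [consts]; omega

theorem toNat_wordConsts (h : E + 3 ≤ lgS w) (i : ℕ) :
    (wordConsts E w i).toNat = (consts E w).getD i 0 := by
  rw [wordConsts, BitVec.toNat_ofNat, Nat.mod_eq_of_lt (consts_lt h i)]

end

/-! ## Notation for expressions -/

instance : Add Expr := ⟨.bin .add⟩
instance : Sub Expr := ⟨.bin .sub⟩
instance : Mul Expr := ⟨.bin .mul⟩
instance : AndOp Expr := ⟨.bin .and⟩
instance : OrOp Expr := ⟨.bin .or⟩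
instance : XorOp Expr := ⟨.bin .xor⟩
instance : ShiftLeft Expr := ⟨.bin .shl⟩
instance : ShiftRight Expr := ⟨.bin .shr⟩

section
variable {w : ℕ} (env : RamEnv w) (σ : St) (a b : Expr)

theorem eval_add : (a + b).eval env σ = (a.eval env σ + b.eval env σ) % 2 ^ w := rfl
theorem eval_sub : (a - b).eval env σ = (2 ^ w - b.eval env σ + a.eval env σ) % 2 ^ w := rfl
theorem eval_mul : (a * b).eval env σ = (a.eval env σ * b.eval env σ) % 2 ^ w := rfl
theorem eval_and : (a &&& b).eval env σ = a.eval env σ &&& b.eval env σ := rfl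
theorem eval_or : (a ||| b).eval env σ = a.eval env σ ||| b.eval env σ := rfl
theorem eval_xor : (a ^^^ b).eval env σ = a.eval env σ ^^^ b.eval env σ := rfl
theorem eval_shl : (a <<< b).eval env σ = (a.eval env σ <<< b.eval env σ) % 2 ^ w := rfl
theorem eval_shr : (a >>> b).eval env σ = a.eval env σ >>> b.eval env σ := rfl
theorem eval_var (r : ℕ) : (Expr.var r).eval env σ = σ.reg r := rfl

end

theorem eval_lit {w : ℕ} {env : RamEnv w} {σ : St} {n : ℕ} (h : n < 2 ^ w) :
    (Expr.lit n).eval env σ = n := Nat.mod_eq_of_lt h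

end WordRam

/-! ## Binary logarithms in constant time -/

namespace WordRam

open Finset

/-- The bits up to the lowest one of `e`. -/
def lowMaskE (e : Expr) : Expr := e ^^^ (e - .lit 1)

/-- For `2 ^ (d + 1) - 1` the number `d / rt w`. -/
def chunkE (m : Expr) : Expr := ((((m >>> .wc 0) &&& .wc 1) * .wc 1) >>> .wc 2) &&& .wc 3

/-- The logarithm of the lowest bit, given the bits up to the lowest one. -/
def lgMaskE (m : Expr) : Expr :=
  chunkE m * .wc 0 + chunkE (lowMaskE
    (((((m >>> .lit 1) + .lit 1) >>> (chunkE m * .wc 0)) * .wc 4) &&& .wc 5))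

/-- The position of the lowest bit. -/
def lgE (e : Expr) : Expr := lgMaskE (lowMaskE e)

/-- The lowest bit in which `a` and `b` differ. -/
def lowCmd (r : ℕ) (a b : Expr) : Cmd :=
  .ite ⟨false, a, b⟩ (.assign r (.wc 6)) (.assign r (lgE (a ^^^ b)))

section
variable {E w : ℕ}

/-- Subtracting one clears the lowest one, sets the bits below it, and leaves the bits above it
alone. -/
theorem xor_pred {z d : ℕ} (h : z.testBit d = true) (h' : ∀ i < d, z.testBit i = false) :
    z ^^^ (z - 1) = 2 ^ (d + 1) - 1 := by
  have hm : z % 2 ^ (d + 1) = 2 ^ d := by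
    refine Nat.eq_of_testBit_eq fun i => ?_
    rw [Nat.testBit_mod_two_pow, Nat.testBit_two_pow]
    rcases lt_trichotomy i d with hi | rfl | hi
    · simp [h' i hi, hi.ne']
    · simp [h]
    · have : ¬ i < d + 1 := by omega
      simp [this, hi.ne]
  have hz : z = 2 ^ (d + 1) * (z / 2 ^ (d + 1)) + 2 ^ d := by
    conv_lhs => rw [← Nat.div_add_mod z (2 ^ (d + 1)), hm]
  have hp : (2 : ℕ) ^ d < 2 ^ (d + 1) := Nat.pow_lt_pow_right (by norm_num) (by omega)
  have h1 : 1 ≤ 2 ^ d := Nat.one_le_two_pow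
  have hz' : z - 1 = 2 ^ (d + 1) * (z / 2 ^ (d + 1)) + (2 ^ d - 1) := by omega
  generalize z / 2 ^ (d + 1) = q at hz hz'
  refine Nat.eq_of_testBit_eq fun i => ?_
  rw [Nat.testBit_xor, hz', Nat.testBit_two_pow_mul_add _ (by omega), Nat.testBit_two_pow_sub_one]
  conv_lhs => rw [hz]
  rw [Nat.testBit_two_pow_mul_add _ hp, Nat.testBit_two_pow_sub_one, Nat.testBit_two_pow]
  rcases lt_trichotomy i d with hi | rfl | hi
  · simp [hi, hi.ne', Nat.lt_succ_of_lt hi]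
  · simp
  · have : ¬ i < d + 1 := by omega
    simp [this]

/-- The quotient is the number of positive multiples of `rt w` up to `d`. Shift and mask leave one
flag for each of them, and multiplication by a packed word of ones adds up all flags in the top
digit. Digits are at most `rk w < 4 * rt w`, so they do not overflow. -/
theorem chunk_popcount (h : E + 3 ≤ lgS w) {d : ℕ} (hd : d < w) :
    ((((2 ^ (d + 1) - 1) >>> rt w &&& pack (rt w) (rk w) fun _ => 1) *
      pack (rt w) (rk w) fun _ => 1) % 2 ^ w) >>> (rt w * (rk w - 1)) &&& (2 ^ rt w - 1)
      = d / rt w := by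
  have hr := rt_pos (w := w)
  have h8 := le_rt h
  have hone : (1 : ℕ) < 2 ^ rt w := Nat.one_lt_two_pow (by omega)
  have hc : d / rt w ≤ rk w := Nat.div_le_div_right (by omega)
  have h1 : ((2 ^ (d + 1) - 1) >>> rt w &&& pack (rt w) (rk w) fun _ => 1)
      = pack (rt w) (rk w) fun j => if j < d / rt w then 1 else 0 := by
    refine Nat.eq_of_testBit_eq fun p => ?_
    rw [Nat.testBit_land, Nat.testBit_shiftRight, Nat.testBit_two_pow_sub_one,
      testBit_pack hr fun _ _ => hone, testBit_pack hr fun i _ => by split <;> omega]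
    by_cases hp : p % rt w = 0
    · have hp2 : p = rt w * (p / rt w) := by
        have := Nat.div_add_mod p (rt w); omega
      have : (rt w + p < d + 1) ↔ p / rt w < d / rt w := by
        have h2 := Nat.le_div_iff_mul_le hr (x := p / rt w + 1) (y := d)
        rw [show (p / rt w + 1) * rt w = p + rt w by rw [add_mul, one_mul, mul_comm, ← hp2]] at h2
        omega
      rw [hp]
      by_cases h3 : p / rt w < d / rt w
      · simp [this.2 h3, h3]
      · have h4 : ¬ (rt w + p < d + 1) := fun h => h3 (this.1 h)
        simp [h4, h3]
    · have : ∀ x : ℕ, x ≤ 1 → x.testBit (p % rt w) = false := fun x hx =>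
        Nat.testBit_eq_false_of_lt (lt_of_le_of_lt hx (Nat.one_lt_two_pow hp))
      rw [this 1 le_rfl, this _ (by split <;> omega)]
      simp
  rw [h1, Nat.and_two_pow_sub_one_eq_mod, Nat.shiftRight_eq_div_pow,
    pack_mul_digit (rk_pos h) (rt_mul_rk_lt h).le]
  · rw [← Finset.sum_filter_add_sum_filter_not _ (fun j => j < d / rt w)]
    rw [Finset.sum_congr rfl (g := fun _ => 1), Finset.sum_congr (s₁ := filter _ _)
      (s₂ := filter (fun j => ¬ j < d / rt w) (range (rk w))) rfl (g := fun _ => 0)]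
    · rw [Finset.sum_const_zero, Finset.sum_const, smul_eq_mul, mul_one, add_zero]
      have : filter (fun j => j < d / rt w) (range (rk w)) = range (d / rt w) := by
        ext j; simp; omega
      rw [this, card_range]
    · intro j hj; simp [(mem_filter.1 hj).2]
    · intro j hj; simp [(mem_filter.1 hj).2]
  · intro e he
    calc _ ≤ ∑ j ∈ range (e + 1), 1 := Finset.sum_le_sum fun j _ => by split <;> omega
      _ = e + 1 := by simp
      _ < 2 ^ rt w := by
        have := rk_lt (w := w)
        have := four_mul_lt_two_pow h8
        omega

variable {env : RamEnv w}

theorem eval_wc (h : E + 3 ≤ lgS w) (hc : env.const = wordConsts E w) (σ : St) (i : ℕ) :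
    (Expr.wc i).eval env σ = (consts E w).getD i 0 := by
  rw [Expr.eval, hc, toNat_wordConsts h]

theorem eval_lowMaskE {σ : St} {e : Expr} {z d : ℕ} (he : e.eval env σ = z)
    (hz : z < 2 ^ w) (hd : z.testBit d = true) (hd' : ∀ i < d, z.testBit i = false) :
    (lowMaskE e).eval env σ = 2 ^ (d + 1) - 1 := by
  have hz0 : z ≠ 0 := by rintro rfl; simp at hd
  have h1 : 1 < 2 ^ w := by omega
  rw [lowMaskE, eval_xor, eval_sub, eval_lit h1, he, ← xor_pred hd hd']
  congr 1
  rw [show 2 ^ w - 1 + z = 2 ^ w + (z - 1) by omega, Nat.add_mod_left, Nat.mod_eq_of_lt (by omega)]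

theorem eval_chunkE (h : E + 3 ≤ lgS w) (hc : env.const = wordConsts E w) {σ : St} {m : Expr}
    {d : ℕ} (hd : d < w) (hm : m.eval env σ = 2 ^ (d + 1) - 1) :
    (chunkE m).eval env σ = d / rt w := by
  rw [chunkE, eval_and, eval_shr, eval_mul, eval_and, eval_shr, eval_wc h hc, eval_wc h hc,
    eval_wc h hc, eval_wc h hc, hm]
  exact chunk_popcount h hd

/-- With `r = d % rt w`, the count of multiples gives the quotient, and shifting `2 ^ d` down leaves
`2 ^ r`. Copying `2 ^ r` into all fields and keeping only bit `i` of field `i` leaves the single bit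
`rt w * r + r`, so a second count, of the multiples of `rt w` up to this position, returns `r`. -/
theorem eval_lgMaskE (h : E + 3 ≤ lgS w) (hc : env.const = wordConsts E w) {σ : St} {m : Expr}
    {d : ℕ} (hd : d < w) (hm : m.eval env σ = 2 ^ (d + 1) - 1) :
    (lgMaskE m).eval env σ = d := by
  have hr := rt_pos (w := w)
  have h8 := le_rt h
  have hw := rt_mul_rt_le (ne_zero_of_lgS h)
  have h1w : 1 < 2 ^ w := Nat.one_lt_two_pow (ne_zero_of_lgS h)
  have hww : w < 2 ^ w := Nat.lt_two_pow_self
  have hdm := Nat.div_add_mod d (rt w)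
  have hrl := Nat.mod_lt d hr
  have e1 : (chunkE m * Expr.wc 0).eval env σ = d / rt w * rt w := by
    rw [eval_mul, eval_chunkE h hc hd hm, eval_wc h hc]
    refine Nat.mod_eq_of_lt (lt_of_le_of_lt ?_ hww)
    exact (Nat.div_mul_le_self d (rt w)).trans hd.le
  set r := d % rt w with hrdef
  have e2 : (((((m >>> .lit 1) + .lit 1) >>> (chunkE m * .wc 0)) * .wc 4) &&& .wc 5 : Expr).eval
      env σ = 2 ^ (rt w * r + r) := by
    rw [eval_and, eval_mul, eval_shr, e1, eval_add, eval_shr, eval_lit h1w, hm, eval_wc h hc,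
      eval_wc h hc]
    have s1 : (2 ^ (d + 1) - 1) >>> 1 + 1 = 2 ^ d := by
      rw [Nat.shiftRight_eq_div_pow, pow_succ]
      have := Nat.one_le_two_pow (n := d)
      omega
    have s2 : (2 : ℕ) ^ d % 2 ^ w = 2 ^ d :=
      Nat.mod_eq_of_lt (Nat.pow_lt_pow_right (by norm_num) hd)
    have s3 : (2 : ℕ) ^ d >>> (d / rt w * rt w) = 2 ^ r := by
      rw [Nat.shiftRight_eq_div_pow, Nat.pow_div (Nat.div_mul_le_self _ _) (by norm_num)]
      congr 1
      rw [hrdef, mul_comm]; omega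
    have hlt : ∀ i < rt w, (2 : ℕ) ^ i < 2 ^ rt w := fun i hi =>
      Nat.pow_lt_pow_right (by norm_num) hi
    rw [s1, s2, s3]
    show 2 ^ r * (pack (rt w) (rt w) fun _ => 1) % 2 ^ w &&& (pack (rt w) (rt w) fun i => 2 ^ i) = _
    rw [mul_pack, Nat.mod_eq_of_lt, pack_land hr (fun i hi => by simpa using hlt r hrl) hlt]
    · have : ∀ i, (2 ^ r * 1 &&& 2 ^ i) = if i = r then 2 ^ r else 0 := fun i => by
        refine Nat.eq_of_testBit_eq fun b => ?_
        rw [Nat.testBit_land, mul_one, Nat.testBit_two_pow, Nat.testBit_two_pow]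
        split
        · rename_i hi; simp [hi, Nat.testBit_two_pow]
        · rename_i hi; simp; omega
      simp only [this, pack, ite_mul, zero_mul]
      rw [Finset.sum_ite_eq' (range (rt w)) r, if_pos (mem_range.2 hrl), ← pow_add, add_comm]
    · refine (pack_lt fun i _ => ?_).trans_le (Nat.pow_le_pow_right (by norm_num) hw)
      simpa using hlt r hrl
  have hlt : rt w * r + r < w := by
    have : rt w * (r + 1) ≤ rt w * rt w := Nat.mul_le_mul_left _ hrl
    rw [mul_add, mul_one] at this
    omega
  have e3 := eval_lowMaskE e2 (Nat.pow_lt_pow_right (by norm_num) hlt) (d := rt w * r + r)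
    (by simp) (fun i hi => by rw [Nat.testBit_two_pow]; simp; omega)
  have e4 := eval_chunkE h hc hlt e3
  rw [lgMaskE, eval_add, e1, e4, Nat.mul_add_div hr, Nat.div_eq_of_lt hrl, add_zero, mul_comm,
    Nat.mod_eq_of_lt (by omega)]
  omega

theorem eval_lgE (h : E + 3 ≤ lgS w) (hc : env.const = wordConsts E w) {σ : St} {e : Expr}
    {z d : ℕ} (he : e.eval env σ = z) (hz : z < 2 ^ w) (hd : z.testBit d = true)
    (hd' : ∀ i < d, z.testBit i = false) : (lgE e).eval env σ = d := by
  have hdw : d < w := by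
    by_contra hn
    rw [Nat.testBit_eq_false_of_lt (hz.trans_le (Nat.pow_le_pow_right (by norm_num)
      (not_lt.1 hn)))] at hd
    simp at hd
  exact eval_lgMaskE h hc hdw (eval_lowMaskE he hz hd hd')

/-- The value standing for the lowest differing bit of equal words. -/
def big (w : ℕ) : ℕ := 2 ^ (lgN w + 1)

theorem wp_lowCmd (h : E + 3 ≤ lgS w) (hc : env.const = wordConsts E w) {σ : St} {a b : Expr}
    {x y : ℕ} {r : ℕ} {Q : St → Prop} (ha : a.eval env σ = x) (hb : b.eval env σ = y)
    (hx : x < 2 ^ w) (hy : y < 2 ^ w) (hQ : Q (σ.set r (low (big w) x y))) :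
    wp env (lowCmd r a b) Q σ := by
  refine ⟨fun h' => ?_, fun h' => ?_⟩
  · have h' : x = y := by simpa [Cond.holds, ha, hb] using h'
    subst h'
    rw [low_self] at hQ
    simp only [wp]
    rwa [eval_wc h hc]
  · have h' : x ≠ y := by simpa [Cond.holds, ha, hb] using h'
    obtain ⟨h1, h2⟩ := low_spec (big w) h'
    simp only [wp]
    rwa [eval_lgE h hc (z := x ^^^ y) (d := low (big w) x y) (by rw [eval_xor, ha, hb])
      (Nat.xor_lt_two_pow hx hy)]
    · rw [Nat.testBit_xor]; revert h1
      cases x.testBit (low (big w) x y) <;> cases y.testBit (low (big w) x y) <;> simp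
    · intro i hi
      rw [Nat.testBit_xor, h2 i hi]; simp

end
end WordRam

/-! ## Parallel tests on packed fields -/

namespace WordRam

open Finset

/-- From a packed word, one bit for every field that is not zero. -/
def gatherE (e : Expr) : Expr :=
  (((((e + .wc 19) >>> .wc 20) &&& .wc 18) * .wc 21) >>> .wc 22) &&& .wc 23

/-- Combine the fields of the packed word number `var 20` at `base` with `var 23`. -/
def parBody (o : BinOp) (base : ℕ) : Cmd :=
  .seq (.load 21 (.lit base + .var 20))
    (.assign 22 (.var 22 ||| (gatherE (.bin o (.var 23 * .wc 18) (.var 21)) <<<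
      (.var 20 <<< .wc 24))))

/-- For every field of the `n` packed words at `base`, one bit in `var 22` that tells whether the
combination of the field with `var 23` is not zero. -/
def parCmd (o : BinOp) (base n : ℕ) : Cmd :=
  .seq (.assign 22 (.lit 0)) (.for 20 (.lit 0) (.lit n) (parBody o base))

def parCost (o : BinOp) (base n : ℕ) : ℕ := 2 + ((parBody o base).cost + 1 + 1 + 8) * (n + 1)

section
variable {E w : ℕ}

theorem gs_lt_field (h : E + 3 ≤ lgS w) : gs E w ≤ 8 * ck E w - 1 := by
  have := gs_le h
  have := rt_le_ck (E := E) (w := w)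
  have := ck_pos (E := E) (w := w)
  omega

theorem field_mul_gs_le (h : E + 3 ≤ lgS w) : 8 * ck E w * gs E w ≤ w :=
  (field_mul_gs h).trans_le (lgN_le (ne_zero_of_lgS h))

/-- Adding `2 ^ (4 * ck E w) - 1` to a value below `2 ^ (4 * ck E w)` carries into bit `4 * ck E w`
exactly if the value is not 0. Fields are twice as wide as the values, so the carry stays in its
field. -/
theorem gather_flags (h : E + 3 ≤ lgS w) {z : ℕ → ℕ} (hz : ∀ j < gs E w, z j < 2 ^ (4 * ck E w)) :
    ((pack (8 * ck E w) (gs E w) z +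
      pack (8 * ck E w) (gs E w) fun _ => 2 ^ (4 * ck E w) - 1) % 2 ^ w) >>> (4 * ck E w) &&&
      (pack (8 * ck E w) (gs E w) fun _ => 1)
      = pack (8 * ck E w) (gs E w) fun j => if z j = 0 then 0 else 1 := by
  have hk := ck_pos (E := E) (w := w)
  have h4 : (0 : ℕ) < 2 ^ (4 * ck E w) := by positivity
  have h8 : (2 : ℕ) ^ (8 * ck E w) = 2 ^ (4 * ck E w) * 2 ^ (4 * ck E w) := by
    rw [← pow_add]; congr 1; omega
  have hb : ∀ j < gs E w, z j + (2 ^ (4 * ck E w) - 1) < 2 ^ (4 * ck E w + 1) := fun j hj => by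
    have := hz j hj
    rw [pow_succ]; omega
  have hb' : ∀ j < gs E w, z j + (2 ^ (4 * ck E w) - 1) < 2 ^ (8 * ck E w) := fun j hj =>
    (hb j hj).trans_le (Nat.pow_le_pow_right (by norm_num) (by omega))
  have hone : (1 : ℕ) < 2 ^ (8 * ck E w) := Nat.one_lt_two_pow (by omega)
  rw [pack_add, Nat.mod_eq_of_lt ((pack_lt hb').trans_le
    (Nat.pow_le_pow_right (by norm_num) (field_mul_gs_le h)))]
  refine Nat.eq_of_testBit_eq fun p => ?_
  rw [Nat.testBit_land, Nat.testBit_shiftRight, testBit_pack (by omega) hb',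
    testBit_pack (by omega) fun _ _ => hone, testBit_pack (by omega) fun i _ => by split <;> omega]
  by_cases hp : p % (8 * ck E w) = 0
  · have e1 : (4 * ck E w + p) / (8 * ck E w) = p / (8 * ck E w) := by
      rw [← Nat.div_add_mod p (8 * ck E w), hp, add_zero, Nat.add_mul_div_left _ _ (by omega),
        Nat.mul_div_cancel_left _ (by omega), Nat.div_eq_of_lt (by omega), zero_add]
    have e2 : (4 * ck E w + p) % (8 * ck E w) = 4 * ck E w := by
      rw [← Nat.div_add_mod p (8 * ck E w), hp, add_zero, Nat.add_mul_mod_self_left,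
        Nat.mod_eq_of_lt (by omega)]
    rw [e1, e2, hp]
    by_cases hj : p / (8 * ck E w) < gs E w
    · by_cases h0 : z (p / (8 * ck E w)) = 0
      · have : (2 ^ (4 * ck E w) - 1).testBit (4 * ck E w) = false :=
          Nat.testBit_eq_false_of_lt (by omega)
        simp [h0]
      · have hlt := hb _ hj
        have : (z (p / (8 * ck E w)) + (2 ^ (4 * ck E w) - 1)).testBit (4 * ck E w) = true := by
          rw [Nat.testBit_eq_decide_div_mod_eq, decide_eq_true_eq]
          have : (z (p / (8 * ck E w)) + (2 ^ (4 * ck E w) - 1)) / 2 ^ (4 * ck E w) = 1 :=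
            Nat.div_eq_of_lt_le (by omega) (by rw [pow_succ] at hlt; omega)
          rw [this]
        simp [h0, this]
    · simp [hj]
  · have : ∀ x : ℕ, x ≤ 1 → x.testBit (p % (8 * ck E w)) = false := fun x hx =>
      Nat.testBit_eq_false_of_lt (lt_of_le_of_lt hx (Nat.one_lt_two_pow hp))
    rw [this 1 le_rfl, this _ (by split <;> omega)]
    simp

/-- Flags spaced by `8 * ck E w` are the digits `φ j * 2 ^ j` when read with fields one bit
narrower. Multiplying by ones at this narrower spacing sums all digits in the top one, and the sum
is the flags side by side. It fits because `gs E w ≤ 8 * ck E w - 1`. -/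
theorem gather_bits (h : E + 3 ≤ lgS w) {φ : ℕ → ℕ} (hφ : ∀ j < gs E w, φ j ≤ 1) :
    (((pack (8 * ck E w) (gs E w) φ * pack (8 * ck E w - 1) (gs E w) fun _ => 1) % 2 ^ w) >>>
      ((8 * ck E w - 1) * (gs E w - 1))) &&& (2 ^ gs E w - 1) = pack 1 (gs E w) φ := by
  have hk := ck_pos (E := E) (w := w)
  have hgk := gs_lt_field h
  have e1 : pack (8 * ck E w) (gs E w) φ
      = pack (8 * ck E w - 1) (gs E w) fun j => φ j * 2 ^ j := by
    refine Finset.sum_congr rfl fun j _ => ?_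
    rw [mul_assoc (φ j), ← pow_add]
    congr 2
    obtain ⟨k, hk⟩ : ∃ k, 8 * ck E w = k + 1 := ⟨8 * ck E w - 1, by omega⟩
    rw [hk, Nat.add_sub_cancel]; ring
  have hs : ∀ d ≤ gs E w, ∑ j ∈ range d, φ j * 2 ^ j * 1 < 2 ^ d := fun d hd => by
    have := pack_lt (F := 1) (n := d) (y := φ) fun j hj => by
      have := hφ j (by omega); omega
    simpa [pack] using this
  have hle : (2 : ℕ) ^ gs E w ≤ 2 ^ (8 * ck E w - 1) := Nat.pow_le_pow_right (by norm_num) hgk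
  have hw : (8 * ck E w - 1) * gs E w ≤ w :=
    (Nat.mul_le_mul_right _ (Nat.sub_le _ _)).trans (field_mul_gs_le h)
  rw [e1, Nat.and_two_pow_sub_one_eq_mod, Nat.shiftRight_eq_div_pow,
    ← Nat.mod_mod_of_dvd _ (pow_dvd_pow 2 hgk), pack_mul_digit gs_pos hw]
  · rw [Nat.mod_eq_of_lt (hs _ le_rfl)]
    simp [pack]
  · intro d hd
    exact (hs (d + 1) hd).trans_le ((Nat.pow_le_pow_right (by norm_num) hd).trans hle)

variable {env : RamEnv w}

theorem eval_gatherE (h : E + 3 ≤ lgS w) (hc : env.const = wordConsts E w) {σ : St} {e : Expr}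
    {z : ℕ → ℕ} (hz : ∀ j < gs E w, z j < 2 ^ (4 * ck E w))
    (he : e.eval env σ = pack (8 * ck E w) (gs E w) z) :
    (gatherE e).eval env σ = pack 1 (gs E w) fun j => if z j = 0 then 0 else 1 := by
  rw [gatherE, eval_and, eval_shr, eval_mul, eval_and, eval_shr, eval_add, he]
  simp only [eval_wc h hc]
  rw [← gather_bits h (φ := fun j => if z j = 0 then 0 else 1) fun j _ => by split <;> omega,
    ← gather_flags h hz]
  rfl

/-- The operations that act on each field separately. -/
def BinOp.Fieldwise (o : BinOp) : Prop := o = and ∨ o = xor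

theorem BinOp.Fieldwise.eval_pack {o : BinOp} (ho : o.Fieldwise) (w : ℕ) {F n : ℕ} {y z : ℕ → ℕ}
    (hF : 0 < F) (hy : ∀ i < n, y i < 2 ^ F) (hz : ∀ i < n, z i < 2 ^ F) :
    o.eval w (pack F n y) (pack F n z) = pack F n fun i => o.eval w (y i) (z i) := by
  rcases ho with rfl | rfl
  · exact pack_land hF hy hz
  · exact pack_xor hF hy hz

theorem BinOp.Fieldwise.eval_lt {o : BinOp} (ho : o.Fieldwise) (w : ℕ) {n x y : ℕ}
    (hx : x < 2 ^ n) (hy : y < 2 ^ n) : o.eval w x y < 2 ^ n := by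
  rcases ho with rfl | rfl
  · exact Nat.and_lt_two_pow _ hy
  · exact Nat.xor_lt_two_pow hx hy

theorem shiftLeft_lg_gs (a : ℕ) :
    a <<< (lgN w - lgS w - E - 3) = a * gs E w := Nat.shiftLeft_eq _ _

/-- Memory holds `y 0, y 1, …` in the packed words at `base`. -/
def Packed (E w n base : ℕ) (μ : ℕ → ℕ) (y : ℕ → ℕ) : Prop :=
  ∀ g < n, μ (base + g) = pack (8 * ck E w) (gs E w) fun j => y (g * gs E w + j)

/-- Word `k` contributes its `gs E w` answers at the positions from `k * gs E w` on. Answers shifted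
beyond the word are lost, whence the condition `q < w`; the callers have `m < w`. -/
theorem parCmd_spec (h : E + 3 ≤ lgS w) (hc : env.const = wordConsts E w) {o : BinOp}
    (ho : o.Fieldwise) {base n : ℕ} {y : ℕ → ℕ} {v : ℕ} {σ : St}
    (hv : v < 2 ^ (4 * ck E w)) (hx : σ.reg 23 = v) (hy : ∀ q, y q < 2 ^ (4 * ck E w))
    (hm : Packed E w n base σ.mem y) (hs : base + n ≤ env.space) (hnw : base + n * gs E w < 2 ^ w) :
    Tr env (parCmd o base n) σ (parCost o base n) (fun σ' =>
      σ'.reg 22 < 2 ^ w ∧ ∀ q, (σ'.reg 22).testBit q =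
        (decide (q < w) && decide (q < n * gs E w) && decide (o.eval w v (y q) ≠ 0))) := by
  have hk := ck_pos (E := E) (w := w)
  have hg := gs_pos (E := E) (w := w)
  have hnle : n ≤ n * gs E w := Nat.le_mul_of_pos_right _ hg
  have hw0 : 0 < 2 ^ w := by positivity
  set I : ℕ → St → Prop := fun k σ' => σ'.reg 23 = v ∧ σ'.mem = σ.mem ∧ σ'.reg 22 < 2 ^ w ∧
    ∀ q, (σ'.reg 22).testBit q =
      (decide (q < w) && decide (q < k * gs E w) && decide (o.eval w v (y q) ≠ 0)) with hI
  have h1 : Tr env (.assign 22 (.lit 0)) σ 2 (I 0) := by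
    refine (wp_sound ?_).mono le_rfl fun _ h => h
    refine ⟨by rw [St.set_reg, if_neg (by norm_num), hx], rfl, ?_, fun q => ?_⟩ <;>
      simp [St.set_reg, Expr.eval, hw0]
  refine h1.seq fun σ₁ hσ₁ _ => ?_
  generalize hB : (parBody o base).cost = B
  refine (Tr.for I B (Nat.zero_le n) (by omega) (Nat.zero_mod _) rfl (fun _ _ =>
    eval_lit (by omega)) ?_ ?_).mono (by simp [Expr.len]) fun σ' h => ⟨h.1.2.2.1, h.1.2.2.2⟩
  · simpa [hI, St.set_reg] using hσ₁
  · rintro k σ₂ - hkn ⟨a1, a2, a3, a4⟩ hk20 - -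
    refine (wp_sound (Q := fun σ'' => I (k + 1) (σ''.set 20 (k + 1))) ?_).mono hB.le fun _ h => h
    have ea : (Expr.lit base + Expr.var 20).eval env σ₂ = base + k := by
      rw [eval_add, eval_lit (by omega), eval_var, hk20, Nat.mod_eq_of_lt (by omega)]
    refine ⟨by rw [ea]; omega, ?_⟩
    rw [ea, a2, hm k hkn]
    set σ₃ := σ₂.set 21 (pack (8 * ck E w) (gs E w) fun j => y (k * gs E w + j)) with hσ₃
    have hle : (2 : ℕ) ^ (4 * ck E w) ≤ 2 ^ (8 * ck E w) :=
      Nat.pow_le_pow_right (by norm_num) (by omega)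
    have eb : (Expr.bin o (.var 23 * .wc 18) (.var 21)).eval env σ₃
        = pack (8 * ck E w) (gs E w) fun j => o.eval w v (y (k * gs E w + j)) := by
      rw [Expr.eval, eval_mul, eval_wc h hc, eval_var, eval_var]
      have : σ₃.reg 23 = v := by rw [hσ₃, St.set_reg, if_neg (by norm_num), a1]
      rw [this]
      have : (v * pack (8 * ck E w) (gs E w) fun _ => 1) % 2 ^ w
          = pack (8 * ck E w) (gs E w) fun _ => v := by
        rw [mul_pack, Nat.mod_eq_of_lt]
        · simp
        · refine (pack_lt fun _ _ => ?_).trans_le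
            (Nat.pow_le_pow_right (by norm_num) (field_mul_gs_le h))
          rw [mul_one]; omega
      show o.eval w ((v * pack (8 * ck E w) (gs E w) fun _ => 1) % 2 ^ w) _ = _
      rw [this, hσ₃, St.set_reg, if_pos rfl, ho.eval_pack w (by omega)
        (fun _ _ => hv.trans_le hle) (fun _ _ => (hy _).trans_le hle)]
    have ec := eval_gatherE h hc (fun j _ => ho.eval_lt w hv (hy _)) eb
    have ed : (Expr.var 20 <<< Expr.wc 24).eval env σ₃ = k * gs E w := by
      rw [eval_shl, eval_wc h hc, eval_var, hσ₃, St.set_reg, if_neg (by norm_num), hk20]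
      show (k <<< (lgN w - lgS w - E - 3)) % 2 ^ w = _
      rw [shiftLeft_lg_gs, Nat.mod_eq_of_lt]
      exact lt_of_le_of_lt (Nat.mul_le_mul_right _ hkn.le) (by omega)
    simp only [wp]
    have eo : σ₃.reg 22 = σ₂.reg 22 := by rw [hσ₃, St.set_reg, if_neg (by norm_num)]
    have hφ : ∀ j < gs E w, (if o.eval w v (y (k * gs E w + j)) = 0 then 0 else 1) < 2 ^ 1 :=
      fun j _ => by split <;> omega
    refine ⟨?_, ?_, ?_, fun q => ?_⟩
    · rw [St.set_reg, if_neg (by norm_num), St.set_reg, if_neg (by norm_num), hσ₃,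
        St.set_reg, if_neg (by norm_num), a1]
    · simp [hσ₃, a2]
    · rw [St.set_reg, if_neg (by norm_num), St.set_reg, if_pos rfl, eval_or, eval_shl, eval_var, eo]
      exact Nat.or_lt_two_pow a3 (Nat.mod_lt _ hw0)
    · rw [St.set_reg, if_neg (by norm_num), St.set_reg, if_pos rfl, eval_or, eval_shl, eval_var,
        eo, ec, ed, Nat.testBit_lor, a4, Nat.testBit_mod_two_pow, Nat.testBit_shiftLeft,
        testBit_pack (by norm_num) hφ, Nat.div_one, Nat.mod_one]
      have hmul : (k + 1) * gs E w = k * gs E w + gs E w := by ring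
      rw [hmul]
      by_cases hqw : q < w
      · rcases lt_or_ge q (k * gs E w) with hq | hq
        · have h2 : ¬ q ≥ k * gs E w := by omega
          have h3 : q < k * gs E w + gs E w := by omega
          simp [hqw, hq, h3, h2]
        · have h2 : ¬ q < k * gs E w := by omega
          have h3 : q - k * gs E w < gs E w ↔ q < k * gs E w + gs E w := by omega
          rw [Nat.add_sub_cancel' hq]
          by_cases h0 : o.eval w v (y q) = 0 <;> simp [hqw, hq, h2, h3, h0]
      · simp [hqw]

end
end WordRam

/-! ## Evaluation of the hash function -/

namespace WordRam

open Finset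

/-- The `c`-th chunk of `x`. -/
def chunk (s x c : ℕ) : ℕ := x / 2 ^ (s * c) % 2 ^ s

/-- A linear combination of the chunks of `x`. -/
def hsum (E w : ℕ) (co : ℕ → ℕ) (x : ℕ) : ℕ :=
  ∑ c ∈ range (4 * qs E w), co c * chunk (ck E w) x c

/-- The chunk number `q` of part `p`: the parts are given by the parity and the half. -/
def cpos (E w p q : ℕ) : ℕ := 2 * q + p % 2 + 2 * qs E w * (p / 2)

/-- The multiplier that evaluates part `p` of a linear combination. -/
def multiplier (E w : ℕ) (co : ℕ → ℕ) (p : ℕ) : ℕ :=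
  pack (2 * ck E w) (qs E w) fun i => co (cpos E w p (qs E w - 1 - i))

/-- A pair of linear combinations as one number. -/
def hash (E w : ℕ) (co co' : ℕ → ℕ) (x : ℕ) : ℕ :=
  hsum E w co x * 2 ^ (2 * ck E w) + hsum E w co' x

def partShift : ℕ → Expr
  | 0 => .lit 0
  | 1 => .wc 14
  | 2 => .wc 13
  | _ => .wc 13 + .wc 14

/-- Add part `p` of the linear combination with multipliers at `A` to `var 27`. -/
def hashPart (A p : ℕ) : Cmd :=
  .seq (.load 29 (.lit (A + p)))
    (.assign 27 (.var 27 +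
      (((((.var 24 >>> partShift p) &&& .wc 9) * .var 29) >>> .wc 11) &&& .wc 10)))

/-- The linear combination of the chunks of `var 24` with multipliers at `A`, in `var 27`. -/
def hashPass (A : ℕ) : Cmd :=
  .seq (.assign 27 (.lit 0)) (.seq (hashPart A 0) (.seq (hashPart A 1)
    (.seq (hashPart A 2) (hashPart A 3))))

/-- The hash value of `var 24` in `var 25`. -/
def hashCmd (A : ℕ) : Cmd :=
  .seq (hashPass A) (.seq (.assign 25 (.var 27 <<< .wc 12)) (.seq (hashPass (A + 4))
    (.assign 25 (.var 25 + .var 27))))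

section
variable {E w : ℕ}

theorem chunk_lt (s x c : ℕ) : chunk s x c < 2 ^ s := Nat.mod_lt _ (by positivity)

theorem testBit_chunk (s x c b : ℕ) :
    (chunk s x c).testBit b = (decide (b < s) && x.testBit (b + s * c)) := by
  rw [chunk, Nat.testBit_mod_two_pow, Nat.testBit_div_two_pow]

/-- Splitting the chunk numbers into two halves and each half by parity reaches every chunk once. -/
theorem sum_cpos (f : ℕ → ℕ) : ∑ c ∈ range (4 * qs E w), f c
    = ∑ p ∈ range 4, ∑ q ∈ range (qs E w), f (cpos E w p q) := by
  have key : ∀ n a, ∑ c ∈ range (2 * n), f (c + a)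
      = ∑ q ∈ range n, f (2 * q + a) + ∑ q ∈ range n, f (2 * q + 1 + a) := fun n a => by
    induction n with
    | zero => simp
    | succ n ih =>
      rw [show 2 * (n + 1) = 2 * n + 1 + 1 by ring, sum_range_succ, sum_range_succ, ih,
        sum_range_succ, sum_range_succ]
      ring
  rw [show 4 * qs E w = 2 * qs E w + 2 * qs E w by ring, sum_range_add]
  have h1 := key (qs E w) 0
  have h2 := key (qs E w) (2 * qs E w)
  simp only [add_zero] at h1
  simp only [add_comm (2 * qs E w)]
  rw [h1, h2]
  simp [sum_range_succ, cpos]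
  ring

theorem hsum_lt {co : ℕ → ℕ} (hco : ∑ c ∈ range (4 * qs E w), co c ≤ 2 ^ ck E w) (x : ℕ) :
    hsum E w co x < 2 ^ (2 * ck E w) := by
  have h1 : hsum E w co x ≤ ∑ c ∈ range (4 * qs E w), co c * (2 ^ ck E w - 1) :=
    sum_le_sum fun c _ => Nat.mul_le_mul_left _ (Nat.le_sub_one_of_lt (chunk_lt _ _ _))
  rw [← sum_mul] at h1
  have h2 := Nat.mul_le_mul_right (2 ^ ck E w - 1) hco
  have h3 : 0 < 2 ^ ck E w := by positivity
  have h4 : 2 ^ ck E w * (2 ^ ck E w - 1) < 2 ^ ck E w * 2 ^ ck E w :=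
    Nat.mul_lt_mul_of_pos_left (by omega) h3
  rw [two_mul, pow_add]
  omega

theorem hash_lt {co co' : ℕ → ℕ} (hco : ∑ c ∈ range (4 * qs E w), co c ≤ 2 ^ ck E w)
    (hco' : ∑ c ∈ range (4 * qs E w), co' c ≤ 2 ^ ck E w) (x : ℕ) :
    hash E w co co' x < 2 ^ (4 * ck E w) := by
  have h1 := hsum_lt hco x
  have h2 := hsum_lt hco' x
  rw [show 4 * ck E w = 2 * ck E w + 2 * ck E w by ring, pow_add, hash]
  have := Nat.mul_le_mul_right (2 ^ (2 * ck E w)) h1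
  rw [Nat.succ_mul] at this
  omega

/-- Keeping every second chunk leaves `ck E w` zero bits above each of them, the room that products
need. Two halves are needed because the chunks cover `2 ^ (lgN w + 1) > w` positions, whereas the
`qs E w` digits of a part must fit in a word. -/
theorem mask_part (h : E + 3 ≤ lgS w) (x p : ℕ) :
    (x >>> (ck E w * (p % 2) + 2 ^ lgN w * (p / 2)) &&&
      pack (2 * ck E w) (qs E w) fun _ => 2 ^ ck E w - 1)
      = pack (2 * ck E w) (qs E w) fun q => chunk (ck E w) x (cpos E w p q) := by
  have hk := ck_pos (E := E) (w := w)
  have h2 : (2 : ℕ) ^ ck E w ≤ 2 ^ (2 * ck E w) := Nat.pow_le_pow_right (by norm_num) (by omega)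
  have h3 : 0 < 2 ^ ck E w := by positivity
  refine Nat.eq_of_testBit_eq fun b => ?_
  rw [Nat.testBit_land, testBit_pack (by omega) fun _ _ => by omega, Nat.testBit_shiftRight,
    testBit_pack (by omega) fun _ _ => (chunk_lt _ _ _).trans_le h2, Nat.testBit_two_pow_sub_one,
    testBit_chunk, ← field_mul_qs h]
  have : ck E w * (p % 2) + 2 * ck E w * qs E w * (p / 2) + b
      = b % (2 * ck E w) + ck E w * cpos E w p (b / (2 * ck E w)) := by
    conv_lhs => rw [← Nat.div_add_mod b (2 * ck E w)]
    rw [cpos]; ring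
  rw [this]
  cases decide (b / (2 * ck E w) < qs E w) <;> cases decide (b % (2 * ck E w) < ck E w) <;> simp

theorem field_mul_qs_le (h : E + 3 ≤ lgS w) : 2 * ck E w * qs E w ≤ w :=
  (field_mul_qs h).trans_le (lgN_le (ne_zero_of_lgS h))

theorem four_ck_le (h : E + 3 ≤ lgS w) : 4 * ck E w < w := by
  have := field_mul_gs_le h
  have := gs_pos (E := E) (w := w)
  have := ck_pos (E := E) (w := w)
  nlinarith

/-- The multiplier lists the coefficients in reverse order, so the top digit of the product is the
inner product. Every digit up to it is at most `2 ^ ck E w - 1` times the sum of the coefficients,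
hence below `2 ^ (2 * ck E w)`, and no carries occur. -/
theorem mul_part (h : E + 3 ≤ lgS w) {co : ℕ → ℕ}
    (hco : ∑ c ∈ range (4 * qs E w), co c ≤ 2 ^ ck E w) (x : ℕ) {p : ℕ} (hp : p < 4) :
    ((((x >>> (ck E w * (p % 2) + 2 ^ lgN w * (p / 2)) &&&
      pack (2 * ck E w) (qs E w) fun _ => 2 ^ ck E w - 1) * multiplier E w co p) % 2 ^ w) >>>
        (2 * ck E w * (qs E w - 1))) &&& (2 ^ (2 * ck E w) - 1)
      = ∑ q ∈ range (qs E w), co (cpos E w p q) * chunk (ck E w) x (cpos E w p q) := by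
  rw [mask_part h, multiplier, Nat.and_two_pow_sub_one_eq_mod, Nat.shiftRight_eq_div_pow,
    pack_mul_digit qs_pos (field_mul_qs_le h)]
  · refine sum_congr rfl fun q hq => ?_
    have hq := mem_range.1 hq
    rw [mul_comm, show qs E w - 1 - (qs E w - 1 - q) = q by omega]
  · intro d hd
    have h1 : ∑ j ∈ range (d + 1), chunk (ck E w) x (cpos E w p j) *
        co (cpos E w p (qs E w - 1 - (d - j)))
        ≤ ∑ j ∈ range (d + 1), (2 ^ ck E w - 1) * co (cpos E w p (qs E w - 1 - d + j)) := by
      refine sum_le_sum fun j hj => ?_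
      have hj := mem_range.1 hj
      rw [show qs E w - 1 - (d - j) = qs E w - 1 - d + j by omega]
      exact Nat.mul_le_mul_right _ (Nat.le_sub_one_of_lt (chunk_lt _ _ _))
    have h2 : ∑ j ∈ range (d + 1), co (cpos E w p (qs E w - 1 - d + j))
        ≤ ∑ q ∈ range (qs E w), co (cpos E w p q) := by
      have := sum_range_add (fun q => co (cpos E w p q)) (qs E w - 1 - d) (d + 1)
      rw [show qs E w - 1 - d + (d + 1) = qs E w by omega] at this
      omega
    have h3 : ∑ q ∈ range (qs E w), co (cpos E w p q) ≤ ∑ c ∈ range (4 * qs E w), co c := by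
      rw [sum_cpos co]
      exact single_le_sum (f := fun p => ∑ q ∈ range (qs E w), co (cpos E w p q))
        (fun _ _ => Nat.zero_le _) (mem_range.2 hp)
    rw [← mul_sum] at h1
    have h4 := Nat.mul_le_mul_left (2 ^ ck E w - 1) (h2.trans (h3.trans hco))
    have h5 : 0 < 2 ^ ck E w := by positivity
    have h6 : (2 ^ ck E w - 1) * 2 ^ ck E w < 2 ^ ck E w * 2 ^ ck E w :=
      Nat.mul_lt_mul_of_pos_right (by omega) h5
    rw [two_mul, pow_add]
    omega

variable {env : RamEnv w}

theorem eval_partShift (h : E + 3 ≤ lgS w) (hc : env.const = wordConsts E w) (σ : St) {p : ℕ}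
    (hp : p < 4) :
    (partShift p).eval env σ = ck E w * (p % 2) + 2 ^ lgN w * (p / 2) := by
  have h1 := lgN_lt h
  have h2 := four_ck_le h
  have h3 := lgN_le (ne_zero_of_lgS h)
  have h4 := four_mul_lt_two_pow (n := w) (by have := le_w h; omega)
  interval_cases p
  · simp [partShift, Expr.eval]
  · rw [partShift, eval_wc h hc]; simp [consts]
  · rw [partShift, eval_wc h hc]; simp [consts]
  · show (Expr.wc 13 + Expr.wc 14).eval env σ = _
    rw [eval_add, eval_wc h hc, eval_wc h hc]
    show (2 ^ lgN w + ck E w) % 2 ^ w = _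
    rw [Nat.mod_eq_of_lt (by omega)]; simp [add_comm]

theorem wp_hashPart (h : E + 3 ≤ lgS w) (hc : env.const = wordConsts E w) {co : ℕ → ℕ}
    (hco : ∑ c ∈ range (4 * qs E w), co c ≤ 2 ^ ck E w) {σ : St} {A p x : ℕ} (hp : p < 4)
    (hs : A + p < env.space) (hA : A + p < 2 ^ w)
    (hm : σ.mem (A + p) = multiplier E w co p) (hx : σ.reg 24 = x)
    (hlt : σ.reg 27 + ∑ q ∈ range (qs E w), co (cpos E w p q) *
      chunk (ck E w) x (cpos E w p q) < 2 ^ w) :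
    wp env (hashPart A p) (fun σ' => σ'.reg 27 = σ.reg 27 + ∑ q ∈ range (qs E w),
      co (cpos E w p q) * chunk (ck E w) x (cpos E w p q)) σ := by
  refine ⟨by rwa [eval_lit hA], ?_⟩
  rw [eval_lit hA, hm]
  simp only [wp]
  rw [St.set_reg, if_pos rfl, eval_add, eval_and, eval_shr, eval_mul, eval_and, eval_shr,
    eval_partShift h hc _ hp, eval_wc h hc, eval_wc h hc, eval_wc h hc, eval_var, eval_var,
    eval_var, St.set_reg, if_neg (by norm_num), St.set_reg, if_neg (by norm_num), St.set_reg,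
    if_pos rfl, hx]
  exact (congrArg (fun z => (σ.reg 27 + z) % 2 ^ w) (mul_part h hco x hp)).trans
    (Nat.mod_eq_of_lt hlt)

/-- Memory holds the multipliers of `co` at `A`. -/
def Multipliers (E w A : ℕ) (μ : ℕ → ℕ) (co : ℕ → ℕ) : Prop :=
  ∀ p < 4, μ (A + p) = multiplier E w co p

theorem wp_hashPass (h : E + 3 ≤ lgS w) (hc : env.const = wordConsts E w) {co : ℕ → ℕ}
    (hco : ∑ c ∈ range (4 * qs E w), co c ≤ 2 ^ ck E w) {σ : St} {A x : ℕ}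
    (hs : A + 4 ≤ env.space) (hA : A + 4 < 2 ^ w)
    (hm : Multipliers E w A σ.mem co) (hx : σ.reg 24 = x) :
    wp env (hashPass A) (fun σ' => σ'.reg 27 = hsum E w co x) σ := by
  have h2 : hsum E w co x < 2 ^ w := (hsum_lt hco x).trans_le
    (Nat.pow_le_pow_right (by norm_num) (by have := four_ck_le h; omega))
  have h3 := sum_cpos (E := E) (w := w) fun c => co c * chunk (ck E w) x c
  rw [← hsum] at h3
  simp only [sum_range_succ, sum_range_zero, zero_add] at h3
  refine wp_seq (R := fun σ' => σ'.reg 27 = 0) ?_ fun σ0 e0 f0 => ?_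
  · simp [wp, St.set_reg, Expr.eval]
  have m0 : σ0.mem = σ.mem := f0.2 rfl
  have x0 : σ0.reg 24 = x := (f0.1 24 rfl).trans hx
  refine wp_seq (wp_hashPart h hc hco (p := 0) (x := x) (by norm_num) (by omega) (by omega)
    (by rw [m0]; exact hm 0 (by norm_num)) x0 (by rw [e0]; omega)) fun σ1 e1 f1 => ?_
  have m1 : σ1.mem = σ.mem := (f1.2 rfl).trans m0
  have x1 : σ1.reg 24 = x := (f1.1 24 rfl).trans x0
  refine wp_seq (wp_hashPart h hc hco (p := 1) (x := x) (by norm_num) (by omega) (by omega)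
    (by rw [m1]; exact hm 1 (by norm_num)) x1 (by rw [e1, e0]; omega)) fun σ2 e2 f2 => ?_
  have m2 : σ2.mem = σ.mem := (f2.2 rfl).trans m1
  have x2 : σ2.reg 24 = x := (f2.1 24 rfl).trans x1
  refine wp_seq (wp_hashPart h hc hco (p := 2) (x := x) (by norm_num) (by omega) (by omega)
    (by rw [m2]; exact hm 2 (by norm_num)) x2 (by rw [e2, e1, e0]; omega)) fun σ3 e3 f3 => ?_
  have m3 : σ3.mem = σ.mem := (f3.2 rfl).trans m2
  have x3 : σ3.reg 24 = x := (f3.1 24 rfl).trans x2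
  refine wp_mono (wp_hashPart h hc hco (p := 3) (x := x) (by norm_num) (by omega) (by omega)
    (by rw [m3]; exact hm 3 (by norm_num)) x3 (by rw [e3, e2, e1, e0]; omega)) fun σ4 e4 f4 => ?_
  rw [e4, e3, e2, e1, e0, h3, zero_add]

theorem wp_hashCmd (h : E + 3 ≤ lgS w) (hc : env.const = wordConsts E w) {co co' : ℕ → ℕ}
    (hco : ∑ c ∈ range (4 * qs E w), co c ≤ 2 ^ ck E w)
    (hco' : ∑ c ∈ range (4 * qs E w), co' c ≤ 2 ^ ck E w) {σ : St} {A x : ℕ}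
    (hs : A + 8 ≤ env.space) (hA : A + 8 < 2 ^ w)
    (hm : Multipliers E w A σ.mem co) (hm' : Multipliers E w (A + 4) σ.mem co')
    (hx : σ.reg 24 = x) :
    wp env (hashCmd A) (fun σ' => σ'.reg 25 = hash E w co co' x) σ := by
  have h1 : hash E w co co' x < 2 ^ w := (hash_lt hco hco' x).trans_le
    (Nat.pow_le_pow_right (by norm_num) (four_ck_le h).le)
  refine wp_seq (wp_hashPass h hc hco (by omega) (by omega) hm hx) fun σ1 e1 f1 => ?_
  refine wp_seq (R := fun σ' => σ'.reg 25 = hsum E w co x * 2 ^ (2 * ck E w)) ?_ fun σ2 e2 f2 => ?_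
  · simp only [wp]
    rw [St.set_reg, if_pos rfl, eval_shl, eval_var, eval_wc h hc, e1]
    show (hsum E w co x <<< (2 * ck E w)) % 2 ^ w = _
    rw [Nat.shiftLeft_eq, Nat.mod_eq_of_lt]
    unfold hash at h1; omega
  have m2 : σ2.mem = σ.mem := (f2.2 rfl).trans (f1.2 rfl)
  have x2 : σ2.reg 24 = x := ((f2.1 24 rfl).trans (f1.1 24 rfl)).trans hx
  refine wp_seq (wp_hashPass h hc hco' (by omega) (by omega) (by rwa [m2]) x2) fun σ3 e3 f3 => ?_
  simp only [wp]
  rw [St.set_reg, if_pos rfl, eval_add, eval_var, eval_var, e3, f3.1 25 rfl, e2]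
  exact Nat.mod_eq_of_lt h1

end
end WordRam

/-! ## The operations -/

namespace WordRam

/-- The data structure in memory: `n` packed words each for the masks `pred` and `cl` and for the
hash values of `label`, the multipliers of the hash function, and the array `label`. -/
structure IsDS (E w n m : ℕ) (μ : ℕ → ℕ) (pred cl label co co' : ℕ → ℕ) : Prop where
  packed_pred : Packed E w n 0 μ pred
  packed_cl : Packed E w n n μ cl
  packed_hash : ∃ y : ℕ → ℕ, Packed E w n (2 * n) μ y ∧ (∀ q, y q < 2 ^ (4 * ck E w)) ∧
    ∀ q < m, y q = hash E w co co' (label q)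
  mult : Multipliers E w (3 * n) μ co
  mult' : Multipliers E w (3 * n + 4) μ co'
  labels : ∀ q < m, μ (3 * n + 8 + q) = label q
  pred_lt : ∀ q, pred q < 2 ^ m
  cl_lt : ∀ q, cl q < 2 ^ m
  pred_zero : ∀ q, m ≤ q → pred q = 0
  cl_zero : ∀ q, m ≤ q → cl q = 0
  sum_co : ∑ c ∈ Finset.range (4 * qs E w), co c ≤ 2 ^ ck E w
  sum_co' : ∑ c ∈ Finset.range (4 * qs E w), co' c ≤ 2 ^ ck E w
  inj : ∀ p < m, ∀ q < m, hash E w co co' (label p) = hash E w co co' (label q) → label p = label q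

/-- The relations between the word length, the number of states, the number of packed words, and
the space. -/
structure Sizes (E w n m sp : ℕ) : Prop where
  big : E + 3 ≤ lgS w
  pos : 0 < m
  -- The summand `rt w` pays for the number of chunks when coefficients of size `2 ^ m` are added
  -- up.
  le_ck : m + rt w ≤ ck E w
  le_fields : m ≤ n * gs E w
  space : 3 * n + 8 + 6 * m ≤ sp
  fields_lt : (3 * n + 9) * (gs E w + 6 * m) < 2 ^ w
  sq_lt : m * m + m < w * w
  sq_lt_pow : 16 * (w * w) < 2 ^ w

def closeCmd (n : ℕ) : Cmd :=
  .seq (.assign 23 (.var 0)) (.seq (parCmd .and n n) (.assign 0 (.var 22)))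

/-- On entry `var 22` has the states with a predecessor in the state-set and `var 30` the states
whose hash value differs from that of the character. The XOR with the AND deletes the latter from
the former. -/
def checkCmd (n : ℕ) : Cmd :=
  .seq (.assign 22 (.var 22 ^^^ (.var 22 &&& .var 30)))
    (.ite ⟨false, .var 22, .lit 0⟩ (.assign 0 (.lit 0))
      (.seq (.assign 31 (lgE (.var 22))) (.seq (.load 31 (.lit (3 * n + 8) + .var 31))
        (.ite ⟨false, .var 31, .var 1⟩ (.assign 0 (.var 22)) (.assign 0 (.lit 0))))))

def moveCmd (n : ℕ) : Cmd :=
  .seq (.seq (.assign 24 (.var 1)) (hashCmd (3 * n))) (.seq (.assign 23 (.var 25))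
    (.seq (parCmd .xor (2 * n) n) (.seq (.seq (.assign 30 (.var 22)) (.assign 23 (.var 0)))
      (.seq (parCmd .and 0 n) (checkCmd n)))))

def memberCmd : Cmd := .assign 0 ((.var 0 >>> .var 1) &&& .lit 1)

def insertCmd : Cmd := .assign 0 (.var 0 ||| (.lit 1 <<< .var 1))

def closeCost (n : ℕ) : ℕ :=
  (Cmd.assign 23 (.var 0)).cost + (parCost .and n n + (Cmd.assign 0 (.var 22)).cost)

def moveCost (n : ℕ) : ℕ :=
  (Cmd.seq (.assign 24 (.var 1)) (hashCmd (3 * n))).cost + ((Cmd.assign 23 (.var 25)).cost +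
    (parCost .xor (2 * n) n + ((Cmd.seq (.assign 30 (.var 22)) (.assign 23 (.var 0))).cost +
      (parCost .and 0 n + (checkCmd n).cost))))

/-! ### Correctness of Close and Move. -/

section
variable {E w n m : ℕ} {env : RamEnv w}

theorem Sizes.ck_le (H : Sizes E w n m env.space) : 4 * ck E w < w := four_ck_le H.big

theorem Sizes.m_lt (H : Sizes E w n m env.space) : m < 4 * ck E w := by
  have := H.le_ck; have := rt_pos (w := w); omega

theorem Sizes.addr_lt (H : Sizes E w n m env.space) : 3 * n + 9 + 6 * m < 2 ^ w := by
  have h1 := H.fields_lt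
  have h2 := gs_pos (E := E) (w := w)
  have h3 := H.pos
  have : 3 * n + 9 + 6 * m ≤ (3 * n + 9) * (gs E w + 6 * m) := by
    have e : (3 * n + 9) * (gs E w + 6 * m) = (3 * n + 9) * gs E w + (3 * n + 9) * (6 * m) := by
      ring
    have a1 : (3 * n + 9) * 1 ≤ (3 * n + 9) * gs E w := Nat.mul_le_mul_left _ h2
    have a2 : 1 * (6 * m) ≤ (3 * n + 9) * (6 * m) := Nat.mul_le_mul_right _ (by omega)
    omega
  omega

theorem Sizes.par_lt (H : Sizes E w n m env.space) {b : ℕ} (hb : b ≤ 2 * n) :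
    b + n * gs E w < 2 ^ w := by
  refine lt_of_le_of_lt ?_ H.fields_lt
  have h2 := gs_pos (E := E) (w := w)
  nlinarith

theorem two_pow_m_le (H : Sizes E w n m env.space) : (2 : ℕ) ^ m ≤ 2 ^ (4 * ck E w) :=
  Nat.pow_le_pow_right (by norm_num) H.m_lt.le

variable {σ : St} {pred cl label co co' : ℕ → ℕ}

theorem closeCmd_spec (H : Sizes E w n m env.space) (hc : env.const = wordConsts E w)
    (D : IsDS E w n m σ.mem pred cl label co co') (hS : σ.reg 0 < 2 ^ m) :
    Tr env (closeCmd n) σ (closeCost n) (fun σ' => σ'.mem = σ.mem ∧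
      ∀ q, (σ'.reg 0).testBit q = decide (q < m ∧ σ.reg 0 &&& cl q ≠ 0)) := by
  have hm := H.m_lt
  have hck := H.ck_le
  have hsp := H.space
  have hfi := H.le_fields
  have h1 : Tr env (.assign 23 (.var 0)) σ _ (fun σ' => σ'.reg 23 = σ.reg 0) :=
    wp_sound (by simp [wp, St.set_reg, Expr.eval])
  refine h1.seq fun σ1 e1 f1 => ?_
  have hmem : σ1.mem = σ.mem := f1.2 rfl
  refine (parCmd_spec H.big hc (Or.inl rfl) (v := σ.reg 0) (y := cl) (base := n) (n := n)
    (hS.trans_le (two_pow_m_le H)) e1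
    (fun q => (D.cl_lt q).trans_le (two_pow_m_le H)) (by rw [hmem]; exact D.packed_cl) (by omega)
    (H.par_lt (by omega))).seq fun σ2 e2 f2 => ?_
  have hmem2 : σ2.mem = σ.mem := (f2.2 rfl).trans hmem
  refine wp_sound ⟨by simpa using hmem2, fun q => ?_⟩
  rw [St.set_reg, if_pos rfl, eval_var, e2.2 q]
  by_cases hq : q < m
  · have a : q < w := by omega
    have b : q < n * gs E w := by omega
    by_cases h0 : σ.reg 0 &&& cl q = 0 <;> simp [a, b, hq, BinOp.eval, h0]
  · simp [hq, BinOp.eval, D.cl_zero q (not_lt.1 hq)]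

/-- All remaining candidates have the hash value of the character, hence one common label by
`D.inj`. If the lowest candidate has the right label, all have it; if not, none has. The comparison
is needed because injectivity covers only labels, not arbitrary characters. -/
theorem wp_checkCmd (H : Sizes E w n m env.space) (hc : env.const = wordConsts E w)
    (D : IsDS E w n m σ.mem pred cl label co co') {S : ℕ} (h22 : σ.reg 22 < 2 ^ w)
    (hp : ∀ q, (σ.reg 22).testBit q = decide (q < m ∧ S &&& pred q ≠ 0))
    (hh : ∀ q < m, (σ.reg 30).testBit q
      = decide (hash E w co co' (σ.reg 1) ≠ hash E w co co' (label q))) :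
    wp env (checkCmd n) (fun σ' => ∀ q, (σ'.reg 0).testBit q
      = decide (q < m ∧ S &&& pred q ≠ 0 ∧ label q = σ.reg 1)) σ := by
  have haddr := H.addr_lt
  refine wp_seq (R := fun σ' => σ'.reg 22 < 2 ^ w ∧ ∀ q, (σ'.reg 22).testBit q
    = decide (q < m ∧ S &&& pred q ≠ 0 ∧
      hash E w co co' (σ.reg 1) = hash E w co co' (label q))) ?_ fun σ1 h1 f1 => ?_
  · refine ⟨?_, fun q => ?_⟩
    · rw [St.set_reg, if_pos rfl, eval_xor, eval_and, eval_var]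
      exact Nat.xor_lt_two_pow h22 (lt_of_le_of_lt Nat.and_le_left h22)
    · rw [St.set_reg, if_pos rfl, eval_xor, eval_and, eval_var, eval_var, Nat.testBit_xor,
        Nat.testBit_land, hp]
      by_cases hq : q < m
      · rw [hh q hq]
        by_cases a : S &&& pred q = 0 <;>
          by_cases b : hash E w co co' (σ.reg 1) = hash E w co co' (label q) <;> simp [hq, a, b]
      · simp [hq]
  obtain ⟨hlt, hb⟩ := h1
  have hz : σ1.reg 1 = σ.reg 1 := f1.1 1 rfl
  have hw0 : 0 < 2 ^ w := by positivity
  refine ⟨fun h0 => ?_, fun h0 => ?_⟩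
  · have h0 : σ1.reg 22 = 0 := by simpa [Cond.holds, Expr.eval] using h0
    intro q
    rw [St.set_reg, if_pos rfl, eval_lit hw0, Nat.zero_testBit, eq_comm, decide_eq_false_iff_not]
    rintro ⟨a, b, c⟩
    have := hb q
    rw [h0, Nat.zero_testBit, eq_comm, decide_eq_false_iff_not] at this
    exact this ⟨a, b, by rw [c]⟩
  · have h0 : σ1.reg 22 ≠ 0 := by simpa [Cond.holds, Expr.eval] using h0
    have hl := low_spec 0 h0
    set d := low 0 (σ1.reg 22) 0 with hd
    have hd1 : (σ1.reg 22).testBit d = true := by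
      have := hl.1; rw [Nat.zero_testBit] at this; simpa using this
    have hd2 : d < m ∧ S &&& pred d ≠ 0 ∧
        hash E w co co' (σ.reg 1) = hash E w co co' (label d) := by
      have := hb d; rw [hd1] at this; simpa using this.symm
    refine wp_seq (R := fun σ' => σ'.reg 31 = d) ?_ fun σ2 e2 f2 => ?_
    · show (σ1.set 31 _).reg 31 = d
      rw [St.set_reg, if_pos rfl]
      exact eval_lgE H.big hc (eval_var _ _ _) hlt hd1 fun i hi => by
        rw [hl.2 i hi, Nat.zero_testBit]
    have hmem : σ2.mem = σ.mem := (f2.2 rfl).trans (f1.2 rfl)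
    have ea : (Expr.lit (3 * n + 8) + Expr.var 31).eval env σ2 = 3 * n + 8 + d := by
      rw [eval_add, eval_lit (by omega), eval_var, e2, Nat.mod_eq_of_lt (by omega)]
    refine wp_seq (R := fun σ' => σ'.reg 31 = label d) ⟨?_, ?_⟩ fun σ3 e3 f3 => ?_
    · rw [ea]; have := H.space; omega
    · show (σ2.set 31 _).reg 31 = _
      rw [ea, St.set_reg, if_pos rfl, hmem, D.labels d hd2.1]
    have h1' : σ3.reg 1 = σ.reg 1 := ((f3.1 1 rfl).trans (f2.1 1 rfl)).trans hz
    have h22' : σ3.reg 22 = σ1.reg 22 := (f3.1 22 rfl).trans (f2.1 22 rfl)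
    refine ⟨fun h4 q => ?_, fun h4 q => ?_⟩
    · have h4 : label d = σ.reg 1 := by simpa [Cond.holds, Expr.eval, e3, h1'] using h4
      rw [St.set_reg, if_pos rfl, eval_var, h22', hb]
      refine decide_eq_decide.2 ⟨fun ⟨a, b, c⟩ => ⟨a, b, ?_⟩, fun ⟨a, b, c⟩ => ⟨a, b, by rw [c]⟩⟩
      rw [← h4]
      exact D.inj q a d hd2.1 (by rw [← c, hd2.2.2])
    · have h4 : label d ≠ σ.reg 1 := by simpa [Cond.holds, Expr.eval, e3, h1'] using h4
      rw [St.set_reg, if_pos rfl, eval_lit hw0, Nat.zero_testBit, eq_comm,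
        decide_eq_false_iff_not]
      rintro ⟨a, b, c⟩
      refine h4 (D.inj d hd2.1 q a ?_ |>.trans c)
      rw [← hd2.2.2, c]

theorem moveCmd_spec (H : Sizes E w n m env.space) (hc : env.const = wordConsts E w)
    (D : IsDS E w n m σ.mem pred cl label co co') (hS : σ.reg 0 < 2 ^ m) :
    Tr env (moveCmd n) σ (moveCost n) (fun σ' => σ'.mem = σ.mem ∧
      ∀ q, (σ'.reg 0).testBit q
        = decide (q < m ∧ σ.reg 0 &&& pred q ≠ 0 ∧ label q = σ.reg 1)) := by
  have hm := H.m_lt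
  have hck := H.ck_le
  have hsp := H.space
  have hfi := H.le_fields
  have haddr := H.addr_lt
  obtain ⟨y, hy1, hy2, hy3⟩ := D.packed_hash
  have h1 : Tr env (.seq (.assign 24 (.var 1)) (hashCmd (3 * n))) σ
      (Cmd.cost (.seq (.assign 24 (.var 1)) (hashCmd (3 * n))))
      (fun σ' => σ'.reg 25 = hash E w co co' (σ.reg 1)) := by
    refine wp_sound (wp_seq (R := fun σ' => σ'.reg 24 = σ.reg 1) ?_ fun σ1 e1 f1 => ?_)
    · simp [wp, St.set_reg, Expr.eval]
    · have hmem : σ1.mem = σ.mem := f1.2 rfl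
      exact wp_hashCmd H.big hc D.sum_co D.sum_co' (by omega) (by omega) (by rw [hmem]; exact D.mult)
        (by rw [hmem]; exact D.mult') e1
  refine h1.seq fun σ1 e1 f1 => ?_
  have h2 : Tr env (.assign 23 (.var 25)) σ1 _
      (fun σ' => σ'.reg 23 = hash E w co co' (σ.reg 1)) :=
    wp_sound (by simp [wp, St.set_reg, Expr.eval, e1])
  refine h2.seq fun σ2 e2 f2 => ?_
  have m2 : σ2.mem = σ.mem := (f2.2 rfl).trans (f1.2 rfl)
  refine (parCmd_spec H.big hc (Or.inr rfl) (hash_lt D.sum_co D.sum_co' _) e2 hy2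
    (by rw [m2]; exact hy1) (by omega) (H.par_lt (by omega))).seq fun σ3 e3 f3 => ?_
  have r03 : σ3.reg 0 = σ.reg 0 := ((f3.1 0 rfl).trans (f2.1 0 rfl)).trans (f1.1 0 rfl)
  have r13 : σ3.reg 1 = σ.reg 1 := ((f3.1 1 rfl).trans (f2.1 1 rfl)).trans (f1.1 1 rfl)
  have m3 : σ3.mem = σ.mem := (f3.2 rfl).trans m2
  have h4 : Tr env (.seq (.assign 30 (.var 22)) (.assign 23 (.var 0))) σ3 _
      (fun σ' => σ'.reg 30 = σ3.reg 22 ∧ σ'.reg 23 = σ.reg 0) :=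
    wp_sound (by simp [wp, St.set_reg, Expr.eval, r03])
  refine h4.seq fun σ4 e4 f4 => ?_
  have m4 : σ4.mem = σ.mem := (f4.2 rfl).trans m3
  refine (parCmd_spec H.big hc (Or.inl rfl) (v := σ.reg 0) (y := pred) (base := 0) (n := n)
    (hS.trans_le (two_pow_m_le H)) e4.2
    (fun q => (D.pred_lt q).trans_le (two_pow_m_le H)) (by rw [m4]; exact D.packed_pred) (by omega)
    (H.par_lt (by omega))).seq fun σ5 e5 f5 => ?_
  have m5 : σ5.mem = σ.mem := (f5.2 rfl).trans m4
  have r15 : σ5.reg 1 = σ.reg 1 := ((f5.1 1 rfl).trans (f4.1 1 rfl)).trans r13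
  have r30 : σ5.reg 30 = σ3.reg 22 := (f5.1 30 rfl).trans e4.1
  have := wp_checkCmd H hc (σ := σ5) (S := σ.reg 0) (by rwa [m5]) e5.1 (fun q => ?_) (fun q hq => ?_)
  · rw [r15] at this
    exact (wp_sound this).frame.mono le_rfl fun σ6 h6 => ⟨(h6.2.2 rfl).trans m5, h6.1⟩
  · rw [e5.2]
    by_cases hq : q < m
    · have a : q < w := by omega
      have b : q < n * gs E w := by omega
      by_cases h0 : σ.reg 0 &&& pred q = 0 <;> simp [a, b, hq, BinOp.eval, h0]
    · simp [hq, BinOp.eval, D.pred_zero q (not_lt.1 hq)]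
  · have a : q < w := by omega
    have b : q < n * gs E w := by omega
    rw [r30, e3.2, r15, hy3 q hq]
    by_cases h0 : hash E w co co' (σ.reg 1) = hash E w co co' (label q) <;>
      simp [a, b, BinOp.eval, h0]

end
end WordRam

/-! ## The choice of the coefficients of the hash function -/

namespace WordRam

open Finset

/-- The lowest chunk in which `x` and `y` differ, and `4 * qs E w` if `x = y`. -/
noncomputable def cls (E w x y : ℕ) : ℕ := low (big w) x y / ck E w

/-- The pairs of keys with the same value of `g` and with class in `[cur, top)`. -/
def act (m : ℕ) (g : ℕ → ℕ) (c : ℕ → ℕ → ℕ) (cur top : ℕ) : Finset (ℕ × ℕ) :=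
  (range m ×ˢ range m).filter fun p => p.1 < p.2 ∧ g p.1 = g p.2 ∧ cur ≤ c p.1 p.2 ∧ c p.1 p.2 < top

theorem mem_act {m : ℕ} {g : ℕ → ℕ} {c : ℕ → ℕ → ℕ} {cur top i j : ℕ} :
    (i, j) ∈ act m g c cur top ↔ i < j ∧ j < m ∧ g i = g j ∧ cur ≤ c i j ∧ c i j < top := by
  simp only [act, mem_filter, mem_product, mem_range]
  constructor
  · rintro ⟨⟨a, b⟩, c, d, e, f⟩; exact ⟨c, b, d, e, f⟩
  · rintro ⟨a, b, c, d, e⟩; exact ⟨⟨by omega, b⟩, a, c, d, e⟩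

/-- The active pairs on which `h` collides. -/
def bad (m : ℕ) (g h : ℕ → ℕ) (c : ℕ → ℕ → ℕ) (cur top : ℕ) : Finset (ℕ × ℕ) :=
  (act m g c cur top).filter fun p => h p.1 = h p.2

/-- By `hc` no class lies strictly between `b` and `cur`. -/
theorem act_split {m : ℕ} {g : ℕ → ℕ} {c : ℕ → ℕ → ℕ} {b cur top : ℕ} (hb : b < cur)
    (hcur : cur ≤ top) (hc : ∀ i j, i < j → j < m → c i j < cur → c i j ≤ b) :
    #(act m g c b top) = #(act m g c cur top) + #(act m g c b (b + 1)) := by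
  rw [← card_union_of_disjoint]
  · congr 1
    ext ⟨i, j⟩
    rw [mem_union, mem_act, mem_act, mem_act]
    constructor
    · rintro ⟨h1, h2, h3, h4, h5⟩
      by_cases h : c i j < cur
      · have := hc i j h1 h2 h
        exact Or.inr ⟨h1, h2, h3, h4, by omega⟩
      · exact Or.inl ⟨h1, h2, h3, by omega, h5⟩
    · rintro (⟨h1, h2, h3, h4, h5⟩ | ⟨h1, h2, h3, h4, h5⟩)
      · exact ⟨h1, h2, h3, by omega, h5⟩
      · exact ⟨h1, h2, h3, h4, by omega⟩
  · rw [Finset.disjoint_left]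
    rintro ⟨i, j⟩ h1 h2
    rw [mem_act] at h1 h2
    omega

/-- One step of the choice of coefficients. -/
theorem bad_step {m : ℕ} {g h h' : ℕ → ℕ} {c mark : ℕ → ℕ → ℕ} {b cur top t : ℕ} (hb : b < cur)
    (hcur : cur ≤ top) (hc : ∀ i j, i < j → j < m → c i j < cur → c i j ≤ b)
    (hold : ∀ i j, i < j → j < m → cur ≤ c i j → h' i = h' j → h i = h j)
    (hnew : ∀ i j, i < j → j < m → c i j = b → h' i = h' j → mark i j = t)
    (hmin : ∀ t' < m, #((act m g c b (b + 1)).filter fun p => mark p.1 p.2 = t)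
      ≤ #((act m g c b (b + 1)).filter fun p => mark p.1 p.2 = t'))
    (hI : m * #(bad m g h c cur top) ≤ #(act m g c cur top)) :
    m * #(bad m g h' c b top) ≤ #(act m g c b top) := by
  -- A pair of class at least `cur` that collides now collided before, and a colliding pair of class
  -- `b` has mark `t`.
  have h1 : #(bad m g h' c b top) ≤ #(bad m g h c cur top) +
      #((act m g c b (b + 1)).filter fun p => mark p.1 p.2 = t) := by
    refine (card_le_card ?_).trans (card_union_le _ _)
    rintro ⟨i, j⟩ hp
    rw [bad, mem_filter, mem_act] at hp
    obtain ⟨⟨a1, a2, a3, a4, a5⟩, a6⟩ := hp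
    rw [mem_union, bad, mem_filter, mem_filter, mem_act, mem_act]
    by_cases hlt : c i j < cur
    · have := hc i j a1 a2 hlt
      exact Or.inr ⟨⟨a1, a2, a3, a4, by omega⟩, hnew i j a1 a2 (by omega) a6⟩
    · exact Or.inl ⟨⟨a1, a2, a3, by omega, a5⟩, hold i j a1 a2 (by omega) a6⟩
  -- Averaging: different values of the mark give disjoint sets of pairs, and `t` is the least
  -- frequent of the `m` candidates.
  have h2 : m * #((act m g c b (b + 1)).filter fun p => mark p.1 p.2 = t)
      ≤ #(act m g c b (b + 1)) := by
    calc _ = ∑ _t' ∈ range m, #((act m g c b (b + 1)).filter fun p => mark p.1 p.2 = t) := by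
          simp
      _ ≤ ∑ t' ∈ range m, #((act m g c b (b + 1)).filter fun p => mark p.1 p.2 = t') :=
          sum_le_sum fun t' h => hmin t' (mem_range.1 h)
      _ = #((act m g c b (b + 1)).filter fun p => mark p.1 p.2 ∈ range m) := by
          rw [card_eq_sum_card_fiberwise (f := fun p => mark p.1 p.2) (t := range m)]
          · refine sum_congr rfl fun t' ht' => ?_
            congr 1
            ext p
            simp only [mem_filter]
            constructor
            · rintro ⟨a, b⟩; exact ⟨⟨a, b ▸ ht'⟩, b⟩
            · rintro ⟨⟨a, -⟩, b⟩; exact ⟨a, b⟩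
          · intro p hp; exact (mem_filter.1 hp).2
      _ ≤ _ := card_le_card (filter_subset _ _)
  rw [act_split hb hcur hc]
  have := Nat.mul_le_mul_left m h1
  rw [mul_add] at this
  omega

/-! ### Classes of pairs of keys and collisions of linear combinations. -/

section
variable {E w : ℕ}

theorem big_div (h : E + 3 ≤ lgS w) : big w / ck E w = 4 * qs E w := by
  rw [big, pow_succ, ← field_mul_qs h, show 2 * ck E w * qs E w * 2 = ck E w * (4 * qs E w) by ring,
    Nat.mul_div_cancel_left _ ck_pos]

theorem w_lt_big : w < big w := lt_lgN

theorem cls_self (h : E + 3 ≤ lgS w) (x : ℕ) : cls E w x x = 4 * qs E w := by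
  rw [cls, low_self, big_div h]

/-- The chunks cover all `w` bits, so distinct words differ in a proper chunk. Equal words get the
class one past the last chunk. -/
theorem cls_lt_iff (h : E + 3 ≤ lgS w) {x y : ℕ} (hx : x < 2 ^ w) (hy : y < 2 ^ w) :
    cls E w x y < 4 * qs E w ↔ x ≠ y := by
  constructor
  · rintro hlt rfl
    rw [cls_self h] at hlt; omega
  · intro hne
    have h1 := low_lt (B := big w) hne hx hy
    rw [cls, Nat.div_lt_iff_lt_mul ck_pos]
    have h2 : 4 * qs E w * ck E w = big w := by
      rw [big, pow_succ, ← field_mul_qs h]; ring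
    have := w_lt_big (w := w)
    omega

/-- This reduces the classes of all pairs of sorted keys to those of adjacent ones: the minimum
passes from bits to chunks because division is monotone. -/
theorem cls_three {x y z : ℕ} (hx : x < 2 ^ w) (hy : y < 2 ^ w) (hz : z < 2 ^ w)
    (hxy : RevLe x y) (hyz : RevLe y z) :
    cls E w x z = min (cls E w x y) (cls E w y z) := by
  have hw := (w_lt_big (w := w)).le
  have := (RevLe.three (B := big w) hxy hyz (low_le hw hx hy) (low_le hw hy hz)).2
  rw [cls, this, cls, cls]
  rcases le_total (low (big w) x y) (low (big w) y z) with h | h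
  · rw [min_eq_left h, min_eq_left (Nat.div_le_div_right h)]
  · rw [min_eq_right h, min_eq_right (Nat.div_le_div_right h)]

/-- Keys that agree below chunk `c + 1` have the same chunk `c`. -/
theorem chunk_eq_of_lt_cls {x y c : ℕ} (h : c < cls E w x y) (hne : x ≠ y) :
    chunk (ck E w) x c = chunk (ck E w) y c := by
  obtain ⟨-, h2⟩ := low_spec (big w) hne
  refine Nat.eq_of_testBit_eq fun b => ?_
  rw [testBit_chunk, testBit_chunk]
  by_cases hb : b < ck E w
  · rw [h2]
    have h3 := (Nat.le_div_iff_mul_le ck_pos).1 (Nat.succ_le_of_lt h)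
    rw [Nat.succ_mul, mul_comm] at h3
    omega
  · simp [hb]

theorem low_chunk {x y c B : ℕ} (h : cls E w x y = c) (hne : x ≠ y) :
    chunk (ck E w) x c ≠ chunk (ck E w) y c ∧
      low B (chunk (ck E w) x c) (chunk (ck E w) y c) = low (big w) x y % ck E w := by
  obtain ⟨h1, h2⟩ := low_spec (big w) hne
  have hdm := Nat.div_add_mod (low (big w) x y) (ck E w)
  have hlt := Nat.mod_lt (low (big w) x y) (ck_pos (E := E) (w := w))
  rw [← cls, h] at hdm
  have key : (chunk (ck E w) x c).testBit (low (big w) x y % ck E w)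
      ≠ (chunk (ck E w) y c).testBit (low (big w) x y % ck E w) := by
    rw [testBit_chunk, testBit_chunk, add_comm, hdm]
    simpa [hlt] using h1
  refine ⟨fun he => key (by rw [he]), low_eq key fun i hi => ?_⟩
  rw [testBit_chunk, testBit_chunk, h2 _ (by omega)]

/-- A shift that makes two values collide is determined by lowest differing bits. -/
theorem low_of_collision {a b x y t B : ℕ} (hxy : x ≠ y) (h : a + x * 2 ^ t = b + y * 2 ^ t) :
    a ≠ b ∧ low B a b = low B x y + t := by
  have hab : a ≠ b := by
    rintro rfl
    exact hxy (Nat.eq_of_mul_eq_mul_right (by positivity) (Nat.add_left_cancel h))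
  refine ⟨hab, (low_eq_iff_mod hab).2 ?_⟩
  obtain ⟨h1, h2⟩ := (low_eq_iff_mod (B := B) hxy).1 rfl
  set d := low B x y
  -- Multiplication by `2 ^ t` raises the modulus of a congruence by the same factor, and by `h` the
  -- congruences for `a, b` and for the shifted `x, y` are equivalent.
  have key : ∀ e, a % 2 ^ (e + t) = b % 2 ^ (e + t) ↔ x % 2 ^ e = y % 2 ^ e := fun e => by
    have e1 : x ≡ y [MOD 2 ^ e] ↔ x * 2 ^ t ≡ y * 2 ^ t [MOD 2 ^ (e + t)] := by
      rw [pow_add]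
      exact ⟨fun h => h.mul_right' _, fun h => Nat.ModEq.mul_right_cancel' (by positivity) h⟩
    show a ≡ b [MOD _] ↔ x ≡ y [MOD _]
    rw [e1]
    constructor
    · intro h'
      refine Nat.ModEq.add_left_cancel h' ?_
      rw [h]
    · intro h'
      refine Nat.ModEq.add_right_cancel h' ?_
      rw [h]
  exact ⟨(key d).2 h1, fun h3 => h2 ((key (d + 1)).1 (by rwa [show d + 1 + t = d + t + 1 by ring]))⟩

theorem hsum_update {co : ℕ → ℕ} {b v : ℕ} (hb : b < 4 * qs E w) (h0 : co b = 0) (x : ℕ) :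
    hsum E w (Function.update co b v) x = hsum E w co x + chunk (ck E w) x b * v := by
  have hb' : b ∈ range (4 * qs E w) := mem_range.2 hb
  rw [hsum, hsum, ← add_sum_erase _ _ hb', ← add_sum_erase _ _ hb', Function.update_self, h0,
    zero_mul, zero_add, add_comm, mul_comm v]
  congr 1
  exact sum_congr rfl fun c hc => by rw [Function.update_of_ne (ne_of_mem_erase hc)]

/-- The number of chunks is only O(`rt w`), hence at most `2 ^ rt w`, and `m + rt w ≤ ck E w`. -/
theorem sum_co_le (h : E + 3 ≤ lgS w) {m : ℕ} (hm : m + rt w ≤ ck E w) {co : ℕ → ℕ}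
    (hco : ∀ c, co c ≤ 2 ^ m) : ∑ c ∈ range (4 * qs E w), co c ≤ 2 ^ ck E w := by
  have h1 : 4 * qs E w ≤ 2 ^ rt w := by
    have h2 : qs E w * rt w ≤ 2 * (rt w * rt w) := by
      have a1 := field_mul_qs_le h
      have a2 := lt_rt_mul_rt (w := w)
      have a3 := Nat.mul_le_mul_left (2 * qs E w) (rt_le_ck (E := E) (w := w))
      have a4 : 2 * ck E w * qs E w = 2 * qs E w * ck E w := by ring
      have a5 : 2 * qs E w * rt w = 2 * (qs E w * rt w) := by ring
      omega
    have h3 : qs E w ≤ 2 * rt w := by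
      rw [← mul_assoc] at h2
      exact Nat.le_of_mul_le_mul_right h2 rt_pos
    have := four_mul_lt_two_pow (le_rt h)
    omega
  calc _ ≤ ∑ _c ∈ range (4 * qs E w), 2 ^ m := sum_le_sum fun c _ => hco c
    _ = 4 * qs E w * 2 ^ m := by simp
    _ ≤ 2 ^ rt w * 2 ^ m := Nat.mul_le_mul_right _ h1
    _ ≤ 2 ^ ck E w := by
      rw [← pow_add]; exact Nat.pow_le_pow_right (by norm_num) (by omega)

end
end WordRam

/-! ## Arrays and packed arrays in memory -/

namespace WordRam

/-- Address of entry `v` of the array number `j`. -/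
def loc (n m j v : ℕ) : ℕ := 3 * n + 8 + j * m + v

/-- Entry `i` of array number `j`; the number of states is in `var 0`. -/
def arr (n j : ℕ) (i : Expr) : Expr := .lit (3 * n + 8) + (.lit j * .var 0 + i)

/-- Or `var 33` into field `var 32` of the packed words at `base`. -/
def packOr (base : ℕ) : Cmd :=
  .seq (.assign 34 (.lit base + (.var 32 >>> .wc 24))) (.seq (.load 35 (.var 34))
    (.store (.var 34) (.var 35 ||| (.var 33 <<< ((.var 32 &&& .wc 25) <<< .wc 26)))))

section
variable {E w n m : ℕ} {env : RamEnv w}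

theorem loc_inj {j j' v v' : ℕ} (hv : v < m) (hv' : v' < m) :
    loc n m j v = loc n m j' v' ↔ j = j' ∧ v = v' := by
  unfold loc
  constructor
  · intro h
    have h : j * m + v = j' * m + v' := by omega
    have hj : j = j' := by
      rcases lt_trichotomy j j' with hl | he | hg
      · have := Nat.mul_le_mul_right m hl
        rw [Nat.succ_mul] at this; omega
      · exact he
      · have := Nat.mul_le_mul_right m hg
        rw [Nat.succ_mul] at this; omega
    subst hj
    exact ⟨rfl, by omega⟩
  · rintro ⟨rfl, rfl⟩; rfl

theorem le_loc (j v : ℕ) : 3 * n + 8 ≤ loc n m j v := by unfold loc; omega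

theorem Sizes.loc_lt (H : Sizes E w n m env.space) {j v : ℕ} (hj : j < 6) (hv : v < m) :
    loc n m j v < env.space ∧ loc n m j v < 2 ^ w := by
  have h1 := H.space
  have h2 := H.addr_lt
  have h3 := Nat.mul_le_mul_right m (Nat.succ_le_of_lt hj)
  rw [Nat.succ_mul] at h3
  unfold loc
  omega

theorem Sizes.one_lt (H : Sizes E w n m env.space) : 1 < 2 ^ w :=
  Nat.one_lt_two_pow (ne_zero_of_lgS H.big)

theorem eval_arr (H : Sizes E w n m env.space) {σ : St} {j v : ℕ} {i : Expr} (hj : j < 6)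
    (h0 : σ.reg 0 = m) (hi : i.eval env σ = v) (hv : v < m) :
    (arr n j i).eval env σ = loc n m j v := by
  have h1 := (H.loc_lt hj hv).2
  have h2 := H.addr_lt
  have hp := H.pos
  have h3 : j ≤ j * m := Nat.le_mul_of_pos_right _ hp
  unfold loc at h1
  rw [arr, eval_add, eval_add, eval_mul, eval_lit (by omega), eval_lit (by omega), eval_var, h0, hi,
    Nat.mod_eq_of_lt (a := j * m) (by omega), Nat.mod_eq_of_lt (a := j * m + v) (by omega),
    Nat.mod_eq_of_lt (by omega), loc]
  ring

theorem wp_load_arr (H : Sizes E w n m env.space) {σ : St} {r j v : ℕ} {i : Expr}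
    {Q : St → Prop} (hj : j < 6) (h0 : σ.reg 0 = m) (hi : i.eval env σ = v) (hv : v < m)
    (hQ : Q (σ.set r (σ.mem (loc n m j v)))) : wp env (.load r (arr n j i)) Q σ := by
  rw [wp, eval_arr H hj h0 hi hv]
  exact ⟨(H.loc_lt hj hv).1, hQ⟩

theorem wp_store_arr (H : Sizes E w n m env.space) {σ : St} {j v : ℕ} {i e : Expr}
    {Q : St → Prop} (hj : j < 6) (h0 : σ.reg 0 = m) (hi : i.eval env σ = v) (hv : v < m)
    (hQ : Q (σ.setMem (loc n m j v) (e.eval env σ))) : wp env (.store (arr n j i) e) Q σ := by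
  rw [wp, eval_arr H hj h0 hi hv]
  exact ⟨(H.loc_lt hj hv).1, hQ⟩

theorem pack_or {F k : ℕ} {y : ℕ → ℕ} (hF : 0 < F) (hy : ∀ i, y i < 2 ^ F) {j v : ℕ} (hj : j < k)
    (hv : v < 2 ^ F) :
    pack F k y ||| v <<< (F * j) = pack F k (Function.update y j (y j ||| v)) := by
  refine Nat.eq_of_testBit_eq fun b => ?_
  have hu : ∀ i, Function.update y j (y j ||| v) i < 2 ^ F := fun i => by
    by_cases hi : i = j
    · subst hi; rw [Function.update_self]; exact Nat.or_lt_two_pow (hy _) hv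
    · rw [Function.update_of_ne hi]; exact hy i
  rw [Nat.testBit_lor, testBit_pack hF fun i _ => hy i, testBit_pack hF fun i _ => hu i,
    Nat.testBit_shiftLeft]
  have hdm := Nat.div_add_mod b F
  have hlt := Nat.mod_lt b hF
  by_cases hb : b / F = j
  · rw [hb, Function.update_self, Nat.testBit_lor]
    rw [hb] at hdm
    have h1 : F * j ≤ b := by omega
    have h2 : b - F * j = b % F := by omega
    simp [h1, h2, hj]
  · rw [Function.update_of_ne hb]
    have : (decide (b ≥ F * j) && v.testBit (b - F * j)) = false := by
      by_cases h1 : F * j ≤ b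
      · rw [Nat.testBit_eq_false_of_lt, Bool.and_false]
        refine hv.trans_le (Nat.pow_le_pow_right (by norm_num) ?_)
        by_contra h2
        refine hb (Nat.div_eq_of_lt_le (by rw [mul_comm]; exact h1) ?_)
        rw [Nat.succ_mul, mul_comm]; omega
      · simp [h1]
    rw [this, Bool.or_false]

/-- As `gs E w` and `8 * ck E w` are powers of two, a shift and a mask split `q` into word and
field, and another shift gives the position of the field. -/
theorem wp_packOr (H : Sizes E w n m env.space) (hc : env.const = wordConsts E w) {σ : St}
    {base q v : ℕ} {y : ℕ → ℕ} (hb : base ≤ 2 * n) (hm : Packed E w n base σ.mem y)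
    (hy : ∀ q, y q < 2 ^ (4 * ck E w)) (hq : σ.reg 32 = q) (hqm : q < m) (hv : σ.reg 33 = v)
    (hvlt : v < 2 ^ (4 * ck E w)) :
    wp env (packOr base) (fun σ' => Packed E w n base σ'.mem (Function.update y q (y q ||| v)) ∧
      ∀ a, (a < base ∨ base + n ≤ a) → σ'.mem a = σ.mem a) σ := by
  have hk := ck_pos (E := E) (w := w)
  have hg := gs_pos (E := E) (w := w)
  have hdm := Nat.div_add_mod q (gs E w)
  have hlt := Nat.mod_lt q hg
  have hqn : q / gs E w < n := by
    rw [Nat.div_lt_iff_lt_mul hg]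
    exact hqm.trans_le H.le_fields
  have h8 : (2 : ℕ) ^ (4 * ck E w) ≤ 2 ^ (8 * ck E w) :=
    Nat.pow_le_pow_right (by norm_num) (by omega)
  have ha := H.addr_lt
  have hsp := H.space
  have e1 : (.lit base + (.var 32 >>> .wc 24) : Expr).eval env σ = base + q / gs E w := by
    rw [eval_add, eval_shr, eval_lit (by omega), eval_var, hq, eval_wc H.big hc]
    show (base + q >>> (lgN w - lgS w - E - 3)) % 2 ^ w = _
    rw [Nat.shiftRight_eq_div_pow]
    exact Nat.mod_eq_of_lt (show base + q / gs E w < 2 ^ w by omega)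
  refine wp_seq (R := fun σ' => σ'.reg 34 = base + q / gs E w) ?_ fun σ1 f34 f1 => ?_
  · show (σ.set 34 _).reg 34 = _
    rw [St.set_reg, if_pos rfl, e1]
  have m1 : σ1.mem = σ.mem := f1.2 rfl
  refine wp_seq (R := fun σ' => σ'.reg 35 = σ.mem (base + q / gs E w)) ?_ fun σ2 f35 f2 => ?_
  · refine ⟨?_, ?_⟩
    · rw [eval_var, f34]; omega
    · show (σ1.set 35 _).reg 35 = _
      rw [St.set_reg, if_pos rfl, eval_var, f34, m1]
  have m2 : σ2.mem = σ.mem := (f2.2 rfl).trans m1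
  have r34 : σ2.reg 34 = base + q / gs E w := (f2.1 34 rfl).trans f34
  have r32 : σ2.reg 32 = q := ((f2.1 32 rfl).trans (f1.1 32 rfl)).trans hq
  have r33 : σ2.reg 33 = v := ((f2.1 33 rfl).trans (f1.1 33 rfl)).trans hv
  have hFG : 8 * ck E w * (q % gs E w) + 8 * ck E w ≤ w := by
    refine le_trans ?_ (field_mul_gs_le H.big)
    rw [← Nat.mul_succ]
    exact Nat.mul_le_mul_left _ hlt
  have hww : w < 2 ^ w := Nat.lt_two_pow_self
  have e2 : (.var 35 ||| (.var 33 <<< ((.var 32 &&& .wc 25) <<< .wc 26)) : Expr).eval env σ2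
      = pack (8 * ck E w) (gs E w) fun j => Function.update y q (y q ||| v)
        (q / gs E w * gs E w + j) := by
    have s1 : (.var 32 &&& .wc 25 : Expr).eval env σ2 = q % gs E w := by
      rw [eval_and, eval_var, eval_wc H.big hc, r32]
      exact Nat.and_two_pow_sub_one_eq_mod _ _
    have s2 : ((.var 32 &&& .wc 25) <<< .wc 26 : Expr).eval env σ2
        = 8 * ck E w * (q % gs E w) := by
      rw [eval_shl, s1, eval_wc H.big hc]
      show ((q % gs E w) <<< (lgS w + E + 3)) % 2 ^ w = _
      rw [Nat.shiftLeft_eq, pow_add, ← ck, Nat.mod_eq_of_lt]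
      · ring
      · calc q % gs E w * (ck E w * 2 ^ 3) = 8 * ck E w * (q % gs E w) := by ring
          _ < 2 ^ w := by omega
    rw [eval_or, eval_shl, eval_var, eval_var, s2, r33, f35, hm _ hqn, Nat.mod_eq_of_lt,
      pack_or (by omega) (fun i => (hy _).trans_le h8) hlt (hvlt.trans_le h8)]
    · refine pack_congr fun i hi => ?_
      by_cases hi' : i = q % gs E w
      · subst hi'
        rw [Function.update_self, mul_comm, hdm, Function.update_self]
      · rw [Function.update_of_ne hi', Function.update_of_ne]
        rw [mul_comm]; omega
    · rw [Nat.shiftLeft_eq]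
      calc v * 2 ^ (8 * ck E w * (q % gs E w))
          < 2 ^ (8 * ck E w) * 2 ^ (8 * ck E w * (q % gs E w)) :=
            Nat.mul_lt_mul_of_pos_right (hvlt.trans_le h8) (by positivity)
        _ = 2 ^ (8 * ck E w * (q % gs E w) + 8 * ck E w) := by rw [← pow_add, add_comm]
        _ ≤ 2 ^ w := Nat.pow_le_pow_right (by norm_num) hFG
  have e3 : (Expr.var 34).eval env σ2 = base + q / gs E w := r34
  rw [wp, e3, e2]
  refine ⟨by omega, fun g hg' => ?_, fun a ha' => ?_⟩
  · rw [St.setMem_mem]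
    by_cases hgq : g = q / gs E w
    · rw [if_pos (by omega), hgq]
    · rw [if_neg (by omega), m2, hm g hg']
      refine pack_congr fun i hi => ?_
      rw [Function.update_of_ne]
      intro he
      apply hgq
      rw [← he, mul_comm, Nat.mul_add_div hg, Nat.div_eq_of_lt hi, add_zero]
  · rw [St.setMem_mem, if_neg, m2]
    generalize q / gs E w = z at hqn
    omega

end
end WordRam

/-! ## Reading the input -/

namespace WordRam

/-- The entries of array number `j` are given by `f`. -/
def Arr (n m j : ℕ) (μ f : ℕ → ℕ) : Prop := ∀ v < m, μ (loc n m j v) = f v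

theorem Arr.congr {n m j : ℕ} {μ μ' f : ℕ → ℕ} (h : Arr n m j μ f)
    (hμ : ∀ v < m, μ' (loc n m j v) = μ (loc n m j v)) : Arr n m j μ' f :=
  fun v hv => (hμ v hv).trans (h v hv)

theorem Arr.set {n m j : ℕ} {σ : St} {f : ℕ → ℕ} (h : Arr n m j σ.mem f) {v : ℕ} (hv : v < m)
    (x : ℕ) : Arr n m j (σ.setMem (loc n m j v) x).mem (Function.update f v x) := by
  intro u hu
  rw [St.setMem_mem, Function.update_apply]
  by_cases huv : u = v
  · rw [if_pos (by rw [huv]), if_pos huv]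
  · rw [if_neg (fun he => huv ((loc_inj hu hv).1 he).2), if_neg huv, h u hu]

theorem Arr.set_of_ne {n m j j' : ℕ} {σ : St} {f : ℕ → ℕ} (h : Arr n m j σ.mem f) {v : ℕ}
    (hv : v < m) (x : ℕ) (hj : j ≠ j') : Arr n m j (σ.setMem (loc n m j' v) x).mem f := by
  intro u hu
  rw [St.setMem_mem, if_neg (fun he => hj ((loc_inj hu hv).1 he).1), h u hu]

theorem setMem_loc_of_lt {n m j v : ℕ} {σ : St} {x a : ℕ} (ha : a < 3 * n + 8) :
    (σ.setMem (loc n m j v) x).mem a = σ.mem a := by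
  rw [St.setMem_mem, if_neg]
  have := le_loc (n := n) (m := m) j v
  omega

theorem Packed.congr {E w n base : ℕ} {μ μ' y : ℕ → ℕ} (h : Packed E w n base μ y)
    (hμ : ∀ a, base ≤ a → a < base + n → μ' a = μ a) : Packed E w n base μ' y := fun g hg => by
  rw [hμ _ (by omega) (by omega)]; exact h g hg

theorem packed_zero {E w n base : ℕ} {μ : ℕ → ℕ} (h : ∀ a, base ≤ a → a < base + n → μ a = 0) :
    Packed E w n base μ fun _ => 0 := fun g hg => by
  rw [h _ (by omega) (by omega)]; simp [pack]

/-- Roles of the arrays: 0 labels, 1 sorted keys, 2 values of the linear combination under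
construction, 3 the values that separate keys already (all 0 in the first pass), 4 counters, 5
reachability masks. The words before the arrays are cleared because the initial memory is arbitrary;
array 5 starts with `2 ^ q` to make reachability reflexive. -/
def initCmd (n : ℕ) : Cmd :=
  .seq (.read 0 (.lit 0)) (.seq (.read 1 (.lit 1))
    (.seq (.for 2 (.lit 0) (.lit (3 * n + 8)) (.store (.var 2) (.lit 0)))
      (.for 2 (.lit 0) (.var 0)
        (.seq (.store (arr n 0 (.var 2)) (.lit 0)) (.store (arr n 5 (.var 2)) (.lit 1 <<< .var 2))))))

/-- Read transition number `var 7`. -/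
def readBody (n : ℕ) : Cmd :=
  .seq (.seq (.read 3 (.lit 4 + .lit 4 * .var 7)) (.seq (.read 4 (.lit 5 + .lit 4 * .var 7))
    (.seq (.read 5 (.lit 6 + .lit 4 * .var 7)) (.read 6 (.lit 7 + .lit 4 * .var 7)))))
  (.ite ⟨false, .var 5, .lit 0⟩
    (.seq (.load 8 (arr n 5 (.var 4)))
      (.store (arr n 5 (.var 4)) (.var 8 ||| (.lit 1 <<< .var 3))))
    (.seq (.store (arr n 0 (.var 4)) (.var 6))
      (.seq (.seq (.assign 32 (.var 4)) (.assign 33 (.lit 1 <<< .var 3))) (packOr 0))))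

def readCmd (n : ℕ) : Cmd := .for 7 (.lit 0) (.var 1) (readBody n)

section
variable {E w n m : ℕ} {env : RamEnv w}

theorem initCmd_spec (H : Sizes E w n m env.space) {σ : St} {N : ℕ}
    (h0 : ∃ x, env.inp[0]? = some x ∧ x.toNat = m) (h1 : ∃ x, env.inp[1]? = some x ∧ x.toNat = N) :
    Tr env (initCmd n) σ (100 * (3 * n + 9 + m)) (fun σ' => σ'.reg 0 = m ∧ σ'.reg 1 = N ∧
      (∀ a < 3 * n + 8, σ'.mem a = 0) ∧ Arr n m 0 σ'.mem (fun _ => 0) ∧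
      Arr n m 5 σ'.mem (fun q => 2 ^ q)) := by
  have ha := H.addr_lt
  have h1w := H.one_lt
  have hww : w < 2 ^ w := Nat.lt_two_pow_self
  have hm := H.m_lt
  have hck := H.ck_le
  have hsp := H.space
  have r0 : Tr env (.read 0 (.lit 0)) σ (Cmd.cost (.read 0 (.lit 0))) (fun σ' => σ'.reg 0 = m) := by
    obtain ⟨x, hx, hxm⟩ := h0
    refine wp_sound ⟨x, ?_, ?_⟩
    · rw [eval_lit (by omega)]; exact hx
    · show (σ.set 0 _).reg 0 = m
      rw [St.set_reg, if_pos rfl, hxm]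
  refine Tr.mono (r0.seq (t' := 100 * (3 * n + 9 + m) - 2) fun σ1 e1 f1 => ?_) ?_ fun _ h => h
  swap
  · show 2 + _ ≤ _; omega
  have r1 : Tr env (.read 1 (.lit 1)) σ1 (Cmd.cost (.read 1 (.lit 1)))
      (fun σ' => σ'.reg 1 = N) := by
    obtain ⟨x, hx, hxm⟩ := h1
    refine wp_sound ⟨x, ?_, ?_⟩
    · rw [eval_lit (by omega)]; exact hx
    · show (σ1.set 1 _).reg 1 = N
      rw [St.set_reg, if_pos rfl, hxm]
  refine Tr.mono (r1.seq (t' := 100 * (3 * n + 9 + m) - 4) fun σ2 e2 f2 => ?_) ?_ fun _ h => h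
  swap
  · show 2 + _ ≤ _; omega
  have z0 : ∀ σ, (Expr.lit 0).eval env σ = 0 := fun σ => eval_lit (by omega)
  have l1 := Tr.for (env := env) (i := 2) (lo := .lit 0) (hi := .lit (3 * n + 8))
    (body := .store (.var 2) (.lit 0)) (σ := σ2) (l := 0) (n := 3 * n + 8)
    (fun k σ' => ∀ a < k, σ'.mem a = 0) 3 (by omega) (by omega) (z0 _) rfl
    (fun σ' _ => eval_lit (by omega)) (fun a ha => by omega)
    (fun k σ' _ hk hI hi _ _ => (wp_sound (c := .store (.var 2) (.lit 0)) (by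
      refine ⟨by rw [eval_var, hi]; omega, fun a hak => ?_⟩
      rw [St.set_mem, eval_var, hi, z0, St.setMem_mem]
      split
      · rfl
      · exact hI a (by omega))).mono le_rfl fun _ h => h)
  refine Tr.mono (l1.seq (t' := 30 * (m + 1)) fun σ3 e3 f3 => ?_) ?_ fun _ h => h
  swap
  · simp only [Expr.len]; omega
  have g0 : σ3.reg 0 = m := (f3.1 0 rfl).trans ((f2.1 0 rfl).trans e1)
  have g1 : σ3.reg 1 = N := (f3.1 1 rfl).trans e2
  refine Tr.mono (Tr.for (l := 0) (n := m)
    (fun k σ' => (∀ a < 3 * n + 8, σ'.mem a = 0) ∧ (∀ v < k, σ'.mem (loc n m 0 v) = 0) ∧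
      ∀ v < k, σ'.mem (loc n m 5 v) = 2 ^ v) 20 (by omega) (by omega) (z0 _) rfl
    (fun σ' h => by rw [eval_var, h 0 rfl (by norm_num), g0])
    ⟨e3.1, fun _ h => by omega, fun _ h => by omega⟩
    fun k σ' _ hk hI hi fr _ => ?_).frame (by simp only [Expr.len]; omega) ?_
  · refine (wp_sound (c := .seq (.store (arr n 0 (.var 2)) (.lit 0))
      (.store (arr n 5 (.var 2)) (.lit 1 <<< .var 2))) (Q := fun σ'' =>
      (∀ a < 3 * n + 8, σ''.mem a = 0) ∧ (∀ v < k + 1, σ''.mem (loc n m 0 v) = 0) ∧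
      ∀ v < k + 1, σ''.mem (loc n m 5 v) = 2 ^ v) ?_).mono (by
        show Cmd.cost _ ≤ 20
        exact Nat.le_of_ble_eq_true rfl) fun _ h => h
    have k0 : σ'.reg 0 = m := (fr 0 rfl (by norm_num)).trans g0
    refine wp_store_arr H (by norm_num) k0 hi hk ?_
    refine wp_store_arr H (by norm_num) k0 hi hk ?_
    have ek : (Expr.lit 1 <<< Expr.var 2).eval env
        (σ'.setMem (loc n m 0 k) ((Expr.lit 0).eval env σ')) = 2 ^ k := by
      rw [eval_shl, eval_lit h1w, eval_var, St.setMem_reg, hi, Nat.shiftLeft_eq, one_mul]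
      exact Nat.mod_eq_of_lt (Nat.pow_lt_pow_right (by norm_num) (by omega))
    rw [ek, z0]
    refine ⟨fun a ha => ?_, fun v hv => ?_, fun v hv => ?_⟩
    · rw [setMem_loc_of_lt ha, setMem_loc_of_lt ha, hI.1 a ha]
    · rw [St.setMem_mem, if_neg (fun h => by simpa using ((loc_inj (by omega) hk).1 h).1),
        St.setMem_mem]
      split
      · rfl
      · rename_i hne
        exact hI.2.1 v (lt_of_le_of_ne (by omega) fun h => hne (by rw [h]))
    · rw [St.setMem_mem]
      by_cases hvk : v = k
      · rw [if_pos (by rw [hvk]), hvk]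
      · rw [if_neg (fun h => hvk ((loc_inj (by omega) hk).1 h).2), St.setMem_mem,
          if_neg (fun h => by simpa using ((loc_inj (by omega) hk).1 h).1)]
        exact hI.2.2 v (by omega)
  · rintro σ' ⟨⟨h, -⟩, f⟩
    exact ⟨(f.1 0 rfl).trans g0, (f.1 1 rfl).trans g1, h.1, h.2.1, h.2.2⟩

theorem lt_two_pow_of_testBit {x k : ℕ} (h : ∀ p, x.testBit p = true → p < k) : x < 2 ^ k := by
  refine Nat.lt_pow_two_of_testBit x fun i hi => ?_
  by_contra hx
  have := h i (by simpa using hx)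
  omega

theorem testBit_or_two_pow (x p p' : ℕ) :
    (x ||| 2 ^ p').testBit p = true ↔ x.testBit p = true ∨ p = p' := by
  rw [Nat.testBit_lor, Nat.testBit_two_pow, Bool.or_eq_true, decide_eq_true_iff, eq_comm (a := p)]

/-- By `hu` a label that is written again is written with the same character, so it is correct for
all transitions read so far. -/
theorem readCmd_spec (H : Sizes E w n m env.space) (hc : env.const = wordConsts E w) {σ : St}
    {N : ℕ} {tp tq tf ta : ℕ → ℕ} (hN : N ≤ m * m + m)
    (hp : ∀ e < N, ∃ x, env.inp[4 + 4 * e]? = some x ∧ x.toNat = tp e)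
    (hq : ∀ e < N, ∃ x, env.inp[5 + 4 * e]? = some x ∧ x.toNat = tq e)
    (hf : ∀ e < N, ∃ x, env.inp[6 + 4 * e]? = some x ∧ x.toNat = tf e)
    (ha : ∀ e < N, ∃ x, env.inp[7 + 4 * e]? = some x ∧ x.toNat = ta e)
    (hpm : ∀ e < N, tp e < m) (hqm : ∀ e < N, tq e < m)
    (hu : ∀ e < N, ∀ e' < N, tf e ≠ 0 → tf e' ≠ 0 → tq e = tq e' → ta e = ta e')
    (r0 : σ.reg 0 = m) (r1 : σ.reg 1 = N) (hz : ∀ a < n, σ.mem a = 0)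
    (hl : Arr n m 0 σ.mem fun _ => 0) (hcol : Arr n m 5 σ.mem fun q => 2 ^ q) :
    Tr env (readCmd n) σ (300 * (N + 1)) (fun σ' => ∃ col pred label : ℕ → ℕ,
      Arr n m 5 σ'.mem col ∧ Packed E w n 0 σ'.mem pred ∧ Arr n m 0 σ'.mem label ∧
      (∀ q < m, ∀ p, (col q).testBit p = true ↔
        p = q ∨ ∃ e < N, tf e = 0 ∧ tp e = p ∧ tq e = q) ∧
      (∀ q p, (pred q).testBit p = true ↔ ∃ e < N, tf e ≠ 0 ∧ tp e = p ∧ tq e = q) ∧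
      (∀ e < N, tf e ≠ 0 → label (tq e) = ta e) ∧ (∀ q, label q < 2 ^ w) ∧
      ∀ a, n ≤ a → a < 3 * n + 8 → σ'.mem a = σ.mem a) := by
  have hw0 : 0 < 2 ^ w := by positivity
  have h1w := H.one_lt
  have hww : w < 2 ^ w := Nat.lt_two_pow_self
  have hm := H.m_lt
  have hck := H.ck_le
  have hsq := H.sq_lt
  have hsq' := H.sq_lt_pow
  have h64 := le_w H.big
  -- Costs depend only on the shape of a command and not on `n`, so bounds of this kind hold by
  -- evaluation.
  have hB : (readBody n).cost ≤ 280 := Nat.le_of_ble_eq_true rfl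
  refine Tr.mono (Tr.for (l := 0) (n := N) (fun k σ' => ∃ col pred label : ℕ → ℕ,
      Arr n m 5 σ'.mem col ∧ Packed E w n 0 σ'.mem pred ∧ Arr n m 0 σ'.mem label ∧
      (∀ q < m, ∀ p, (col q).testBit p = true ↔
        p = q ∨ ∃ e < k, tf e = 0 ∧ tp e = p ∧ tq e = q) ∧
      (∀ q p, (pred q).testBit p = true ↔ ∃ e < k, tf e ≠ 0 ∧ tp e = p ∧ tq e = q) ∧
      (∀ e < k, tf e ≠ 0 → label (tq e) = ta e) ∧ (∀ q, label q < 2 ^ w) ∧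
      ∀ a, n ≤ a → a < 3 * n + 8 → σ'.mem a = σ.mem a) 280 (by omega) (by omega)
    (eval_lit (by omega)) rfl (fun σ' h => by rw [eval_var, h 1 rfl (by norm_num), r1]) ?_
    fun k σ' _ hk hI hi fr _ => ?_) (by simp only [Expr.len]; omega) fun σ' h => h.1
  · refine ⟨_, fun _ => 0, _, hcol, packed_zero fun a _ h => hz a (by omega), hl, fun q _ p => ?_,
      fun q p => ?_, fun e he => by omega, fun _ => hw0, fun _ _ _ => rfl⟩
    · rw [Nat.testBit_two_pow]; simp [eq_comm]
    · simp
  · refine (wp_sound (c := readBody n) ?_).mono hB fun _ h => h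
    obtain ⟨col, pred, label, i1, i2, i3, i4, i5, i6, i7, i8⟩ := hI
    have k0 : σ'.reg 0 = m := (fr 0 rfl (by norm_num)).trans r0
    have ei : ∀ c < 8, ∀ σ'' : St, σ''.reg 7 = k →
        (Expr.lit c + Expr.lit 4 * Expr.var 7).eval env σ'' = c + 4 * k := fun c hc σ'' h7 => by
      rw [eval_add, eval_mul, eval_lit (by omega), eval_lit (by omega), eval_var, h7,
        Nat.mod_eq_of_lt (a := 4 * k) (by omega), Nat.mod_eq_of_lt (by omega)]
    refine wp_seq (R := fun σ' => σ'.reg 3 = tp k ∧ σ'.reg 4 = tq k ∧ σ'.reg 5 = tf k ∧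
      σ'.reg 6 = ta k) ?_ fun σ1 e1 f1 => ?_
    · obtain ⟨x, hx, hxp⟩ := hp k hk
      obtain ⟨y, hy, hyp⟩ := hq k hk
      obtain ⟨z, hz', hzp⟩ := hf k hk
      obtain ⟨u, hu', hup⟩ := ha k hk
      refine ⟨x, by rw [ei 4 (by norm_num) _ hi]; exact hx, y, ?_, z, ?_, u, ?_, ?_⟩
      · rw [ei 5 (by norm_num) _ (by simp [St.set_reg, hi])]; exact hy
      · rw [ei 6 (by norm_num) _ (by simp [St.set_reg, hi])]; exact hz'
      · rw [ei 7 (by norm_num) _ (by simp [St.set_reg, hi])]; exact hu'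
      · simp [St.set_reg, hxp, hyp, hzp, hup]
    obtain ⟨g3, g4, g5, g6⟩ := e1
    have m1 : σ1.mem = σ'.mem := f1.2 rfl
    have q0 : σ1.reg 0 = m := (f1.1 0 rfl).trans k0
    have hpk := hpm k hk
    have hqk := hqm k hk
    have ebit : ∀ σ'' : St, σ''.reg 3 = tp k →
        (Expr.lit 1 <<< Expr.var 3).eval env σ'' = 2 ^ tp k := fun σ'' h => by
      rw [eval_shl, eval_lit h1w, eval_var, h, Nat.shiftLeft_eq, one_mul]
      exact Nat.mod_eq_of_lt (Nat.pow_lt_pow_right (by norm_num) (by omega))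
    have hex : ∀ P : ℕ → Prop, (∃ e < k + 1, P e) ↔ (∃ e < k, P e) ∨ P k := fun P => by
      constructor
      · rintro ⟨e, he, h⟩
        rcases Nat.lt_succ_iff_lt_or_eq.1 he with h' | rfl
        · exact Or.inl ⟨e, h', h⟩
        · exact Or.inr h
      · rintro (⟨e, he, h⟩ | h)
        · exact ⟨e, by omega, h⟩
        · exact ⟨k, by omega, h⟩
    refine ⟨fun hc0 => ?_, fun hc0 => ?_⟩
    · have hc0 : tf k = 0 := by simpa [Cond.holds, Expr.eval, g5] using hc0
      refine wp_load_arr H (by norm_num) q0 g4 hqk ?_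
      refine wp_store_arr H (by norm_num) (by simpa [St.set_reg] using q0)
        (by rw [eval_var, St.set_reg, if_neg (by norm_num)]; exact g4) hqk ?_
      have ev : (Expr.var 8 ||| (Expr.lit 1 <<< Expr.var 3)).eval env
          (σ1.set 8 (σ1.mem (loc n m 5 (tq k)))) = col (tq k) ||| 2 ^ tp k := by
        rw [eval_or, ebit _ (by simp [St.set_reg, g3]), eval_var, St.set_reg, if_pos rfl, m1,
          i1 _ hqk]
      rw [ev]
      have hs : (σ1.set 8 (σ1.mem (loc n m 5 (tq k)))).mem = σ'.mem := m1
      refine ⟨Function.update col (tq k) (col (tq k) ||| 2 ^ tp k), pred, label, ?_, ?_, ?_, ?_, ?_,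
        ?_, i7, ?_⟩
      · exact Arr.set (by rw [hs]; exact i1) hqk _
      · refine i2.congr fun a _ h => ?_
        rw [St.set_mem, setMem_loc_of_lt (by omega), hs]
      · exact Arr.set_of_ne (by rw [hs]; exact i3) hqk _ (by norm_num)
      · intro q hq' p
        rw [hex]
        by_cases hqe : q = tq k
        · subst hqe
          rw [Function.update_self, testBit_or_two_pow, i4 _ hq']
          simp only [hc0, true_and, and_true, eq_comm (a := tp k), or_assoc]
        · rw [Function.update_of_ne hqe, i4 q hq']
          simp [Ne.symm hqe]
      · intro q p
        rw [hex, i5]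
        simp [hc0]
      · intro e he hfe
        rcases Nat.lt_succ_iff_lt_or_eq.1 he with h' | rfl
        · exact i6 e h' hfe
        · exact (hfe hc0).elim
      · intro a h1 h2
        rw [St.set_mem, setMem_loc_of_lt h2, hs, i8 a h1 h2]
    · have hc0 : tf k ≠ 0 := by simpa [Cond.holds, Expr.eval, g5] using hc0
      refine wp_seq (R := fun s => s = σ1.setMem (loc n m 0 (tq k)) (ta k)) ?_ fun σ2 e2 f2 => ?_
      · refine wp_store_arr H (by norm_num) q0 g4 hqk ?_
        rw [eval_var, g6]
      refine wp_seq (R := fun s => s.reg 32 = tq k ∧ s.reg 33 = 2 ^ tp k) ?_ fun σ3 e3 f3 => ?_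
      · refine ⟨?_, ?_⟩
        · rw [St.set_reg, if_neg (by norm_num), St.set_reg, if_pos rfl, eval_var, e2]
          exact g4
        · rw [St.set_reg, if_pos rfl, ebit]
          rw [St.set_reg, if_neg (by norm_num), e2]
          exact g3
      have m3 : σ3.mem = (σ1.setMem (loc n m 0 (tq k)) (ta k)).mem := (f3.2 rfl).trans (by rw [e2])
      have hlow : ∀ a < 3 * n + 8, σ3.mem a = σ'.mem a := fun a ha => by
        rw [m3, setMem_loc_of_lt ha, m1]
      have hpw : 2 ^ tp k < 2 ^ (4 * ck E w) := Nat.pow_lt_pow_right (by norm_num) (by omega)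
      have hpr : ∀ q, pred q < 2 ^ (4 * ck E w) := fun q => lt_two_pow_of_testBit fun p h => by
        obtain ⟨e, he, -, h', -⟩ := (i5 q p).1 h
        have := hpm e (by omega)
        omega
      refine wp_mono (wp_packOr H hc (by omega) (y := pred)
        (i2.congr fun a _ h => hlow a (by omega)) hpr e3.1 hqk e3.2 hpw)
        fun σ4 h4 _ => ?_
      have h4' : ∀ a, n ≤ a → σ4.mem a = σ3.mem a := fun a ha => h4.2 a (by omega)
      have hloc : ∀ j v, n ≤ loc n m j v := fun j v => by
        have := le_loc (n := n) (m := m) j v; omega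
      refine ⟨col, Function.update pred (tq k) (pred (tq k) ||| 2 ^ tp k),
        Function.update label (tq k) (ta k), ?_, h4.1, ?_, ?_, ?_, ?_, ?_, ?_⟩
      · refine Arr.congr (Arr.set_of_ne (σ := σ1) (j' := 0) (by rw [m1]; exact i1) hqk (ta k)
          (by norm_num)) fun v _ => ?_
        rw [St.set_mem, h4' _ (hloc _ _), m3]
      · refine Arr.congr (Arr.set (σ := σ1) (by rw [m1]; exact i3) hqk (ta k)) fun v _ => ?_
        rw [St.set_mem, h4' _ (hloc _ _), m3]
      · intro q hq' p
        rw [hex, i4 q hq']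
        simp [hc0]
      · intro q p
        rw [hex]
        by_cases hqe : q = tq k
        · subst hqe
          rw [Function.update_self, testBit_or_two_pow, i5]
          simp [hc0, eq_comm (a := tp k)]
        · rw [Function.update_of_ne hqe, i5]
          simp [Ne.symm hqe]
      · intro e he hfe
        by_cases hqe : tq e = tq k
        · rw [hqe, Function.update_self]
          exact hu k hk e (by omega) hc0 hfe hqe.symm
        · rw [Function.update_of_ne hqe]
          rcases Nat.lt_succ_iff_lt_or_eq.1 he with h' | rfl
          · exact i6 e h' hfe
          · exact (hqe rfl).elim
      · intro q
        rw [Function.update_apply]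
        split
        · obtain ⟨x, -, hx⟩ := ha k hk
          rw [← hx]; exact x.isLt
        · exact i7 q
      · intro a h1 h2
        rw [St.set_mem, h4' a h1, hlow a h2, i8 a h1 h2]

end
end WordRam

/-! ## Reachability -/

namespace WordRam

def warshallBody (n : ℕ) : Cmd :=
  .seq (.load 10 (arr n 5 (.var 8)))
    (.store (arr n 5 (.var 8)) (.var 10 ||| (.var 9 * ((.var 10 >>> .var 7) &&& .lit 1))))

/-- Warshall's algorithm on the bit vectors in array `5`. -/
def warshallCmd (n : ℕ) : Cmd :=
  .for 7 (.lit 0) (.var 0) (.seq (.load 9 (arr n 5 (.var 7)))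
    (.for 8 (.lit 0) (.var 0) (warshallBody n)))

def packCloseCmd (n : ℕ) : Cmd :=
  .for 32 (.lit 0) (.var 0) (.seq (.load 33 (arr n 5 (.var 32))) (packOr n))

/-- One round of Warshall's algorithm. -/
def warshallStep (col : ℕ → ℕ) (k q : ℕ) : ℕ := if (col q).testBit k then col q ||| col k else col q

theorem testBit_warshallStep (col : ℕ → ℕ) (k q p : ℕ) : (warshallStep col k q).testBit p = true ↔
    (col q).testBit p = true ∨ (col q).testBit k = true ∧ (col k).testBit p = true := by
  unfold warshallStep
  split
  · rename_i h; simp [h]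
  · rename_i h; simp [h]

section
variable {E w n m : ℕ} {env : RamEnv w}

/-- Multiplication by the extracted bit `k` selects `col k` or 0 without a branch. -/
theorem wp_warshallBody (H : Sizes E w n m env.space) {σ : St} {col : ℕ → ℕ} {k q : ℕ}
    {Q : St → Prop} (r0 : σ.reg 0 = m) (r7 : σ.reg 7 = k) (r9 : σ.reg 9 = col k)
    (r8 : σ.reg 8 = q) (hq : q < m) (hv : σ.mem (loc n m 5 q) = col q) (hk : col k < 2 ^ w)
    (hQ : Q ((σ.set 10 (col q)).setMem (loc n m 5 q) (warshallStep col k q))) :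
    wp env (warshallBody n) Q σ := by
  refine wp_load_arr H (by norm_num) r0 r8 hq ?_
  rw [hv]
  refine wp_store_arr H (by norm_num) (by rw [St.set_reg, if_neg (by norm_num), r0])
    (by rw [eval_var, St.set_reg, if_neg (by norm_num), r8]) hq ?_
  convert hQ using 2
  rw [eval_or, eval_mul, eval_and, eval_shr, eval_lit H.one_lt, eval_var, eval_var, eval_var,
    St.set_reg, St.set_reg, St.set_reg, if_pos rfl, if_neg (by norm_num), if_neg (by norm_num),
    r7, r9, Nat.and_one_is_mod, Nat.shiftRight_eq_div_pow, ← Nat.toNat_testBit, warshallStep.eq_def]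
  · cases (col q).testBit k
    · simp
    · simp [Nat.mod_eq_of_lt hk]

theorem warshallCmd_spec (H : Sizes E w n m env.space) {σ : St} {col₀ : ℕ → ℕ} {R : ℕ → ℕ → Prop}
    (r0 : σ.reg 0 = m) (hcol : Arr n m 5 σ.mem col₀)
    (hbit : ∀ q < m, ∀ p, (col₀ q).testBit p = true ↔ p = q ∨ R p q)
    (hR : ∀ p q, R p q → p < m) :
    Tr env (warshallCmd n) σ (100 * (m + 1) * (m + 1)) (fun σ' => ∃ col : ℕ → ℕ,
      Arr n m 5 σ'.mem col ∧
      (∀ q < m, ∀ p, (col q).testBit p = true ↔ Relation.ReflTransGen R p q) ∧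
      ∀ a, (∀ v < m, a ≠ loc n m 5 v) → σ'.mem a = σ.mem a) := by
  have ha := H.addr_lt
  have h1w := H.one_lt
  have hm := H.m_lt
  have hck := H.ck_le
  have hB : (warshallBody n).cost ≤ 40 := Nat.le_of_ble_eq_true rfl
  refine Tr.mono (Tr.for (l := 0) (n := m) (fun k σ' => ∃ col : ℕ → ℕ, Arr n m 5 σ'.mem col ∧
      (∀ q < m, ∀ p, (col q).testBit p = true → p < m ∧ Relation.ReflTransGen R p q) ∧
      (∀ q < m, (col q).testBit q = true) ∧
      (∀ q < m, ∀ p, R p q → (col q).testBit p = true) ∧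
      -- The invariant is transitivity through the intermediate states below `k`, which avoids
      -- speaking of paths. For `k = m` it is full transitivity.
      (∀ i < k, ∀ q < m, ∀ p, (col i).testBit p = true → (col q).testBit i = true →
        (col q).testBit p = true) ∧
      ∀ a, (∀ v < m, a ≠ loc n m 5 v) → σ'.mem a = σ.mem a) (8 + 50 * (m + 1)) (by omega)
    (by omega) (eval_lit (by omega)) rfl (fun σ' h => by rw [eval_var, h 0 rfl (by norm_num), r0])
    ?_ fun k σ' _ hk hI hi fr _ => ?_) ?_ fun σ' h => ?_
  · refine ⟨col₀, hcol, fun q hq p hp => ?_, fun q hq => (hbit q hq q).2 (Or.inl rfl),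
      fun q hq p hp => (hbit q hq p).2 (Or.inr hp), fun i hi => by omega, fun _ _ => rfl⟩
    rcases (hbit q hq p).1 hp with rfl | h
    · exact ⟨hq, .refl⟩
    · exact ⟨hR _ _ h, .single h⟩
  · obtain ⟨col, i1, i2, i3, i4, i5, i6⟩ := hI
    have k0 : σ'.reg 0 = m := (fr 0 rfl (by norm_num)).trans r0
    have hcolk : col k < 2 ^ w :=
      (lt_two_pow_of_testBit fun p h => (i2 k hk p h).1).trans
        (Nat.pow_lt_pow_right (by norm_num) (by omega))
    have ld : Tr env (.load 9 (arr n 5 (.var 7))) σ' 8 (fun s => s.reg 9 = col k) := by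
      refine wp_sound (c := .load 9 (arr n 5 (.var 7))) (wp_load_arr H (by norm_num) k0 hi hk ?_)
      rw [St.set_reg, if_pos rfl, i1 k hk]
    refine ld.seq fun σ1 e1 f1 => ?_
    have m1 : σ1.mem = σ'.mem := f1.2 rfl
    have g0 : σ1.reg 0 = m := (f1.1 0 rfl).trans k0
    have g7 : σ1.reg 7 = k := (f1.1 7 rfl).trans hi
    refine Tr.mono (Tr.for (l := 0) (n := m) (fun j s =>
        (∀ q < m, s.mem (loc n m 5 q) = if q < j then warshallStep col k q else col q) ∧
        ∀ a, (∀ v < m, a ≠ loc n m 5 v) → s.mem a = σ.mem a) 40 (by omega)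
      (by omega) (eval_lit (by omega)) rfl (fun s h => by rw [eval_var, h 0 rfl (by norm_num), g0])
      ?_ fun j s _ hj hJ hij fr' _ => ?_) (by simp only [Expr.len]; omega) fun s hs => ?_
    · exact ⟨fun q hq => by rw [if_neg (by omega), St.set_mem, m1, i1 q hq],
        fun a ha => by rw [St.set_mem, m1, i6 a ha]⟩
    · refine Tr.mono (wp_sound (wp_warshallBody H (col := col) (k := k)
        ((fr' 0 rfl (by norm_num)).trans g0) ((fr' 7 rfl (by norm_num)).trans g7)
        ((fr' 9 rfl (by norm_num)).trans e1) hij hj ?_ hcolk ?_)) hB fun _ h => h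
      · rw [hJ.1 j hj, if_neg (by omega)]
      · refine ⟨fun q hq => ?_, fun a ha => ?_⟩
        · rw [St.set_mem, St.setMem_mem, St.set_mem]
          by_cases hqj : q = j
          · rw [hqj, if_pos rfl, if_pos (by omega)]
          · rw [if_neg fun h => hqj ((loc_inj hq hj).1 h).2, hJ.1 q hq]
            by_cases h : q < j
            · rw [if_pos h, if_pos (by omega)]
            · rw [if_neg h, if_neg (by omega)]
        · rw [St.set_mem, St.setMem_mem, if_neg (ha j hj), St.set_mem, hJ.2 a ha]
    · obtain ⟨⟨j1, j2⟩, -⟩ := hs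
      refine ⟨warshallStep col k, fun q hq => by rw [St.set_mem, j1 q hq, if_pos hq],
        fun q hq p hp => ?_, fun q hq => ?_, fun q hq p hp => ?_, fun i hi' q hq p h1 h2 => ?_,
        fun a ha => j2 a ha⟩
      · rcases (testBit_warshallStep ..).1 hp with h | ⟨h1, h2⟩
        · exact i2 q hq p h
        · exact ⟨(i2 k hk p h2).1, (i2 k hk p h2).2.trans (i2 q hq k h1).2⟩
      · exact (testBit_warshallStep ..).2 (Or.inl (i3 q hq))
      · exact (testBit_warshallStep ..).2 (Or.inl (i4 q hq p hp))
      · rw [testBit_warshallStep] at h1 h2 ⊢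
        rcases Nat.lt_succ_iff_lt_or_eq.1 hi' with hik | rfl
        · have him : i < m := by omega
          rcases h1 with h1 | ⟨h1, h1'⟩ <;> rcases h2 with h2 | ⟨h2, h2'⟩
          · exact Or.inl (i5 i hik q hq p h1 h2)
          · exact Or.inr ⟨h2, i5 i hik k hk p h1 h2'⟩
          · exact Or.inr ⟨i5 i hik q hq k h1 h2, h1'⟩
          · exact Or.inr ⟨h2, h1'⟩
        · have h1 : (col i).testBit p = true := by tauto
          have h2 : (col q).testBit i = true := by tauto
          exact Or.inr ⟨h2, h1⟩
  · simp only [Expr.len]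
    rw [Nat.sub_zero]
    exact Nat.mul_le_mul_right _ (by omega)
  · obtain ⟨⟨col, i1, i2, i3, i4, i5, i6⟩, -⟩ := h
    refine ⟨col, i1, fun q hq p => ⟨fun h => (i2 q hq p h).2, fun h => ?_⟩, i6⟩
    induction h using Relation.ReflTransGen.head_induction_on with
    | refl => exact i3 q hq
    | @head a b hab hbq ih =>
      have hb := (i2 q hq b ih).1
      exact i5 b hb q hq a (i4 b hb a hab) ih

theorem packCloseCmd_spec (H : Sizes E w n m env.space) (hc : env.const = wordConsts E w) {σ : St}
    {col : ℕ → ℕ} (r0 : σ.reg 0 = m) (hcol : Arr n m 5 σ.mem col)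
    (hlt : ∀ q < m, col q < 2 ^ m) (hz : ∀ a, n ≤ a → a < 2 * n → σ.mem a = 0) :
    Tr env (packCloseCmd n) σ (200 * (m + 1)) (fun σ' =>
      Packed E w n n σ'.mem (fun q => if q < m then col q else 0) ∧
      ∀ a, (a < n ∨ 2 * n ≤ a) → σ'.mem a = σ.mem a) := by
  have ha := H.addr_lt
  have hB : (Cmd.seq (.load 33 (arr n 5 (.var 32))) (packOr n)).cost ≤ 180 :=
    Nat.le_of_ble_eq_true rfl
  have hloc : ∀ v, 2 * n ≤ loc n m 5 v := fun v => by
    have := le_loc (n := n) (m := m) 5 v; omega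
  refine Tr.mono (Tr.for (l := 0) (n := m) (fun k s =>
      Packed E w n n s.mem (fun q => if q < k then col q else 0) ∧
      ∀ a, (a < n ∨ 2 * n ≤ a) → s.mem a = σ.mem a) 180 (by omega) (by omega)
    (eval_lit (by omega)) rfl (fun s h => by rw [eval_var, h 0 rfl (by norm_num), r0])
    ⟨?_, fun _ _ => rfl⟩ fun k s _ hk hI hi fr _ => ?_) (by simp only [Expr.len]; omega)
    fun σ' h => h.1
  · simp only [Nat.not_lt_zero, if_false]
    exact packed_zero fun a h1 h2 => hz a h1 (by omega)
  · refine Tr.mono (wp_sound ?_) hB fun _ h => h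
    refine wp_seq (R := fun s' => s'.reg 33 = col k) ?_ fun s1 e1 f1 => ?_
    · refine wp_load_arr H (by norm_num) ((fr 0 rfl (by norm_num)).trans r0) hi hk ?_
      rw [St.set_reg, if_pos rfl, hI.2 _ (Or.inr (hloc k)), hcol k hk]
    · have m1 : s1.mem = s.mem := f1.2 rfl
      have hp := two_pow_m_le H
      refine wp_mono (wp_packOr H hc (base := n) (by omega)
        (y := fun q => if q < k then col q else 0) (by rw [m1]; exact hI.1) (fun q => ?_)
        ((f1.1 32 rfl).trans hi) hk e1 ((hlt k hk).trans_le hp)) fun s2 h2 _ => ⟨?_, fun a ha => ?_⟩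
      · split
        · exact (hlt q (by omega)).trans_le hp
        · positivity
      · refine cast (congrArg _ (funext fun q => ?_)) h2.1
        by_cases hq : q = k
        · subst hq; simp
        · rw [Function.update_of_ne hq]
          by_cases h : q < k
          · rw [if_pos h, if_pos (by omega)]
          · rw [if_neg h, if_neg (by omega)]
      · rw [St.set_mem, h2.2 a (by omega), m1, hI.2 a ha]

end
end WordRam

/-! ## Sorting -/

namespace WordRam

def sortBody (n : ℕ) : Cmd :=
  .seq (.load 14 (arr n 1 (.var 13))) (.seq (lowCmd 15 (.var 12) (.var 14))
    (.ite ⟨false, (.var 12 >>> .var 15) &&& .lit 1, .lit 0⟩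
      (.seq (.store (arr n 1 (.var 13)) (.var 12)) (.assign 12 (.var 14)))
      (.assign 12 (.var 12))))

/-- Sort array `0` into array `1`, by insertion. -/
def sortCmd (n : ℕ) : Cmd :=
  .for 11 (.lit 0) (.var 0) (.seq (.load 12 (arr n 0 (.var 11)))
    (.seq (.for 13 (.lit 0) (.var 11) (sortBody n))
      (.seq (.store (arr n 1 (.var 11)) (.var 12)) (.store (arr n 3 (.var 11)) (.lit 0)))))

theorem RevLe.trans {x y z w : ℕ} (hx : x < 2 ^ w) (hy : y < 2 ^ w) (hz : z < 2 ^ w)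
    (hxy : RevLe x y) (hyz : RevLe y z) : RevLe x z :=
  (hxy.three (B := w) hyz (low_le le_rfl hx hy) (low_le le_rfl hy hz)).1

section
variable {E w n m : ℕ} {env : RamEnv w}

/-- Equal keys need no special case: their `low` exceeds `w`, so the shift yields 0, in accordance
with reflexivity. -/
theorem revLe_iff_shiftRight {x y : ℕ} (hx : x < 2 ^ w) :
    (x >>> low (big w) x y) &&& 1 = 0 ↔ RevLe x y := by
  have h1 : (x >>> low (big w) x y) &&& 1 = 0 ↔ x.testBit (low (big w) x y) = false := by
    rw [Nat.and_one_is_mod, Nat.shiftRight_eq_div_pow, ← Nat.toNat_testBit]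
    cases x.testBit (low (big w) x y) <;> simp
  rw [h1]
  by_cases h : x = y
  · subst h
    refine ⟨fun _ => Or.inl rfl, fun _ => ?_⟩
    rw [low_self]
    exact Nat.testBit_eq_false_of_lt (hx.trans_le
      (Nat.pow_le_pow_right (by norm_num) (w_lt_big (w := w)).le))
  · rw [low_congr (B' := 0) h]
    exact ⟨Or.inr, fun h' => h'.resolve_left h⟩

theorem wp_sortBody (H : Sizes E w n m env.space) (hc : env.const = wordConsts E w) {σ : St}
    {x y j : ℕ} {Q : St → Prop} (r0 : σ.reg 0 = m) (r12 : σ.reg 12 = x) (r13 : σ.reg 13 = j)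
    (hj : j < m) (hy : σ.mem (loc n m 1 j) = y) (hxw : x < 2 ^ w) (hyw : y < 2 ^ w)
    (hQ : ∀ σ', (∀ r, r ≠ 12 → r ≠ 14 → r ≠ 15 → σ'.reg r = σ.reg r) →
      (RevLe x y ∧ σ'.reg 12 = y ∧ σ'.mem = (σ.setMem (loc n m 1 j) x).mem ∨
        ¬ RevLe x y ∧ σ'.reg 12 = x ∧ σ'.mem = σ.mem) → Q σ') :
    wp env (sortBody n) Q σ := by
  refine wp_load_arr H (by norm_num) r0 r13 hj ?_
  rw [hy]
  refine wp_seq (R := fun s => s = (σ.set 14 y).set 15 (low (big w) x y))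
    (wp_lowCmd H.big hc (x := x) (y := y) ?_ ?_ hxw hyw rfl) fun s hs _ => ?_
  · rw [eval_var, St.set_reg, if_neg (by norm_num), r12]
  · rw [eval_var, St.set_reg, if_pos rfl]
  · have e : ∀ r, r ≠ 14 → r ≠ 15 → s.reg r = σ.reg r := fun r h1 h2 => by
      rw [hs, St.set_reg, if_neg h2, St.set_reg, if_neg h1]
    have e12 : s.reg 12 = x := (e 12 (by norm_num) (by norm_num)).trans r12
    have e14 : s.reg 14 = y := by
      rw [hs, St.set_reg, if_neg (by norm_num), St.set_reg, if_pos rfl]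
    have e15 : s.reg 15 = low (big w) x y := by rw [hs, St.set_reg, if_pos rfl]
    have em : s.mem = σ.mem := by rw [hs]; rfl
    have hcond : (⟨false, (.var 12 >>> .var 15) &&& .lit 1, .lit 0⟩ : Cond).holds env s ↔
        RevLe x y := by
      rw [← revLe_iff_shiftRight hxw, Cond.holds, if_neg (by simp), eval_and, eval_shr,
        eval_lit H.one_lt, eval_lit (by positivity), eval_var, eval_var, e12, e15]
    refine ⟨fun h => ?_, fun h => ?_⟩
    · refine wp_store_arr H (by norm_num) ((e 0 (by norm_num) (by norm_num)).trans r0)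
        ((e 13 (by norm_num) (by norm_num)).trans r13) hj ?_
      refine hQ _ (fun r h1 h2 h3 => ?_) (Or.inl ⟨hcond.1 h, ?_, ?_⟩)
      · rw [St.set_reg, if_neg h1, St.setMem_reg, e r h2 h3]
      · rw [St.set_reg, if_pos rfl, eval_var, St.setMem_reg, e14]
      · rw [St.set_mem, eval_var, e12, St.setMem, em, St.setMem]
    · refine hQ _ (fun r h1 h2 h3 => ?_) (Or.inr ⟨fun h' => h (hcond.2 h'), ?_, ?_⟩)
      · rw [St.set_reg, if_neg h1, e r h2 h3]
      · rw [St.set_reg, if_pos rfl, eval_var, e12]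
      · rw [St.set_mem, em]

/-- Of the content of the sorted array only the occurrence of every label is recorded, which is all
that injectivity on labels requires. Clearing array 3 puts all keys into one group for the first
pass. -/
theorem sortCmd_spec (H : Sizes E w n m env.space) (hc : env.const = wordConsts E w) {σ : St}
    {label : ℕ → ℕ} (r0 : σ.reg 0 = m) (hl : Arr n m 0 σ.mem label) (hlw : ∀ q, label q < 2 ^ w) :
    Tr env (sortCmd n) σ (400 * (m + 1) * (m + 1)) (fun σ' => ∃ X : ℕ → ℕ,
      Arr n m 1 σ'.mem X ∧ (∀ a b, a < b → b < m → RevLe (X a) (X b)) ∧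
      (∀ q < m, ∃ a < m, X a = label q) ∧ (∀ a, X a < 2 ^ w) ∧ Arr n m 3 σ'.mem (fun _ => 0) ∧
      ∀ a, (∀ v < m, a ≠ loc n m 1 v ∧ a ≠ loc n m 3 v) → σ'.mem a = σ.mem a) := by
  have ha := H.addr_lt
  have hB : (sortBody n).cost ≤ 200 := Nat.le_of_ble_eq_true rfl
  have hB2 : (Cmd.seq (.store (arr n 1 (.var 11)) (.var 12))
    (.store (arr n 3 (.var 11)) (.lit 0))).cost ≤ 40 := Nat.le_of_ble_eq_true rfl
  have hfr : ∀ (s : St) (j v x : ℕ) (f : ℕ → ℕ), j ≠ 0 → Arr n m 0 s.mem f → v < m →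
    Arr n m 0 (s.setMem (loc n m j v) x).mem f := fun s j v x f hj h hv =>
      Arr.set_of_ne h hv x (Ne.symm hj)
  refine Tr.mono (Tr.for (l := 0) (n := m) (fun i s => ∃ X : ℕ → ℕ,
      (∀ v < i, s.mem (loc n m 1 v) = X v) ∧ (∀ a b, a < b → b < i → RevLe (X a) (X b)) ∧
      (∀ q < i, ∃ a < i, X a = label q) ∧ (∀ a, X a < 2 ^ w) ∧
      (∀ v < i, s.mem (loc n m 3 v) = 0) ∧
      ∀ a, (∀ v < m, a ≠ loc n m 1 v ∧ a ≠ loc n m 3 v) → s.mem a = σ.mem a)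
    (8 + (250 * m + 300)) (by omega)
    (by omega) (eval_lit (by omega)) rfl (fun σ' h => by rw [eval_var, h 0 rfl (by norm_num), r0])
    ?_ fun i σ' _ hk hI hi fr _ => ?_) ?_ fun σ' h => ?_
  · exact ⟨fun _ => 0, fun _ h => by omega, fun _ _ _ h => by omega, fun _ h => by omega,
      fun _ => by positivity, fun _ h => by omega, fun _ _ => rfl⟩
  · obtain ⟨X, i1, i2, i3, i4, i5, i6⟩ := hI
    have k0 : σ'.reg 0 = m := (fr 0 rfl (by norm_num)).trans r0
    have ld : Tr env (.load 12 (arr n 0 (.var 11))) σ' 8 (fun s => s.reg 12 = label i) := by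
      refine wp_sound (c := .load 12 (arr n 0 (.var 11)))
        (wp_load_arr H (by norm_num) k0 hi hk ?_)
      rw [St.set_reg, if_pos rfl, i6, hl i hk]
      exact fun v hv => ⟨fun h => by simpa using ((loc_inj hk hv).1 h).1,
        fun h => by simpa using ((loc_inj hk hv).1 h).1⟩
    refine ld.seq fun σ1 e1 f1 => ?_
    have m1 : σ1.mem = σ'.mem := f1.2 rfl
    have g0 : σ1.reg 0 = m := (f1.1 0 rfl).trans k0
    have g11 : σ1.reg 11 = i := (f1.1 11 rfl).trans hi
    -- The key carried in `var 12` is exchanged with each entry that it precedes. The prefix stays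
    -- sorted throughout, and the entries passed so far precede the carried key.
    have inner := Tr.for (env := env) (σ := σ1) (i := 13) (lo := .lit 0) (hi := .var 11)
      (body := sortBody n) (l := 0) (n := i) (fun j s => ∃ Y : ℕ → ℕ,
        (∀ v < i, s.mem (loc n m 1 v) = Y v) ∧ (∀ a b, a < b → b < i → RevLe (Y a) (Y b)) ∧
        (∀ a < j, RevLe (Y a) (s.reg 12)) ∧
        (∀ q ≤ i, s.reg 12 = label q ∨ ∃ a < i, Y a = label q) ∧ (∀ a, Y a < 2 ^ w) ∧
        s.reg 12 < 2 ^ w ∧ (∀ v < i, s.mem (loc n m 3 v) = 0) ∧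
        ∀ a, (∀ v < m, a ≠ loc n m 1 v ∧ a ≠ loc n m 3 v) → s.mem a = σ.mem a) 200 (by omega)
      (by omega) (eval_lit (by omega)) rfl (fun s h => by rw [eval_var, h 11 rfl (by norm_num), g11])
      ?_ fun j s _ hj hJ hij fr' _ => ?_
    · refine (inner.frame).seq (t' := 40) (fun s hs _ => ?_) |>.mono ?_ fun _ h => h
      · obtain ⟨⟨⟨Y, j1, j2, j3, j4, j5, j6, j7, j8⟩, -⟩, f⟩ := hs
        have q0 : s.reg 0 = m := (f.1 0 rfl).trans g0
        have q11 : s.reg 11 = i := (f.1 11 rfl).trans g11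
        refine Tr.mono (wp_sound (c := Cmd.seq (.store (arr n 1 (.var 11)) (.var 12))
          (.store (arr n 3 (.var 11)) (.lit 0))) (wp_store_arr H (by norm_num) q0 q11 hk
            (wp_store_arr H (by norm_num) q0 q11 hk (Q := fun s' => s' = (s.setMem (loc n m 1 i)
              (s.reg 12)).setMem (loc n m 3 i) 0) ?_))) hB2 fun s' hs' => ?_
        · rw [eval_lit (by positivity), eval_var]
        · subst hs'
          refine ⟨Function.update Y i (s.reg 12), fun v hv => ?_, fun a b hab hb => ?_,
            fun q hq => ?_, fun a => ?_, fun v hv => ?_, fun a ha => ?_⟩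
          · rw [St.set_mem, St.setMem_mem,
              if_neg fun h => by simpa using ((loc_inj (by omega) hk).1 h).1, St.setMem_mem]
            by_cases hvi : v = i
            · subst hvi; rw [if_pos rfl, Function.update_self]
            · rw [if_neg fun h => hvi ((loc_inj (by omega) hk).1 h).2, Function.update_of_ne hvi,
                j1 v (by omega)]
          · rw [Function.update_of_ne (a := a) (by omega)]
            by_cases hbi : b = i
            · subst hbi; rw [Function.update_self]; exact j3 a hab
            · rw [Function.update_of_ne hbi]; exact j2 a b hab (by omega)
          · rcases j4 q (by omega) with h | ⟨a, ha, h⟩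
            · exact ⟨i, by omega, by rw [Function.update_self, h]⟩
            · exact ⟨a, by omega, by rw [Function.update_of_ne (by omega), h]⟩
          · rw [Function.update_apply]
            split
            · exact j6
            · exact j5 a
          · rw [St.set_mem, St.setMem_mem]
            by_cases hvi : v = i
            · subst hvi; rw [if_pos rfl]
            · rw [if_neg fun h => hvi ((loc_inj (by omega) hk).1 h).2, St.setMem_mem,
                if_neg fun h => by simpa using ((loc_inj (by omega) hk).1 h).1, j7 v (by omega)]
          · rw [St.set_mem, St.setMem_mem, if_neg (ha i hk).2, St.setMem_mem, if_neg (ha i hk).1,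
              j8 a ha]
      · simp only [Expr.len]
        omega
    · refine ⟨X, fun v hv => by rw [St.set_mem, m1, i1 v hv], i2, fun a h => by omega,
        fun q hq => ?_, i4, ?_, fun v hv => by rw [St.set_mem, m1, i5 v hv],
        fun a ha => by rw [St.set_mem, m1, i6 a ha]⟩
      · rcases Nat.lt_or_eq_of_le hq with h | rfl
        · exact Or.inr (i3 q h)
        · exact Or.inl (by rw [St.set_reg, if_neg (by norm_num), e1])
      · rw [St.set_reg, if_neg (by norm_num), e1]; exact hlw i
    · obtain ⟨Y, j1, j2, j3, j4, j5, j6, j7, j8⟩ := hJ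
      refine Tr.mono (wp_sound (wp_sortBody H hc (j := j) ((fr' 0 rfl (by norm_num)).trans g0) rfl
        hij (by omega) (j1 j hj) j6 (j5 j) fun s' hr hcase => ?_)) hB fun _ h => h
      rcases hcase with ⟨hle, h12, hmem⟩ | ⟨hle, h12, hmem⟩
      · have hu : ∀ a, a ≠ j → Function.update Y j (s.reg 12) a = Y a := fun a h =>
          Function.update_of_ne h _ _
        refine ⟨Function.update Y j (s.reg 12), fun v hv => ?_, fun a b hab hb => ?_,
          fun a ha => ?_, fun q hq => ?_, fun a => ?_, ?_, fun v hv => ?_, fun a ha => ?_⟩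
        · rw [St.set_mem, hmem, St.setMem_mem]
          by_cases hvj : v = j
          · subst hvj; rw [if_pos rfl, Function.update_self]
          · rw [if_neg fun h => hvj ((loc_inj (by omega) (by omega)).1 h).2, hu v hvj, j1 v hv]
        · by_cases hbj : b = j
          · subst hbj; rw [Function.update_self, hu a (by omega)]; exact j3 a hab
          · rw [hu b hbj]
            by_cases haj : a = j
            · subst haj; rw [Function.update_self]
              exact hle.trans j6 (j5 _) (j5 _) (j2 a b hab hb)
            · rw [hu a haj]; exact j2 a b hab hb
        · rw [St.set_reg, if_neg (by norm_num), h12]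
          by_cases haj : a = j
          · subst haj; rw [Function.update_self]; exact hle
          · rw [hu a haj]; exact j2 a j (by omega) hj
        · rw [St.set_reg, if_neg (by norm_num), h12]
          rcases j4 q hq with h | ⟨a, ha, h⟩
          · exact Or.inr ⟨j, hj, by rw [Function.update_self, h]⟩
          · by_cases haj : a = j
            · subst haj; exact Or.inl h
            · exact Or.inr ⟨a, ha, by rw [hu a haj, h]⟩
        · rw [Function.update_apply]
          split
          · exact j6
          · exact j5 a
        · rw [St.set_reg, if_neg (by norm_num), h12]; exact j5 j
        · rw [St.set_mem, hmem, St.setMem_mem,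
            if_neg fun h => by simpa using ((loc_inj (by omega) (by omega)).1 h).1, j7 v hv]
        · rw [St.set_mem, hmem, St.setMem_mem, if_neg (ha j (by omega)).1, j8 a ha]
      · refine ⟨Y, fun v hv => by rw [St.set_mem, hmem, j1 v hv], j2, fun a ha => ?_,
          fun q hq => ?_, j5, ?_, fun v hv => by rw [St.set_mem, hmem, j7 v hv],
          fun a ha => by rw [St.set_mem, hmem, j8 a ha]⟩
        · rw [St.set_reg, if_neg (by norm_num), h12]
          rcases Nat.lt_succ_iff_lt_or_eq.1 ha with h | rfl
          · exact j3 a h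
          · exact revLe_of_not hle
        · rw [St.set_reg, if_neg (by norm_num), h12]; exact j4 q hq
        · rw [St.set_reg, if_neg (by norm_num), h12]; exact j6
  · simp only [Expr.len]
    rw [Nat.sub_zero]
    exact Nat.mul_le_mul_right _ (by omega)
  · obtain ⟨⟨X, i1, i2, i3, i4, i5, i6⟩, -⟩ := h
    exact ⟨X, i1, i2, i3, i4, i5, i6⟩

end
end WordRam

/-! ## The next class, counters, and their minimum -/

namespace WordRam

open Finset

/-- The class of `a` and `b`. -/
def clsCmd (r : ℕ) (a b : Expr) : Cmd := .seq (lowCmd r a b) (.assign r (.var r >>> .wc 7))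

/-- The class of two adjacent keys. -/
noncomputable def adj (E w : ℕ) (X : ℕ → ℕ) (l : ℕ) : ℕ := cls E w (X (l - 1)) (X l)

def bestBody (n : ℕ) : Cmd :=
  .seq (.load 43 (arr n 1 (.var 41))) (.seq (clsCmd 44 (.var 42) (.var 43))
    (.seq (.assign 42 (.var 43)) (.ite ⟨true, .var 44, .var 16⟩
      (.ite ⟨true, .var 17, .var 44⟩ (.assign 17 (.var 44)) (.assign 17 (.var 17)))
      (.assign 17 (.var 17)))))

/-- The largest class of adjacent keys below `var 16`, in `var 17`. -/
def bestCmd (n : ℕ) : Cmd :=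
  .seq (.seq (.assign 17 (.lit 0)) (.load 42 (arr n 1 (.lit 0)))) (.for 41 (.lit 0) (.var 0)
    (bestBody n))

/-- Set array `j` to `0`. -/
def clearCmd (n j : ℕ) : Cmd := .for 41 (.lit 0) (.var 0) (.store (arr n j (.var 41)) (.lit 0))

def argminBody (n : ℕ) : Cmd :=
  .seq (.load 43 (arr n 4 (.var 41))) (.ite ⟨true, .var 43, .var 19⟩
    (.seq (.assign 19 (.var 43)) (.assign 18 (.var 41))) (.assign 18 (.var 18)))

/-- The position of the minimum of array `4`, in `var 18`. -/
def argminCmd (n : ℕ) : Cmd :=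
  .seq (.seq (.assign 18 (.lit 0)) (.load 19 (arr n 4 (.lit 0)))) (.for 41 (.lit 0) (.var 0)
    (argminBody n))

theorem St.set_set (σ : St) (r x y : ℕ) : (σ.set r x).set r y = σ.set r y := by
  simp [St.set]

section
variable {E w n m : ℕ} {env : RamEnv w}

theorem Tr.of_wp {c : Cmd} {σ : St} {t : ℕ} {Q : St → Prop} (h : wp env c Q σ) (ht : c.cost ≤ t) :
    Tr env c σ t Q := (wp_sound h).mono ht fun _ h => h

theorem wp_clsCmd (h : E + 3 ≤ lgS w) (hc : env.const = wordConsts E w) {σ : St} {a b : Expr}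
    {x y r : ℕ} {Q : St → Prop} (ha : a.eval env σ = x) (hb : b.eval env σ = y)
    (hx : x < 2 ^ w) (hy : y < 2 ^ w) (hQ : Q (σ.set r (cls E w x y))) :
    wp env (clsCmd r a b) Q σ := by
  refine wp_seq (R := fun s => s = σ.set r (low (big w) x y)) (wp_lowCmd h hc ha hb hx hy rfl)
    fun s hs _ => ?_
  subst hs
  show Q _
  rw [St.set_set, eval_shr, eval_var, St.set_reg, if_pos rfl, eval_wc h hc]
  show Q (σ.set r (low (big w) x y >>> (lgS w + E)))
  rwa [Nat.shiftRight_eq_div_pow, ← ck]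

/-- The search starts from 0, so chunk 0 is chosen if no adjacent class is below `cur`; such a round
may have no pairs, but it makes the outer loop end. At index 0 the first key is compared with
itself, giving the class `4 * qs E w`, which the caller's `cur` never exceeds. -/
theorem bestCmd_spec (H : Sizes E w n m env.space) (hc : env.const = wordConsts E w) {σ : St}
    {X : ℕ → ℕ} {cur : ℕ} (r0 : σ.reg 0 = m) (r16 : σ.reg 16 = cur) (hX : Arr n m 1 σ.mem X)
    (hXw : ∀ a, X a < 2 ^ w) (hcur : 0 < cur) :
    Tr env (bestCmd n) σ (300 * (m + 1)) (fun σ' => σ'.reg 17 < cur ∧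
      (∀ l < m, adj E w X l < cur → adj E w X l ≤ σ'.reg 17) ∧
      (σ'.reg 17 = 0 ∨ ∃ l < m, adj E w X l = σ'.reg 17 ∧ adj E w X l < cur)) := by
  have ha := H.addr_lt
  have hp := H.pos
  have hB : (bestBody n).cost ≤ 250 := Nat.le_of_ble_eq_true rfl
  have ld : Tr env (.seq (.assign 17 (.lit 0)) (.load 42 (arr n 1 (.lit 0)))) σ 20
      (fun s => s.reg 17 = 0 ∧ s.reg 42 = X 0) := by
    refine Tr.of_wp ?_ (Nat.le_of_ble_eq_true rfl)
    rw [wp, wp]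
    refine wp_load_arr H (by norm_num) (by rw [St.set_reg, if_neg (by norm_num), r0])
      (eval_lit (by positivity)) hp ⟨?_, ?_⟩
    · rw [St.set_reg, if_neg (by norm_num), St.set_reg, if_pos rfl, eval_lit (by positivity)]
    · rw [St.set_reg, if_pos rfl, St.set_mem, hX 0 hp]
  refine (ld.seq (t' := 261 * (m + 1)) fun σ1 e1 f1 => ?_).mono (by omega) fun _ h => h
  have m1 : σ1.mem = σ.mem := f1.2 rfl
  have g0 : σ1.reg 0 = m := (f1.1 0 rfl).trans r0
  have g16 : σ1.reg 16 = cur := (f1.1 16 rfl).trans r16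
  refine Tr.mono (Tr.for (l := 0) (n := m) (fun k s => s.reg 42 = X (k - 1) ∧ s.reg 17 < cur ∧
      (∀ l < k, adj E w X l < cur → adj E w X l ≤ s.reg 17) ∧
      (s.reg 17 = 0 ∨ ∃ l < k, adj E w X l = s.reg 17 ∧ adj E w X l < cur)) 250 (by omega)
    (by omega) (eval_lit (by omega)) rfl (fun σ' h => by rw [eval_var, h 0 rfl (by norm_num), g0])
    ?_ fun k s _ hk hI hi fr hmem => ?_) (by simp only [Expr.len]; omega) fun σ' h => h.1.2
  · refine ⟨?_, ?_, fun _ h => by omega, Or.inl ?_⟩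
    · rw [St.set_reg, if_neg (by norm_num), e1.2]
    · rw [St.set_reg, if_neg (by norm_num), e1.1]; exact hcur
    · rw [St.set_reg, if_neg (by norm_num), e1.1]
  · obtain ⟨i1, i2, i3, i4⟩ := hI
    have q0 : s.reg 0 = m := (fr 0 rfl (by norm_num)).trans g0
    have q16 : s.reg 16 = cur := (fr 16 rfl (by norm_num)).trans g16
    refine Tr.of_wp ?_ hB
    refine wp_load_arr H (by norm_num) q0 hi hk ?_
    rw [hmem rfl, m1, hX k hk]
    refine wp_seq (R := fun s' => s' = (s.set 43 (X k)).set 44 (adj E w X k))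
      (wp_clsCmd H.big hc (x := X (k - 1)) (y := X k) ?_ ?_ (hXw _) (hXw _) rfl)
      fun s' hs' _ => ?_
    · rw [eval_var, St.set_reg, if_neg (by norm_num), i1]
    · rw [eval_var, St.set_reg, if_pos rfl]
    have a16 : s'.reg 16 = cur := by simp [hs', St.set_reg, q16]
    have a17 : s'.reg 17 = s.reg 17 := by simp [hs', St.set_reg]
    have a43 : s'.reg 43 = X k := by simp [hs', St.set_reg]
    have a44 : s'.reg 44 = adj E w X k := by simp [hs', St.set_reg]
    set Goal : St → Prop := fun s => s.reg 42 = X (k + 1 - 1) ∧ s.reg 17 < cur ∧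
      (∀ l < k + 1, adj E w X l < cur → adj E w X l ≤ s.reg 17) ∧
      (s.reg 17 = 0 ∨ ∃ l < k + 1, adj E w X l = s.reg 17 ∧ adj E w X l < cur)
    have fin : ∀ v, v < cur → (∀ l < k + 1, adj E w X l < cur → adj E w X l ≤ v) →
        (v = 0 ∨ ∃ l < k + 1, adj E w X l = v ∧ adj E w X l < cur) →
        Goal (((s'.set 42 (X k)).set 17 v).set 41 (k + 1)) := by
      intro v h1 h2 h3
      have e17 : (((s'.set 42 (X k)).set 17 v).set 41 (k + 1)).reg 17 = v := by simp [St.set_reg]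
      have e42 : (((s'.set 42 (X k)).set 17 v).set 41 (k + 1)).reg 42 = X k := by
        simp [St.set_reg]
      show _ ∧ _
      rw [e17, e42]
      exact ⟨rfl, h1, h2, h3⟩
    have old : cur ≤ adj E w X k ∨ adj E w X k ≤ s.reg 17 →
        Goal (((s'.set 42 (X k)).set 17 (s.reg 17)).set 41 (k + 1)) := fun h =>
      fin _ i2 (fun l hl hlt => by
          rcases Nat.lt_succ_iff_lt_or_eq.1 hl with h' | rfl
          · exact i3 l h' hlt
          · omega)
        (i4.imp_right fun ⟨l, hl, h'⟩ => ⟨l, by omega, h'⟩)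
    have c1 : ∀ s'' : St, s''.reg 44 = adj E w X k → s''.reg 16 = cur →
        ((⟨true, .var 44, .var 16⟩ : Cond).holds env s'' ↔ adj E w X k < cur) := fun s'' h h' => by
      rw [Cond.holds, if_pos rfl, eval_var, eval_var, h, h']
    have c2 : ∀ s'' : St, s''.reg 44 = adj E w X k → s''.reg 17 = s.reg 17 →
        ((⟨true, .var 17, .var 44⟩ : Cond).holds env s'' ↔ s.reg 17 < adj E w X k) :=
      fun s'' h h' => by rw [Cond.holds, if_pos rfl, eval_var, eval_var, h, h']
    have b16 : (s'.set 42 ((Expr.var 43).eval env s')).reg 16 = cur := by simp [St.set_reg, a16]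
    have b17 : (s'.set 42 ((Expr.var 43).eval env s')).reg 17 = s.reg 17 := by
      simp [St.set_reg, a17]
    have b44 : (s'.set 42 ((Expr.var 43).eval env s')).reg 44 = adj E w X k := by
      simp [St.set_reg, a44]
    simp only [wp]
    rw [c1 _ b44 b16, c2 _ b44 b17]
    simp only [eval_var] at b16 b17 b44 ⊢
    rw [a43] at b17 b44 ⊢
    rw [b17, b44]
    refine ⟨fun h1 => ⟨fun h2 => ?_, fun h2 => old (Or.inr (not_lt.1 h2))⟩,
      fun h1 => old (Or.inl (not_lt.1 h1))⟩
    refine fin _ h1 (fun l hl hlt => ?_) (Or.inr ⟨k, by omega, rfl, h1⟩)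
    rcases Nat.lt_succ_iff_lt_or_eq.1 hl with h' | rfl
    · exact (i3 l h' hlt).trans h2.le
    · exact le_rfl

theorem clearCmd_spec (H : Sizes E w n m env.space) {σ : St} {j : ℕ} (hj : j < 6)
    (r0 : σ.reg 0 = m) : Tr env (clearCmd n j) σ (40 * (m + 1)) (fun σ' =>
      Arr n m j σ'.mem (fun _ => 0) ∧ ∀ a, (∀ v < m, a ≠ loc n m j v) → σ'.mem a = σ.mem a) := by
  have ha := H.addr_lt
  refine Tr.mono (Tr.for (l := 0) (n := m) (fun k s => (∀ v < k, s.mem (loc n m j v) = 0) ∧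
      ∀ a, (∀ v < m, a ≠ loc n m j v) → s.mem a = σ.mem a) 9 (by omega)
    (by omega) (eval_lit (by omega)) rfl (fun σ' h => by rw [eval_var, h 0 rfl (by norm_num), r0])
    ⟨fun _ h => by omega, fun _ _ => rfl⟩ fun k s _ hk hI hi fr _ => Tr.of_wp ?_
      (Nat.le_of_ble_eq_true rfl)) (by simp only [Expr.len]; omega) fun σ' h => h.1
  refine wp_store_arr H hj ((fr 0 rfl (by norm_num)).trans r0) hi hk ⟨fun v hv => ?_, fun a ha => ?_⟩
  · rw [St.set_mem, St.setMem_mem, eval_lit (by omega)]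
    split
    · rfl
    · rename_i hne
      exact hI.1 v (lt_of_le_of_ne (by omega) fun h => hne (by rw [h]))
  · rw [St.set_mem, St.setMem_mem, if_neg (ha k hk), hI.2 a ha]

theorem argminCmd_spec (H : Sizes E w n m env.space) {σ : St} {c : ℕ → ℕ} (r0 : σ.reg 0 = m)
    (hC : Arr n m 4 σ.mem c) : Tr env (argminCmd n) σ (100 * (m + 1)) (fun σ' => σ'.reg 18 < m ∧
      ∀ v < m, c (σ'.reg 18) ≤ c v) := by
  have ha := H.addr_lt
  have hp := H.pos
  have hB : (argminBody n).cost ≤ 40 := Nat.le_of_ble_eq_true rfl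
  have ld : Tr env (.seq (.assign 18 (.lit 0)) (.load 19 (arr n 4 (.lit 0)))) σ 20
      (fun s => s.reg 18 = 0 ∧ s.reg 19 = c 0) := by
    refine Tr.of_wp ?_ (Nat.le_of_ble_eq_true rfl)
    rw [wp, wp]
    refine wp_load_arr H (by norm_num) (by rw [St.set_reg, if_neg (by norm_num), r0])
      (eval_lit (by positivity)) hp ⟨?_, ?_⟩
    · rw [St.set_reg, if_neg (by norm_num), St.set_reg, if_pos rfl, eval_lit (by positivity)]
    · rw [St.set_reg, if_pos rfl, St.set_mem, hC 0 hp]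
  refine (ld.seq (t' := 50 * (m + 1)) fun σ1 e1 f1 => ?_).mono (by omega) fun _ h => h
  have m1 : σ1.mem = σ.mem := f1.2 rfl
  have g0 : σ1.reg 0 = m := (f1.1 0 rfl).trans r0
  refine Tr.mono (Tr.for (l := 0) (n := m) (fun k s => s.reg 18 < m ∧ s.reg 19 = c (s.reg 18) ∧
      ∀ v < k, c (s.reg 18) ≤ c v) 40 (by omega)
    (by omega) (eval_lit (by omega)) rfl (fun σ' h => by rw [eval_var, h 0 rfl (by norm_num), g0])
    ?_ fun k s _ hk hI hi fr hmem => Tr.of_wp ?_ hB) (by simp only [Expr.len]; omega)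
    fun σ' h => ⟨h.1.1, h.1.2.2⟩
  · simp [St.set_reg, e1.1, e1.2, hp]
  · obtain ⟨i1, i2, i3⟩ := hI
    have q0 : s.reg 0 = m := (fr 0 rfl (by norm_num)).trans g0
    refine wp_load_arr H (by norm_num) q0 hi hk ?_
    rw [hmem rfl, m1, hC k hk]
    have a18 : (s.set 43 (c k)).reg 18 = s.reg 18 := by simp [St.set_reg]
    have a19 : (s.set 43 (c k)).reg 19 = s.reg 19 := by simp [St.set_reg]
    have a43 : (s.set 43 (c k)).reg 43 = c k := by simp [St.set_reg]
    have a41 : (s.set 43 (c k)).reg 41 = k := by simp [St.set_reg, hi]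
    refine ⟨fun h => ?_, fun h => ?_⟩
    all_goals
      rw [Cond.holds, if_pos rfl, eval_var, eval_var, a43, a19, i2] at h
    · simp only [wp, St.set_reg, Expr.eval]
      simp only [hi]
      norm_num
      refine ⟨hk, fun v hv => ?_⟩
      rcases Nat.lt_succ_iff_lt_or_eq.1 (Nat.lt_succ_of_le hv) with h' | rfl
      · exact h.le.trans (i3 v h')
      · exact le_rfl
    · simp only [wp, St.set_reg, Expr.eval]
      norm_num
      refine ⟨i1, i2, fun v hv => ?_⟩
      rcases Nat.lt_succ_iff_lt_or_eq.1 (Nat.lt_succ_of_le hv) with h' | rfl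
      · exact i3 v h'
      · exact not_lt.1 h

end
end WordRam

/-! ## Counting the pairs of keys in a class -/

namespace WordRam

open Finset

/-- The shift that could make the pair `i, j` collide. -/
noncomputable def mark (E w : ℕ) (X h : ℕ → ℕ) (i j : ℕ) : ℕ :=
  (2 ^ w - low (big w) (X i) (X j) % ck E w + low (big w) (h i) (h j)) % 2 ^ w

/-- The number of pairs in `A` with mark `t` before `(i, k)`, in the order by second components. -/
def seen (A : Finset (ℕ × ℕ)) (mk : ℕ → ℕ → ℕ) (k i t : ℕ) : ℕ :=
  #(A.filter fun p => (p.2 < k ∨ p.2 = k ∧ p.1 < i) ∧ mk p.1 p.2 = t)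

/-- The keys `gs, …, k` agree with key `k` below chunk `c`, the keys `e, …, k` also in chunk `c`. -/
structure Run (E w : ℕ) (X : ℕ → ℕ) (c k gs e : ℕ) : Prop where
  le : gs ≤ e
  le_top : e ≤ k
  iff_le : ∀ i ≤ k, gs ≤ i ↔ c ≤ cls E w (X i) (X k)
  iff_lt : ∀ i ≤ k, e ≤ i ↔ c < cls E w (X i) (X k)

def pairBody (n : ℕ) : Cmd :=
  .seq (.load 52 (arr n 3 (.var 46))) (.ite ⟨false, .var 52, .var 51⟩
    (.seq (.load 53 (arr n 2 (.var 46))) (.seq (.load 54 (arr n 1 (.var 46)))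
      (.seq (lowCmd 53 (.var 53) (.var 50)) (.seq (lowCmd 54 (.var 54) (.var 44))
        (.seq (.assign 55 (.var 53 - (.var 54 &&& .wc 8))) (.ite ⟨true, .var 55, .var 0⟩
          (.seq (.load 56 (arr n 4 (.var 55))) (.store (arr n 4 (.var 55)) (.var 56 + .lit 1)))
          (.assign 56 (.var 56))))))))
    (.assign 56 (.var 56)))

def runCmd (n : ℕ) : Cmd :=
  .seq (.load 44 (arr n 1 (.var 43))) (.seq (clsCmd 45 (.var 42) (.var 44))
    (.seq (.assign 42 (.var 44)) (.ite ⟨true, .var 45, .var 17⟩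
      (.seq (.assign 48 (.var 43)) (.assign 49 (.var 43)))
      (.ite ⟨false, .var 45, .var 17⟩ (.assign 49 (.var 43)) (.assign 49 (.var 49))))))

def pairOuter (n : ℕ) : Cmd :=
  .seq (.seq (runCmd n) (.seq (.load 50 (arr n 2 (.var 43))) (.load 51 (arr n 3 (.var 43)))))
    (.for 46 (.var 48) (.var 49) (pairBody n))

/-- Count the marks of the pairs in class `var 17` in array `4`. -/
def pairCmd (n : ℕ) : Cmd :=
  .seq (.seq (.assign 48 (.lit 0)) (.seq (.assign 49 (.lit 0)) (.load 42 (arr n 1 (.lit 0)))))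
    (.for 43 (.lit 0) (.var 0) (pairOuter n))

theorem seen_succ (A : Finset (ℕ × ℕ)) (mk : ℕ → ℕ → ℕ) (k i t : ℕ) :
    seen A mk k (i + 1) t = seen A mk k i t + if (i, k) ∈ A ∧ mk i k = t then 1 else 0 := by
  simp only [seen, card_filter]
  have : (if (i, k) ∈ A ∧ mk i k = t then 1 else 0)
      = ∑ p ∈ A, if p = (i, k) then (if mk i k = t then 1 else 0) else 0 := by
    rw [sum_ite_eq' A (i, k)]
    by_cases h : (i, k) ∈ A <;> simp [h]
  rw [this, ← sum_add_distrib]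
  refine sum_congr rfl fun p _ => ?_
  by_cases hp : p = (i, k)
  · subst hp
    by_cases h : mk i k = t <;> simp [h]
  · have : (p.2 = k ∧ p.1 < i + 1) ↔ (p.2 = k ∧ p.1 < i) := by
      constructor
      · rintro ⟨h1, h2⟩
        refine ⟨h1, lt_of_le_of_ne (by omega) fun h => hp ?_⟩
        exact Prod.ext h h1
      · rintro ⟨h1, h2⟩; exact ⟨h1, by omega⟩
    simp only [this, hp, if_false, add_zero]

theorem seen_congr {A : Finset (ℕ × ℕ)} {mk : ℕ → ℕ → ℕ} {k i k' i' : ℕ}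
    (h : ∀ p ∈ A, (p.2 < k ∨ p.2 = k ∧ p.1 < i) ↔ (p.2 < k' ∨ p.2 = k' ∧ p.1 < i')) :
    seen A mk k i = seen A mk k' i' := by
  funext t
  simp only [seen]
  congr 1
  refine filter_congr fun p hp => ?_
  rw [h p hp]

section
variable {E w n m : ℕ} {env : RamEnv w}

/-- Passing from key `k - 1` to key `k` replaces each class by its minimum with the adjacent class,
so either boundary stays or moves to `k`. For `k = 0` truncated subtraction makes the adjacent class
`4 * qs E w > c`, and nothing moves. -/
theorem Run.step (h : E + 3 ≤ lgS w) {X : ℕ → ℕ} {c k gs e : ℕ} (hX : ∀ a, X a < 2 ^ w)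
    (hs : ∀ a b, a ≤ b → b ≤ k → RevLe (X a) (X b)) (hc : c < 4 * qs E w)
    (R : Run E w X c (k - 1) gs e) :
    Run E w X c k (if adj E w X k < c then k else gs) (if adj E w X k ≤ c then k else e) := by
  have h3 : ∀ i ≤ k - 1, cls E w (X i) (X k) = min (cls E w (X i) (X (k - 1))) (adj E w X k) :=
    fun i hi => cls_three (hX _) (hX _) (hX _) (hs _ _ hi (by omega)) (hs _ _ (by omega) le_rfl)
  have hk := cls_self h (X k)
  have hle := R.le
  have htop := R.le_top
  have hgs := R.iff_le
  have he := R.iff_lt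
  refine ⟨?_, ?_, fun i hi => ?_, fun i hi => ?_⟩
  · split_ifs <;> omega
  · split_ifs <;> omega
  · by_cases hi' : i ≤ k - 1
    · have h1 := h3 i hi'
      have h2 := hgs i hi'
      by_cases hd : adj E w X k < c
      · rw [if_pos hd, h1]
        constructor
        · intro hk0
          obtain rfl : k = 0 := by omega
          have : adj E w X 0 = 4 * qs E w := cls_self h _
          omega
        · intro h; omega
      · rw [if_neg hd, h1, h2]; omega
    · obtain rfl : i = k := by omega
      rw [hk]
      split_ifs <;> omega
  · by_cases hi' : i ≤ k - 1
    · have h1 := h3 i hi'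
      have h2 := he i hi'
      by_cases hd : adj E w X k ≤ c
      · rw [if_pos hd, h1]
        constructor
        · intro hk0
          obtain rfl : k = 0 := by omega
          have : adj E w X 0 = 4 * qs E w := cls_self h _
          omega
        · intro h; omega
      · rw [if_neg hd, h1, h2]; omega
    · obtain rfl : i = k := by omega
      rw [hk]
      split_ifs <;> omega

/-- Marks that are not below `m` are no admissible exponents and are dropped; the same comparison
keeps the access inside array 4. -/
theorem wp_pairBody (H : Sizes E w n m env.space) (hc : env.const = wordConsts E w) {σ : St}
    {X h g cnt : ℕ → ℕ} {i k : ℕ} (r0 : σ.reg 0 = m) (r46 : σ.reg 46 = i) (r44 : σ.reg 44 = X k)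
    (r50 : σ.reg 50 = h k) (r51 : σ.reg 51 = g k) (hi : i < m) (hX : Arr n m 1 σ.mem X)
    (hh : Arr n m 2 σ.mem h) (hg : Arr n m 3 σ.mem g) (hcnt : Arr n m 4 σ.mem cnt)
    (hXw : ∀ a, X a < 2 ^ w) (hhw : ∀ a, h a < 2 ^ w) (hcw : ∀ t, cnt t + 1 < 2 ^ w) :
    wp env (pairBody n) (fun σ' =>
      Arr n m 4 σ'.mem (fun t => cnt t + if g i = g k ∧ mark E w X h i k = t then 1 else 0) ∧
      ∀ a, (∀ v < m, a ≠ loc n m 4 v) → σ'.mem a = σ.mem a) σ := by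
  have h1 := H.one_lt
  refine wp_load_arr H (by norm_num) r0 r46 hi ?_
  rw [hg i hi]
  set σ1 := σ.set 52 (g i) with hσ1
  have a52 : σ1.reg 52 = g i := by simp [hσ1, St.set_reg]
  have a : ∀ r, r ≠ 52 → σ1.reg r = σ.reg r := fun r hr => by simp [hσ1, St.set_reg, hr]
  have m1 : σ1.mem = σ.mem := rfl
  have hcond : (⟨false, .var 52, .var 51⟩ : Cond).holds env σ1 ↔ g i = g k := by
    rw [Cond.holds, if_neg (by simp), eval_var, eval_var, a52, a 51 (by norm_num), r51]
  refine ⟨fun hgg => ?_, fun hgg => ?_⟩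
  · rw [hcond] at hgg
    refine wp_load_arr H (by norm_num) ((a 0 (by norm_num)).trans r0)
      ((a 46 (by norm_num)).trans r46) hi ?_
    rw [m1, hh i hi]
    refine wp_load_arr H (by norm_num) ?_ (v := i) ?_ hi ?_
    · rw [St.set_reg, if_neg (by norm_num), a 0 (by norm_num), r0]
    · rw [eval_var, St.set_reg, if_neg (by norm_num), a 46 (by norm_num), r46]
    rw [St.set_mem, m1, hX i hi]
    set σ2 := (σ1.set 53 (h i)).set 54 (X i) with hσ2
    refine wp_seq (R := fun s => s = σ2.set 53 (low (big w) (h i) (h k)))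
      (wp_lowCmd H.big hc ?_ ?_ (hhw i) (hhw k) rfl) fun s hs _ => ?_
    · simp [eval_var, hσ2, St.set_reg]
    · simp [eval_var, hσ2, St.set_reg, a, r50]
    subst hs
    refine wp_seq (R := fun s => s = (σ2.set 53 (low (big w) (h i) (h k))).set 54
      (low (big w) (X i) (X k))) (wp_lowCmd H.big hc ?_ ?_ (hXw i) (hXw k) rfl) fun s hs _ => ?_
    · simp [eval_var, hσ2, St.set_reg]
    · simp [eval_var, hσ2, St.set_reg, a, r44]
    have m3 : s.mem = σ.mem := by rw [hs]; rfl
    have b53 : s.reg 53 = low (big w) (h i) (h k) := by simp [hs, St.set_reg]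
    have b54 : s.reg 54 = low (big w) (X i) (X k) := by simp [hs, St.set_reg]
    have b0 : s.reg 0 = m := by simp [hs, hσ2, St.set_reg, a, r0]
    refine wp_seq (R := fun s' => s' = s.set 55 (mark E w X h i k)) ?_ fun s' hs' _ => ?_
    · show s.set 55 _ = _
      congr 1
      rw [eval_sub, eval_and, eval_var, eval_var, b53, b54, eval_wc H.big hc]
      show (2 ^ w - (low (big w) (X i) (X k) &&& (ck E w - 1)) + _) % 2 ^ w = _
      rw [ck, Nat.and_two_pow_sub_one_eq_mod, ← ck, mark]
    have d55 : s'.reg 55 = mark E w X h i k := by rw [hs', St.set_reg, if_pos rfl]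
    have d0 : s'.reg 0 = m := by rw [hs', St.set_reg, if_neg (by norm_num), b0]
    have m4 : s'.mem = σ.mem := by rw [hs', St.set_mem, m3]
    have hcond2 : (⟨true, .var 55, .var 0⟩ : Cond).holds env s' ↔ mark E w X h i k < m := by
      rw [Cond.holds, if_pos rfl, eval_var, eval_var, d55, d0]
    refine ⟨fun hlt => ?_, fun hlt => ?_⟩
    · rw [hcond2] at hlt
      refine wp_load_arr H (by norm_num) d0 d55 hlt ?_
      rw [m4, hcnt _ hlt]
      refine wp_store_arr H (by norm_num) ?_ (v := mark E w X h i k) ?_ hlt ⟨fun v hv => ?_,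
        fun a ha => ?_⟩
      · rw [St.set_reg, if_neg (by norm_num), d0]
      · rw [eval_var, St.set_reg, if_neg (by norm_num), d55]
      · beta_reduce
        rw [St.setMem_mem, eval_add, eval_lit h1, eval_var, St.set_reg, if_pos rfl, St.set_mem, m4,
          Nat.mod_eq_of_lt (hcw _)]
        by_cases hv' : v = mark E w X h i k
        · rw [if_pos (by rw [hv']), if_pos ⟨hgg, hv'.symm⟩, hv']
        · rw [if_neg fun h => hv' ((loc_inj hv hlt).1 h).2, if_neg fun h => hv' h.2.symm, hcnt v hv,
            add_zero]
      · rw [St.setMem_mem, if_neg (ha _ hlt), St.set_mem, m4]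
    · rw [hcond2] at hlt
      refine ⟨fun v hv => ?_, fun a ha => by rw [St.set_mem, m4]⟩
      beta_reduce
      rw [if_neg fun h' : _ ∧ mark E w X h i k = v => hlt (h'.2 ▸ hv), St.set_mem, m4, hcnt v hv, add_zero]
  · rw [hcond] at hgg
    refine ⟨fun v hv => ?_, fun a ha => by rw [St.set_mem, m1]⟩
    beta_reduce
    rw [if_neg fun h => hgg h.1, St.set_mem, m1, hcnt v hv, add_zero]

theorem wp_runCmd (H : Sizes E w n m env.space) (hc : env.const = wordConsts E w) {σ : St}
    {X : ℕ → ℕ} {c k : ℕ} (r0 : σ.reg 0 = m) (r43 : σ.reg 43 = k) (r42 : σ.reg 42 = X (k - 1))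
    (r17 : σ.reg 17 = c) (hk : k < m) (hX : Arr n m 1 σ.mem X) (hXw : ∀ a, X a < 2 ^ w)
    (hs : ∀ a b, a ≤ b → b ≤ k → RevLe (X a) (X b)) (hc4 : c < 4 * qs E w)
    (R : Run E w X c (k - 1) (σ.reg 48) (σ.reg 49)) :
    wp env (runCmd n) (fun σ' => σ'.reg 42 = X k ∧ σ'.reg 44 = X k ∧
      Run E w X c k (σ'.reg 48) (σ'.reg 49)) σ := by
  refine wp_load_arr H (by norm_num) r0 r43 hk ?_
  rw [hX k hk]
  refine wp_seq (R := fun s => s = (σ.set 44 (X k)).set 45 (adj E w X k))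
    (wp_clsCmd H.big hc (x := X (k - 1)) (y := X k) ?_ ?_ (hXw _) (hXw _) rfl) fun s es _ => ?_
  · rw [eval_var, St.set_reg, if_neg (by norm_num), r42]
  · rw [eval_var, St.set_reg, if_pos rfl]
  have R' := R.step H.big hXw hs hc4
  have a44 : s.reg 44 = X k := by simp [es, St.set_reg]
  refine wp_seq (R := fun s' => s' = s.set 42 (X k)) ?_ fun s' hs' _ => ?_
  · show s.set 42 _ = _
    rw [eval_var, a44]
  have b45 : s'.reg 45 = adj E w X k := by simp [hs', es, St.set_reg]
  have b17 : s'.reg 17 = c := by simp [hs', es, St.set_reg, r17]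
  have b43 : s'.reg 43 = k := by simp [hs', es, St.set_reg, r43]
  have b44 : s'.reg 44 = X k := by simp [hs', es, St.set_reg]
  have b42 : s'.reg 42 = X k := by simp [hs', St.set_reg]
  have b48 : s'.reg 48 = σ.reg 48 := by simp [hs', es, St.set_reg]
  have b49 : s'.reg 49 = σ.reg 49 := by simp [hs', es, St.set_reg]
  refine ⟨fun h => ?_, fun h => ?_⟩
  · rw [Cond.holds, if_pos rfl, eval_var, eval_var, b45, b17] at h
    rw [if_pos h, if_pos h.le] at R'
    simp only [wp, St.set_reg, Expr.eval]
    norm_num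
    rw [b43]
    exact ⟨b42, b44, R'⟩
  · rw [Cond.holds, if_pos rfl, eval_var, eval_var, b45, b17] at h
    rw [if_neg h] at R'
    refine ⟨fun h' => ?_, fun h' => ?_⟩
    · rw [Cond.holds, if_neg (by simp), eval_var, eval_var, b45, b17] at h'
      rw [if_pos h'.le] at R'
      simp only [wp, St.set_reg, Expr.eval]
      norm_num
      rw [b43, b48]
      exact ⟨b42, b44, R'⟩
    · rw [Cond.holds, if_neg (by simp), eval_var, eval_var, b45, b17] at h'
      rw [if_neg (by omega)] at R'
      simp only [wp, St.set_reg, Expr.eval]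
      norm_num
      rw [b49, b48]
      exact ⟨b42, b44, R'⟩

/-- The keys that form a pair of class exactly `c` with key `k` are an interval, so the inner loops
enumerate precisely the pairs of this class. Equality under `g` is tested only afterwards, so the
time is bounded by the pairs of all groups, that is, with a constant in place of `g`. -/
theorem pairCmd_spec (H : Sizes E w n m env.space) (hc : env.const = wordConsts E w) {σ : St}
    {X h g : ℕ → ℕ} {c : ℕ} (r0 : σ.reg 0 = m) (r17 : σ.reg 17 = c) (hX : Arr n m 1 σ.mem X)
    (hh : Arr n m 2 σ.mem h) (hg : Arr n m 3 σ.mem g) (hcnt : Arr n m 4 σ.mem fun _ => 0)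
    (hXw : ∀ a, X a < 2 ^ w) (hhw : ∀ a, h a < 2 ^ w)
    (hs : ∀ a b, a ≤ b → b < m → RevLe (X a) (X b)) (hc4 : c < 4 * qs E w) :
    Tr env (pairCmd n) σ (1000 * (m + 1) + 500 *
      #(act m (fun _ => 0) (fun i j => cls E w (X i) (X j)) c (c + 1))) (fun σ' =>
      Arr n m 4 σ'.mem (fun t => #((act m g (fun i j => cls E w (X i) (X j)) c (c + 1)).filter
        fun p => mark E w X h p.1 p.2 = t)) ∧
      ∀ a, (∀ v < m, a ≠ loc n m 4 v) → σ'.mem a = σ.mem a) := by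
  have ha := H.addr_lt
  have hp := H.pos
  have hsq := H.sq_lt
  have hsq' := H.sq_lt_pow
  have hB : (pairBody n).cost ≤ 400 := Nat.le_of_ble_eq_true rfl
  set A := act m g (fun i j => cls E w (X i) (X j)) c (c + 1) with hA
  set A0 := act m (fun _ => 0) (fun i j => cls E w (X i) (X j)) c (c + 1) with hA0
  have hseen : ∀ k i t, seen A (mark E w X h) k i t + 1 < 2 ^ w := fun k i t => by
    have h1 : seen A (mark E w X h) k i t ≤ #(range m ×ˢ range m) :=
      card_le_card fun p hp => by
        have := (mem_filter.1 hp).1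
        exact (mem_filter.1 this).1
    rw [card_product, card_range] at h1
    omega
  have ld : Tr env (.seq (.assign 48 (.lit 0)) (.seq (.assign 49 (.lit 0))
      (.load 42 (arr n 1 (.lit 0))))) σ 20
      (fun s => s.reg 48 = 0 ∧ s.reg 49 = 0 ∧ s.reg 42 = X 0) := by
    refine Tr.of_wp ?_ (Nat.le_of_ble_eq_true rfl)
    rw [wp, wp, wp, wp]
    refine wp_load_arr H (by norm_num) (by simp [St.set_reg, r0]) (eval_lit (by positivity)) hp ?_
    rw [St.set_mem, St.set_mem, hX 0 hp, eval_lit (by positivity), eval_lit (by positivity)]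
    simp [St.set_reg]
  refine (ld.seq (t' := 900 * (m + 1) + 500 * #A0) fun σ1 e1 f1 => ?_).mono (by omega)
    fun _ h => h
  have m1 : σ1.mem = σ.mem := f1.2 rfl
  have g0 : σ1.reg 0 = m := (f1.1 0 rfl).trans r0
  have g17 : σ1.reg 17 = c := (f1.1 17 rfl).trans r17
  have hother : ∀ (μ f : ℕ → ℕ) (j : ℕ), j ≠ 4 → Arr n m j σ.mem f →
      (∀ a, (∀ v < m, a ≠ loc n m 4 v) → μ a = σ.mem a) → Arr n m j μ f := fun μ f j hj hf hμ =>
    hf.congr fun v hv => hμ _ fun u hu h => hj ((loc_inj hv hu).1 h).1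
  refine Tr.mono (Tr.for' (l := 0) (n := m) (fun k s => s.reg 42 = X (k - 1) ∧
      Run E w X c (k - 1) (s.reg 48) (s.reg 49) ∧ Arr n m 4 s.mem (seen A (mark E w X h) k 0) ∧
      ∀ a, (∀ v < m, a ≠ loc n m 4 v) → s.mem a = σ.mem a)
      (fun k => 800 + 420 * #(A0.filter fun p => p.2 = k)) (by omega)
    (by omega) (eval_lit (by omega)) rfl (fun σ' h => by rw [eval_var, h 0 rfl (by norm_num), g0])
    ?_ fun k s _ hk hI hik fr _ => ?_) ?_ fun σ' h => ⟨?_, h.1.2.2.2⟩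
  · have z : seen A (mark E w X h) 0 0 = fun _ => 0 := by
      funext t
      simp [seen]
    refine ⟨?_, ?_, ?_, fun a _ => by rw [St.set_mem, m1]⟩
    · rw [St.set_reg, if_neg (by norm_num), e1.2.2]
    · rw [St.set_reg, if_neg (by norm_num), St.set_reg, if_neg (by norm_num), e1.1, e1.2.1]
      refine ⟨le_rfl, by omega, fun i hi => ?_, fun i hi => ?_⟩ <;>
        · obtain rfl : i = 0 := by omega
          rw [cls_self H.big]; omega
    · rw [z, St.set_mem, m1]; exact hcnt
  · obtain ⟨i1, i2, i3, i4⟩ := hI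
    have q0 : s.reg 0 = m := (fr 0 rfl (by norm_num)).trans g0
    have q17 : s.reg 17 = c := (fr 17 rfl (by norm_num)).trans g17
    have sX := hother s.mem X 1 (by norm_num) hX i4
    have sh := hother s.mem h 2 (by norm_num) hh i4
    have sg := hother s.mem g 3 (by norm_num) hg i4
    have first : Tr env (.seq (runCmd n) (.seq (.load 50 (arr n 2 (.var 43)))
        (.load 51 (arr n 3 (.var 43))))) s 250 (fun s' => (s'.reg 42 = X k ∧ s'.reg 44 = X k ∧
        Run E w X c k (s'.reg 48) (s'.reg 49)) ∧ s'.reg 50 = h k ∧ s'.reg 51 = g k) := by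
      refine Tr.of_wp ?_ (Nat.le_of_ble_eq_true rfl)
      refine wp_seq (wp_runCmd H hc q0 hik i1 q17 hk sX hXw
        (fun a b hab hb => hs a b hab (by omega)) hc4 i2) fun s1 h1 f1 => ?_
      have m2 : s1.mem = s.mem := f1.2 rfl
      have p0 : s1.reg 0 = m := (f1.1 0 rfl).trans q0
      have p43 : s1.reg 43 = k := (f1.1 43 rfl).trans hik
      rw [wp]
      refine wp_load_arr H (by norm_num) p0 p43 hk (wp_load_arr H (by norm_num) ?_ ?_ hk ?_)
      · rw [St.set_reg, if_neg (by norm_num), p0]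
      · rw [eval_var, St.set_reg, if_neg (by norm_num), p43]
      · rw [m2, sh k hk, St.set_mem, m2, sg k hk]
        simpa [St.set_reg] using h1
    refine (first.seq (t' := 420 * (#(A0.filter fun p => p.2 = k) + 1)) fun s1 h1 f1 => ?_).mono
      (by omega) fun _ h => h
    obtain ⟨⟨u42, u44, R⟩, u50, u51⟩ := h1
    have m2 : s1.mem = s.mem := f1.2 rfl
    have p0 : s1.reg 0 = m := (f1.1 0 rfl).trans q0
    set gs := s1.reg 48 with hgs
    set e := s1.reg 49 with he
    have hle := R.le
    have htop := R.le_top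
    have hactive : ∀ i < k, gs ≤ i ∧ i < e ↔ cls E w (X i) (X k) = c := fun i hi => by
      have a1 := R.iff_le i hi.le
      have a2 := R.iff_lt i hi.le
      omega
    have hmem : ∀ i < k, (i, k) ∈ A ↔ gs ≤ i ∧ i < e ∧ g i = g k := fun i hi => by
      rw [hA, mem_act]
      have := hactive i hi
      constructor
      · rintro ⟨-, -, h1, h2, h3⟩
        obtain ⟨h4, h5⟩ := this.2 (by omega)
        exact ⟨h4, h5, h1⟩
      · rintro ⟨h1, h2, h3⟩
        have := this.1 ⟨h1, h2⟩
        exact ⟨hi, hk, h3, by omega, by omega⟩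
    -- Each iteration of the inner loop is charged to its own pair `(i, k)`.
    have hcard : e - gs ≤ #(A0.filter fun p => p.2 = k) := by
      rw [← Nat.card_Ico]
      refine card_le_card_of_injOn (fun i => (i, k)) (fun i hi => ?_)
        (fun i _ j _ h => (Prod.ext_iff.1 h).1)
      have hi := mem_Ico.1 (mem_coe.1 hi)
      rw [mem_coe, mem_filter, hA0, mem_act]
      have := (hactive i (by omega)).1 hi
      exact ⟨⟨by omega, hk, rfl, by omega, by omega⟩, rfl⟩
    refine Tr.mono (Tr.for (l := gs) (n := e) (fun i s' =>
        Arr n m 4 s'.mem (seen A (mark E w X h) k i) ∧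
        ∀ a, (∀ v < m, a ≠ loc n m 4 v) → s'.mem a = σ.mem a) 400 hle (by omega) (eval_var _ _ _) rfl
      (fun s' h => by rw [eval_var, h 49 rfl (by norm_num)]) ⟨?_, fun a ha => by rw [St.set_mem, m2, i4 a ha]⟩
      fun i s' hi1 hi2 hJ hi' fr' _ => ?_).frame ?_ fun s' hs' => ?_
    · rw [St.set_mem, m2, seen_congr (k' := k) (i' := 0)]
      · exact i3
      · rintro ⟨i, j⟩ hij
        dsimp only
        constructor
        · rintro (h | ⟨rfl, h⟩)
          · exact Or.inl h
          · have := (hmem i (by omega)).1 hij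
            omega
        · rintro (h | ⟨rfl, h⟩)
          · exact Or.inl h
          · omega
    · have hik' : i < k := by omega
      refine Tr.of_wp (wp_mono (wp_pairBody H hc (X := X) (h := h) (g := g)
        (cnt := seen A (mark E w X h) k i) ((fr' 0 rfl (by norm_num)).trans p0) hi'
        ((fr' 44 rfl (by norm_num)).trans u44) ((fr' 50 rfl (by norm_num)).trans u50)
        ((fr' 51 rfl (by norm_num)).trans u51) (by omega)
        (hother s'.mem X 1 (by norm_num) hX hJ.2) (hother s'.mem h 2 (by norm_num) hh hJ.2)
        (hother s'.mem g 3 (by norm_num) hg hJ.2) hJ.1 hXw hhw (hseen k i)) fun s'' h'' _ =>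
          ⟨?_, fun a ha => (h''.2 a ha).trans (hJ.2 a ha)⟩) hB
      refine cast (congrArg _ (funext fun t => ?_)) h''.1
      rw [seen_succ]
      congr 1
      have := hmem i hik'
      exact if_congr (and_congr_left fun _ => ⟨fun h => this.2 ⟨hi1, hi2, h⟩,
        fun h => (this.1 h).2.2⟩) rfl rfl
    · simp only [Expr.len]
      have : (e - gs + 1) ≤ #(A0.filter fun p => p.2 = k) + 1 := by omega
      calc _ = 410 * (e - gs + 1) := by ring
        _ ≤ _ := by omega
    · obtain ⟨⟨⟨j1, j2⟩, -⟩, f⟩ := hs'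
      refine ⟨?_, ?_, ?_, fun a ha => by rw [St.set_mem, j2 a ha]⟩
      · rw [St.set_reg, if_neg (by norm_num), f.1 42 rfl, u42]; rfl
      · rw [St.set_reg, if_neg (by norm_num), f.1 48 rfl, St.set_reg, if_neg (by norm_num),
          f.1 49 rfl]
        exact R
      · rw [St.set_mem, seen_congr (k' := k) (i' := e)]
        · exact j1
        · rintro ⟨i, j⟩ hij
          dsimp only
          have hlt := (mem_act.1 hij).1
          constructor
          · rintro (h | ⟨rfl, h⟩)
            · rcases Nat.lt_succ_iff_lt_or_eq.1 h with h' | rfl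
              · exact Or.inl h'
              · exact Or.inr ⟨rfl, ((hmem i hlt).1 hij).2.1⟩
            · omega
          · rintro (h | ⟨rfl, h⟩)
            · exact Or.inl (by omega)
            · exact Or.inl (by omega)
  · simp only [Expr.len]
    have hsum : ∑ k ∈ Ico 0 m, #(A0.filter fun p => p.2 = k) = #A0 := by
      rw [card_eq_sum_card_fiberwise (f := fun p => p.2) (t := Ico 0 m)]
      intro p hp
      have := (mem_act.1 (show (p.1, p.2) ∈ _ from mem_coe.1 hp)).2.1
      exact mem_coe.2 (mem_Ico.2 ⟨Nat.zero_le _, this⟩)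
    rw [sum_add_distrib, sum_add_distrib, ← mul_sum, hsum, sum_const, sum_const, Nat.card_Ico]
    simp only [smul_eq_mul]
    omega
  · refine cast (congrArg _ (funext fun t => ?_)) h.1.2.2.1
    rw [seen]
    congr 1
    refine filter_congr fun p hp => ?_
    have := (mem_act.1 (show (p.1, p.2) ∈ _ from hp)).2.1
    exact ⟨fun h => h.2, fun h => ⟨Or.inl this, h⟩⟩

end
end WordRam

/-! ## Choosing one coefficient -/

namespace WordRam

open Finset

/-- Set the coefficient of chunk `var 17` in the multipliers at `A` to `2 ^ (var 18)`. -/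
def coefCmd (A : ℕ) : Cmd :=
  .seq (.assign 57 (.lit A + ((.var 17 &&& .lit 1) + ((.var 17 >>> .wc 17) <<< .lit 1))))
    (.seq (.load 58 (.var 57)) (.store (.var 57)
      (.var 58 + (.lit 1 <<< (.var 18 + .wc 12 * (.wc 28 - ((.var 17 &&& .wc 16) >>> .lit 1)))))))

def updateBody (n : ℕ) : Cmd :=
  .seq (.load 43 (arr n 2 (.var 41))) (.seq (.load 58 (arr n 1 (.var 41)))
    (.store (arr n 2 (.var 41))
      (.var 43 + (((.var 58 >>> (.wc 14 * .var 17)) &&& .wc 29) <<< .var 18))))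

/-- Add the contributions of chunk `var 17` to the hash values. -/
def updateCmd (n : ℕ) : Cmd := .for 41 (.lit 0) (.var 0) (updateBody n)

section
variable {E w n m : ℕ} {env : RamEnv w}

theorem cpos_eq_iff {p q c : ℕ} (hq : q < qs E w) :
    cpos E w p q = c ↔ p = c % 2 + 2 * (c / (2 * qs E w)) ∧ q = c % (2 * qs E w) / 2 := by
  have hQ := qs_pos (E := E) (w := w)
  unfold cpos
  generalize qs E w = Q at *
  constructor
  · intro h
    have h1 : c / (2 * Q) = p / 2 := by
      rw [← h, Nat.add_mul_div_left _ _ (by omega), Nat.div_eq_of_lt (by omega), zero_add]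
    have h2 : c % (2 * Q) = 2 * q + p % 2 := by
      rw [← h, Nat.add_mul_mod_self_left, Nat.mod_eq_of_lt (by omega)]
    have h3 : c % 2 = p % 2 := by
      rw [← h, mul_assoc, show 2 * q + p % 2 + 2 * (Q * (p / 2))
        = p % 2 + 2 * (q + Q * (p / 2)) by ring, Nat.add_mul_mod_self_left, Nat.mod_mod]
    rw [h1, h2, h3]
    omega
  · rintro ⟨h1, h2⟩
    have h3 := Nat.div_add_mod c (2 * Q)
    have h4 : p % 2 = c % 2 := by omega
    have h5 : p / 2 = c / (2 * Q) := by omega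
    have h6 : c % (2 * Q) % 2 = c % 2 := Nat.mod_mod_of_dvd c (Dvd.intro _ rfl)
    rw [h4, h5, h2]
    omega

theorem pack_update_zero {F k : ℕ} {y : ℕ → ℕ} {j v : ℕ} (hj : j < k) (hy : y j = 0) :
    pack F k (Function.update y j v) = pack F k y + v * 2 ^ (F * j) := by
  have hj' : j ∈ range k := mem_range.2 hj
  rw [pack, pack, ← add_sum_erase _ _ hj', ← add_sum_erase (range k) (fun i => y i * _) hj',
    Function.update_self, hy, zero_mul, zero_add, add_comm]
  congr 1
  exact sum_congr rfl fun c hc => by rw [Function.update_of_ne (ne_of_mem_erase hc)]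

/-- The coefficient was 0, so adding a shifted power of two just sets one digit of one multiplier.
The digit is counted from the top, since multipliers store the coefficients in reverse. -/
theorem wp_coefCmd (H : Sizes E w n m env.space) (hc : env.const = wordConsts E w) {σ : St}
    {co : ℕ → ℕ} {A c t : ℕ} (hA : A + 4 ≤ 3 * n + 8) (r17 : σ.reg 17 = c) (r18 : σ.reg 18 = t)
    (hcQ : c < 4 * qs E w) (ht : t < m) (hM : Multipliers E w A σ.mem co) (h0 : co c = 0)
    (hco : ∀ c, co c ≤ 2 ^ m) :
    wp env (coefCmd A) (fun σ' => Multipliers E w A σ'.mem (Function.update co c (2 ^ t)) ∧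
      ∀ a, (a < A ∨ A + 4 ≤ a) → σ'.mem a = σ.mem a) σ := by
  have h1 := H.one_lt
  have ha := H.addr_lt
  have hsp := H.space
  have hww : w < 2 ^ w := Nat.lt_two_pow_self
  have hm := H.m_lt
  have hmk := H.le_ck
  have hck := H.ck_le
  have hQ := qs_pos (E := E) (w := w)
  have hQs := field_mul_qs H.big
  have hlg := lgN_le (ne_zero_of_lgS H.big)
  have hrt := rt_pos (w := w)
  set p := c % 2 + 2 * (c / (2 * qs E w)) with hp
  set q := c % (2 * qs E w) / 2 with hq
  have hdiv : c / (2 * qs E w) < 2 := Nat.div_lt_of_lt_mul (by omega)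
  have hp4 : p < 4 := by omega
  have hqQ : q < qs E w := by
    have := Nat.mod_lt c (y := 2 * qs E w) (by omega)
    omega
  have e57 : (Expr.lit A + ((.var 17 &&& .lit 1) + ((.var 17 >>> .wc 17) <<< .lit 1))).eval env σ
      = A + p := by
    rw [eval_add, eval_add, eval_shl, eval_shr, eval_and, eval_var, eval_lit h1,
      eval_lit (by omega), r17, eval_wc H.big hc, Nat.and_one_is_mod]
    show (A + (c % 2 + (c >>> (lgN w - lgS w - E)) <<< 1 % 2 ^ w) % 2 ^ w) % 2 ^ w = _
    rw [Nat.shiftRight_eq_div_pow, ← two_mul_qs H.big, Nat.shiftLeft_eq, pow_one, mul_comm _ 2,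
      Nat.mod_eq_of_lt (a := 2 * (c / (2 * qs E w))) (by omega), ← hp,
      Nat.mod_eq_of_lt (a := p) (by omega), Nat.mod_eq_of_lt (by omega)]
  refine wp_seq (R := fun s => s = σ.set 57 (A + p)) (by rw [wp, e57]) fun s hs _ => ?_
  have b57 : (Expr.var 57).eval env s = A + p := by
    rw [eval_var, hs, St.set_reg, if_pos rfl]
  refine wp_seq (R := fun s' => s' = s.set 58 (multiplier E w co p)) ?_ fun s' hs' _ => ?_
  · rw [wp, b57]
    refine ⟨by omega, ?_⟩
    rw [hs, St.set_mem, hM p hp4]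
  have d57 : (Expr.var 57).eval env s' = A + p := by
    rw [eval_var, hs', St.set_reg, if_neg (by norm_num)]; exact b57
  have d17 : s'.reg 17 = c := by simp [hs', hs, St.set_reg, r17]
  have d18 : s'.reg 18 = t := by simp [hs', hs, St.set_reg, r18]
  have d58 : s'.reg 58 = multiplier E w co p := by simp [hs', St.set_reg]
  have dm : s'.mem = σ.mem := by rw [hs', hs]; rfl
  have hF : 2 * ck E w * (qs E w - 1 - q) + 2 * ck E w ≤ w := by
    have : 2 * ck E w * (qs E w - 1 - q + 1) ≤ 2 * ck E w * qs E w :=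
      Nat.mul_le_mul_left _ (by omega)
    rw [mul_add, mul_one] at this
    omega
  have eidx : (Expr.var 18 + .wc 12 * (.wc 28 - ((.var 17 &&& .wc 16) >>> .lit 1))).eval env s'
      = t + 2 * ck E w * (qs E w - 1 - q) := by
    have a1 : (Expr.wc 28 - ((.var 17 &&& .wc 16) >>> .lit 1)).eval env s' = qs E w - 1 - q := by
      rw [eval_sub, eval_shr, eval_and, eval_var, d17, eval_lit h1, eval_wc H.big hc,
        eval_wc H.big hc]
      show (2 ^ w - (c &&& (2 * qs E w - 1)) >>> 1 + (qs E w - 1)) % 2 ^ w = _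
      have : c &&& (2 * qs E w - 1) = c % (2 * qs E w) := by
        rw [two_mul_qs H.big, Nat.and_two_pow_sub_one_eq_mod]
      rw [this, Nat.shiftRight_eq_div_pow, pow_one, ← hq]
      have hQw : qs E w ≤ w := by
        calc qs E w ≤ 2 * ck E w * qs E w := Nat.le_mul_of_pos_left _ (by omega)
          _ ≤ w := by omega
      rw [show 2 ^ w - q + (qs E w - 1) = 2 ^ w + (qs E w - 1 - q) by omega, Nat.add_mod_left,
        Nat.mod_eq_of_lt (by omega)]
    rw [eval_add, eval_mul, a1, eval_var, d18, eval_wc H.big hc]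
    show (t + 2 * ck E w * (qs E w - 1 - q) % 2 ^ w) % 2 ^ w = _
    rw [Nat.mod_eq_of_lt (a := 2 * ck E w * (qs E w - 1 - q)) (by omega),
      Nat.mod_eq_of_lt (by omega)]
  have hle : ∀ c', Function.update co c (2 ^ t) c' ≤ 2 ^ m := fun c' => by
    rw [Function.update_apply]
    split
    · exact Nat.pow_le_pow_right (by norm_num) ht.le
    · exact hco c'
  have hmul : multiplier E w (Function.update co c (2 ^ t)) p
      = multiplier E w co p + 2 ^ t * 2 ^ (2 * ck E w * (qs E w - 1 - q)) := by
    rw [multiplier, multiplier, ← pack_update_zero (by omega)]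
    · refine pack_congr fun i hi => ?_
      rw [Function.update_apply, Function.update_apply]
      refine if_congr ?_ rfl rfl
      rw [cpos_eq_iff (by omega), ← hp, ← hq]
      omega
    · have : cpos E w p (qs E w - 1 - (qs E w - 1 - q)) = c :=
        (cpos_eq_iff (by omega)).2 ⟨hp, by omega⟩
      show co _ = 0
      rw [this, h0]
  have hlt : multiplier E w (Function.update co c (2 ^ t)) p < 2 ^ w := by
    refine (pack_lt fun i _ => lt_of_le_of_lt (hle _) ?_).trans_le
      (Nat.pow_le_pow_right (by norm_num) (hQs.trans_le hlg))
    exact Nat.pow_lt_pow_right (by norm_num) (by omega)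
  rw [wp, d57, eval_add, eval_shl, eidx, eval_var, d58, eval_lit h1, Nat.shiftLeft_eq, one_mul,
    Nat.mod_eq_of_lt (a := 2 ^ _) (Nat.pow_lt_pow_right (by norm_num) (by omega)), pow_add, ← hmul,
    Nat.mod_eq_of_lt hlt]
  refine ⟨by omega, fun p' hp' => ?_, fun a ha' => ?_⟩
  · rw [St.setMem_mem]
    by_cases h : p' = p
    · rw [if_pos (by rw [h]), h]
    · rw [if_neg (by omega), dm, hM p' hp']
      refine pack_congr fun i hi => ?_
      rw [Function.update_of_ne]
      rw [Ne, cpos_eq_iff (by omega)]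
      exact fun h' => h h'.1
  · rw [St.setMem_mem, if_neg (by omega), dm]

theorem updateCmd_spec (H : Sizes E w n m env.space) (hc : env.const = wordConsts E w) {σ : St}
    {X h : ℕ → ℕ} {c t : ℕ} (r0 : σ.reg 0 = m) (r17 : σ.reg 17 = c) (r18 : σ.reg 18 = t)
    (hcQ : c < 4 * qs E w) (hX : Arr n m 1 σ.mem X) (hh : Arr n m 2 σ.mem h)
    (hlt : ∀ i, h i + chunk (ck E w) (X i) c * 2 ^ t < 2 ^ w) :
    Tr env (updateCmd n) σ (100 * (m + 1)) (fun σ' =>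
      Arr n m 2 σ'.mem (fun i => h i + chunk (ck E w) (X i) c * 2 ^ t) ∧
      ∀ a, (∀ v < m, a ≠ loc n m 2 v) → σ'.mem a = σ.mem a) := by
  have ha := H.addr_lt
  have h64 := le_w H.big
  have hww := four_mul_lt_two_pow (n := w) (by omega)
  have hQs := field_mul_qs H.big
  have hlg := lgN_le (ne_zero_of_lgS H.big)
  have hB : (updateBody n).cost ≤ 50 := Nat.le_of_ble_eq_true rfl
  refine Tr.mono (Tr.for (l := 0) (n := m) (fun k s =>
      (∀ v < m, s.mem (loc n m 2 v) = if v < k then h v + chunk (ck E w) (X v) c * 2 ^ t else h v) ∧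
      ∀ a, (∀ v < m, a ≠ loc n m 2 v) → s.mem a = σ.mem a) 50 (by omega)
    (by omega) (eval_lit (by omega)) rfl (fun σ' h => by rw [eval_var, h 0 rfl (by norm_num), r0])
    ⟨fun v hv => by rw [if_neg (by omega)]; exact hh v hv, fun _ _ => rfl⟩
    fun k s _ hk hI hi fr _ => Tr.of_wp ?_ hB) (by simp only [Expr.len]; omega)
    fun σ' h => ⟨fun v hv => by rw [h.1.1 v hv, if_pos hv], h.1.2⟩
  have q0 : s.reg 0 = m := (fr 0 rfl (by norm_num)).trans r0
  have q17 : s.reg 17 = c := (fr 17 rfl (by norm_num)).trans r17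
  have q18 : s.reg 18 = t := (fr 18 rfl (by norm_num)).trans r18
  have sX : s.mem (loc n m 1 k) = X k := by
    rw [hI.2 _ fun u hu h => by simpa using ((loc_inj hk hu).1 h).1, hX k hk]
  refine wp_load_arr H (by norm_num) q0 hi hk ?_
  rw [hI.1 k hk, if_neg (lt_irrefl k)]
  refine wp_load_arr H (by norm_num) (by simp [St.set_reg, q0]) (v := k)
    (by simp [eval_var, St.set_reg, hi]) hk ?_
  rw [St.set_mem, sX]
  set s2 := (s.set 43 (h k)).set 58 (X k) with hs2
  have ev : (Expr.var 43 + (((.var 58 >>> (.wc 14 * .var 17)) &&& .wc 29) <<< .var 18)).eval env s2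
      = h k + chunk (ck E w) (X k) c * 2 ^ t := by
    have e43 : s2.reg 43 = h k := by simp [hs2, St.set_reg]
    have e58 : s2.reg 58 = X k := by simp [hs2, St.set_reg]
    have e17 : s2.reg 17 = c := by simp [hs2, St.set_reg, q17]
    have e18 : s2.reg 18 = t := by simp [hs2, St.set_reg, q18]
    rw [eval_add, eval_shl, eval_and, eval_shr, eval_mul, eval_var, eval_var, eval_var, eval_var,
      e43, e58, e17, e18, eval_wc H.big hc, eval_wc H.big hc]
    show (h k + ((X k >>> (ck E w * c % 2 ^ w) &&& (2 ^ ck E w - 1)) <<< t) % 2 ^ w) % 2 ^ w = _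
    have : ck E w * c < 2 ^ w := by
      have a1 : ck E w * c ≤ ck E w * (4 * qs E w) := Nat.mul_le_mul_left _ hcQ.le
      have a2 : ck E w * (4 * qs E w) = 2 * (2 * ck E w * qs E w) := by ring
      omega
    have hl := hlt k
    rw [Nat.mod_eq_of_lt this, Nat.and_two_pow_sub_one_eq_mod, Nat.shiftRight_eq_div_pow,
      Nat.shiftLeft_eq, ← chunk, Nat.mod_eq_of_lt (a := chunk _ _ _ * _) (by omega),
      Nat.mod_eq_of_lt hl]
  refine wp_store_arr H (by norm_num) (by simp [hs2, St.set_reg, q0]) (v := k)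
    (by simp [hs2, eval_var, St.set_reg, hi]) hk ⟨fun v hv => ?_, fun a ha => ?_⟩
  · rw [St.set_mem, St.setMem_mem, ev]
    by_cases hvk : v = k
    · rw [if_pos (by rw [hvk]), if_pos (by omega), hvk]
    · rw [if_neg fun h => hvk ((loc_inj hv hk).1 h).2]
      have := hI.1 v hv
      show s.mem _ = _
      rw [this]
      by_cases h : v < k
      · rw [if_pos h, if_pos (by omega)]
      · rw [if_neg h, if_neg (by omega)]
  · rw [St.set_mem, St.setMem_mem, if_neg (ha k hk)]
    exact hI.2 a ha

end
end WordRam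

/-! ## Choosing all coefficients -/

namespace WordRam

open Finset

def passBody (n A : ℕ) : Cmd :=
  .seq (bestCmd n) (.seq (clearCmd n 4) (.seq (pairCmd n) (.seq (argminCmd n)
    (.seq (coefCmd A) (.seq (updateCmd n) (.assign 16 (.var 17)))))))

/-- Choose the coefficients of a linear combination of the chunks, with few collisions among the
keys with the same value in array `3`. -/
def passCmd (n A : ℕ) : Cmd :=
  .seq (clearCmd n 2) (.seq (.assign 16 (.wc 15)) (.loop ⟨true, .lit 0, .var 16⟩ (passBody n A)))

/-- A bound on the number of iterations. -/
noncomputable def pot (E w m : ℕ) (X : ℕ → ℕ) (cur : ℕ) : ℕ :=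
  #((range m).filter fun l => adj E w X l < cur) + if 0 < cur then 1 else 0

/-- The rounds of a pass treat disjoint sets of pairs, so their numbers of pairs add up to at most
the number of all pairs. -/
theorem act_add {m : ℕ} {g : ℕ → ℕ} {c : ℕ → ℕ → ℕ} {b cur : ℕ} (hb : b < cur) :
    #(act m g c 0 b) + #(act m g c b (b + 1)) ≤ #(act m g c 0 cur) := by
  rw [← card_union_of_disjoint]
  · refine card_le_card ?_
    rintro ⟨i, j⟩ h
    rw [mem_union, mem_act, mem_act] at h
    rw [mem_act]
    rcases h with ⟨h1, h2, h3, h4, h5⟩ | ⟨h1, h2, h3, h4, h5⟩ <;>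
      exact ⟨h1, h2, h3, by omega, by omega⟩
  · rw [Finset.disjoint_left]
    rintro ⟨i, j⟩ h1 h2
    rw [mem_act] at h1 h2
    omega

section
variable {E w n m : ℕ} {env : RamEnv w}

/-- A round uses up an adjacent class, or it reaches chunk 0 and gives up the extra unit. -/
theorem pot_lt {X : ℕ → ℕ} {b cur : ℕ} (hb : b < cur)
    (h : b = 0 ∨ ∃ l < m, adj E w X l = b ∧ adj E w X l < cur) :
    pot E w m X b + 1 ≤ pot E w m X cur := by
  unfold pot
  rw [if_pos (by omega : 0 < cur)]
  by_cases h0 : b = 0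
  · subst h0
    simp
  · rw [if_pos (by omega)]
    obtain ⟨l, hl, h1, h2⟩ := h.resolve_left h0
    have : #((range m).filter fun l => adj E w X l < b) <
        #((range m).filter fun l => adj E w X l < cur) := by
      refine card_lt_card ⟨fun x hx => ?_, fun hsub => ?_⟩
      · rw [mem_filter] at hx ⊢
        exact ⟨hx.1, by omega⟩
      · have := hsub (mem_filter.2 ⟨mem_range.2 hl, h2⟩)
        rw [mem_filter] at this
        omega
    omega

/-- The class of a pair is a minimum of adjacent classes and is therefore attained. So skipping from
one adjacent class to the next misses no pair. -/
theorem exists_adj_eq_cls {X : ℕ → ℕ} (hX : ∀ a, X a < 2 ^ w)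
    (hs : ∀ a b, a ≤ b → b < m → RevLe (X a) (X b)) {i j : ℕ} (hij : i < j) (hj : j < m) :
    ∃ l < m, adj E w X l = cls E w (X i) (X j) := by
  induction j, hij using Nat.le_induction with
  | base => exact ⟨i + 1, hj, rfl⟩
  | succ j hij ih =>
    have h3 : cls E w (X i) (X (j + 1)) = min (cls E w (X i) (X j)) (adj E w X (j + 1)) :=
      cls_three (hX _) (hX _) (hX _) (hs _ _ (by omega) (by omega)) (hs _ _ (by omega) hj)
    rw [h3]
    rcases min_choice (cls E w (X i) (X j)) (adj E w X (j + 1)) with h | h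
    · rw [h]; exact ih (by omega)
    · rw [h]; exact ⟨j + 1, hj, rfl⟩

theorem hsum_lt_two_pow (H : Sizes E w n m env.space) {co : ℕ → ℕ} (hco : ∀ c, co c ≤ 2 ^ m)
    (x : ℕ) : hsum E w co x < 2 ^ w :=
  (hsum_lt (sum_co_le H.big H.le_ck hco) x).trans_le
    (Nat.pow_le_pow_right (by norm_num) (by have := H.ck_le; omega))

/-- Pairs of class at least `cur` agree in chunk `b`, so the new term adds the same to both values.
A collision of a pair of class `b` forces the old values to differ first at the offset of the keys'
lowest difference in the chunk plus `t`; the mark subtracts this offset and thus equals `t`. -/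
theorem bad_update (H : Sizes E w n m env.space) {X g co : ℕ → ℕ} {b cur t : ℕ}
    (hX : ∀ a, X a < 2 ^ w) (hb : b < cur) (hcur : cur ≤ 4 * qs E w) (h0 : co b = 0) (ht : t < m)
    (hc : ∀ i j, i < j → j < m → cls E w (X i) (X j) < cur → cls E w (X i) (X j) ≤ b)
    (hmin : ∀ t' < m, #((act m g (fun i j => cls E w (X i) (X j)) b (b + 1)).filter fun p =>
        mark E w X (fun i => hsum E w co (X i)) p.1 p.2 = t)
      ≤ #((act m g (fun i j => cls E w (X i) (X j)) b (b + 1)).filter fun p =>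
        mark E w X (fun i => hsum E w co (X i)) p.1 p.2 = t'))
    (hI : m * #(bad m g (fun i => hsum E w co (X i)) (fun i j => cls E w (X i) (X j)) cur
        (4 * qs E w)) ≤ #(act m g (fun i j => cls E w (X i) (X j)) cur (4 * qs E w))) :
    m * #(bad m g (fun i => hsum E w (Function.update co b (2 ^ t)) (X i))
        (fun i j => cls E w (X i) (X j)) b (4 * qs E w)) ≤
      #(act m g (fun i j => cls E w (X i) (X j)) b (4 * qs E w)) := by
  have hb4 : b < 4 * qs E w := by omega
  refine bad_step hb hcur hc (fun i j hij hj hle heq => ?_) (fun i j hij hj hcb heq => ?_) hmin hI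
  · simp only [hsum_update hb4 h0] at heq
    by_cases hne : X i = X j
    · simp only [hne]
    · rw [chunk_eq_of_lt_cls (hb.trans_le hle) hne] at heq
      exact Nat.add_right_cancel heq
  · simp only [hsum_update hb4 h0] at heq
    have hne : X i ≠ X j := (cls_lt_iff H.big (hX i) (hX j)).1 (by omega)
    obtain ⟨h1, h2⟩ := low_chunk (B := big w) hcb hne
    obtain ⟨h3, h4⟩ := low_of_collision (B := big w) h1 heq
    rw [h2] at h4
    simp only [mark]
    rw [h4]
    have hd := Nat.mod_lt (low (big w) (X i) (X j)) (ck_pos (E := E) (w := w))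
    have hck := H.ck_le
    have hm := H.m_lt
    have hww : w < 2 ^ w := Nat.lt_two_pow_self
    rw [show ∀ a d : ℕ, d ≤ a → a - d + (d + t) = a + t from fun a d h => by omega,
      Nat.add_mod_left, Nat.mod_eq_of_lt (by omega)]
    omega

/-- Between rounds the coefficients below `cur` are 0, array 2 has the values of the current
combination, and among the pairs of class at least `cur` that `g` does not separate, at most one
m-th collide. -/
theorem passCmd_spec (H : Sizes E w n m env.space) (hc : env.const = wordConsts E w) {σ : St}
    {X g : ℕ → ℕ} {A : ℕ} (hA : A + 4 ≤ 3 * n + 8) (r0 : σ.reg 0 = m) (hX : Arr n m 1 σ.mem X)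
    (hg : Arr n m 3 σ.mem g) (hXw : ∀ a, X a < 2 ^ w)
    (hs : ∀ a b, a ≤ b → b < m → RevLe (X a) (X b)) (hz : ∀ p < 4, σ.mem (A + p) = 0) :
    Tr env (passCmd n A) σ (3000 * ((m + 1) * (m + 1))) (fun σ' => ∃ co : ℕ → ℕ,
      Multipliers E w A σ'.mem co ∧ (∀ c, co c ≤ 2 ^ m) ∧
      Arr n m 2 σ'.mem (fun i => hsum E w co (X i)) ∧
      m * #(bad m g (fun i => hsum E w co (X i)) (fun i j => cls E w (X i) (X j)) 0 (4 * qs E w))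
        ≤ #(act m g (fun i j => cls E w (X i) (X j)) 0 (4 * qs E w)) ∧
      ∀ a, (a < A ∨ A + 4 ≤ a) → (∀ v < m, a ≠ loc n m 2 v ∧ a ≠ loc n m 4 v) →
        σ'.mem a = σ.mem a) := by
  have ha := H.addr_lt
  have hM : m + 1 ≤ (m + 1) * (m + 1) := Nat.le_mul_of_pos_left _ (by omega)
  have hmm : m * m ≤ (m + 1) * (m + 1) := Nat.mul_le_mul (by omega) (by omega)
  have hBc : (coefCmd A).cost ≤ 60 := Nat.le_of_ble_eq_true rfl
  set c := fun i j => cls E w (X i) (X j) with hcdef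
  refine Tr.mono ((clearCmd_spec H (j := 2) (by norm_num) r0).seq
    (t' := 2900 * ((m + 1) * (m + 1))) fun σ1 e1 f1 => ?_) ?_ fun _ h => h
  swap
  · omega
  have g0 : σ1.reg 0 = m := (f1.1 0 rfl).trans r0
  have h2 : Tr env (.assign 16 (.wc 15)) σ1 2 (fun s => s.reg 16 = 4 * qs E w) := by
    refine Tr.of_wp ?_ le_rfl
    rw [wp, St.set_reg, if_pos rfl, eval_wc H.big hc]
    rfl
  refine Tr.mono (h2.seq (t' := 2850 * ((m + 1) * (m + 1))) fun σ2 e2 f2 => ?_) ?_ fun _ h => h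
  swap
  · omega
  have m2 : σ2.mem = σ1.mem := f2.2 rfl
  have p0 : σ2.reg 0 = m := (f2.1 0 rfl).trans g0
  -- The remaining time: each round still possible is charged for its O(m) fixed work, and each pair
  -- whose class is still to come for being counted.
  set φ : ℕ → ℕ := fun cur => 1700 * (m + 1) * pot E w m X cur + 500 * #(act m (fun _ => 0) c 0 cur)
    with hφ
  refine Tr.mono (Tr.loop (φ := φ (4 * qs E w)) (I := fun f s => ∃ cur co, f = φ cur ∧
      s.reg 16 = cur ∧ cur ≤ 4 * qs E w ∧ s.reg 0 = m ∧ Multipliers E w A s.mem co ∧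
      (∀ c, co c ≤ 2 ^ m) ∧ (∀ c < cur, co c = 0) ∧ Arr n m 2 s.mem (fun i => hsum E w co (X i)) ∧
      m * #(bad m g (fun i => hsum E w co (X i)) c cur (4 * qs E w))
        ≤ #(act m g c cur (4 * qs E w)) ∧
      ∀ a, (a < A ∨ A + 4 ≤ a) → (∀ v < m, a ≠ loc n m 2 v ∧ a ≠ loc n m 4 v) →
        s.mem a = σ.mem a) (fun f s hI hcond => ?_) ?_) ?_ fun s hs' => ?_
  · obtain ⟨cur, co, rfl, i1, i2, i3, i4, i5, i6, i7, i8, i9⟩ := hI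
    have hcur : 0 < cur := by
      simpa [Cond.holds, eval_lit (show 0 < 2 ^ w by positivity), eval_var, i1] using hcond
    have lX : ∀ μ : ℕ → ℕ, (∀ a, (a < A ∨ A + 4 ≤ a) →
        (∀ v < m, a ≠ loc n m 2 v ∧ a ≠ loc n m 4 v) → μ a = σ.mem a) →
        Arr n m 1 μ X ∧ Arr n m 3 μ g := fun μ hμ => by
      refine ⟨hX.congr fun v hv => hμ _ (Or.inr ?_) fun u hu => ⟨fun h => ?_, fun h => ?_⟩,
        hg.congr fun v hv => hμ _ (Or.inr ?_) fun u hu => ⟨fun h => ?_, fun h => ?_⟩⟩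
      all_goals first
        | exact hA.trans (le_loc _ _)
        | exact absurd ((loc_inj hv hu).1 h).1 (by norm_num)
    have hs0 := lX s.mem i9
    obtain ⟨n0, hn0, s1, ev, hb, hb1, hb2⟩ := bestCmd_spec H hc i3 i1 hs0.1 hXw hcur
    set b := s1.reg 17 with hbdef
    have hb4 : b < 4 * qs E w := by omega
    have hco0 : co b = 0 := i6 b hb
    have mem1 : s1.mem = s.mem := ev.frame.2 rfl
    have q0 : s1.reg 0 = m := (ev.frame.1 0 rfl).trans i3
    have hlow : ∀ (μ μ' : ℕ → ℕ) (j : ℕ), (∀ a, (∀ v < m, a ≠ loc n m j v) → μ' a = μ a) →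
        (∀ p < 4, μ' (A + p) = μ (A + p)) ∧ ∀ j' f, j' ≠ j → Arr n m j' μ f → Arr n m j' μ' f :=
      fun μ μ' j h => ⟨fun p hp => h _ fun v hv h' => by
          have := le_loc (n := n) (m := m) j v; omega,
        fun j' f hj hf => hf.congr fun v hv => h _ fun u hu h' => hj ((loc_inj hv hu).1 h').1⟩
    refine ⟨300 * (m + 1) + (40 * (m + 1) + ((1000 * (m + 1) +
      500 * #(act m (fun _ => 0) c b (b + 1))) + (100 * (m + 1) + (60 + (100 * (m + 1) + 2))))),
      Tr.seq (R := fun s' => s' = s1) ⟨n0, hn0, s1, ev, rfl⟩ fun s' hs' _ => ?_⟩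
    subst hs'
    refine (clearCmd_spec H (j := 4) (by norm_num) q0).seq fun s2 h2 f2 => ?_
    have k2 := hlow _ _ _ h2.2
    have q2 : s2.reg 0 = m := (f2.1 0 rfl).trans q0
    have b2 : s2.reg 17 = b := f2.1 17 rfl
    have X2 := k2.2 1 X (by norm_num) (by rw [mem1]; exact hs0.1)
    have g2 := k2.2 3 g (by norm_num) (by rw [mem1]; exact hs0.2)
    have h2' := k2.2 2 _ (by norm_num) (by rw [mem1]; exact i7)
    refine (pairCmd_spec H hc q2 b2 X2 h2' g2 h2.1 hXw (fun i => hsum_lt_two_pow H i5 _) hs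
      hb4).seq fun s3 h3 f3 => ?_
    have k3 := hlow _ _ _ h3.2
    have q3 : s3.reg 0 = m := (f3.1 0 rfl).trans q2
    have b3 : s3.reg 17 = b := (f3.1 17 rfl).trans b2
    refine (argminCmd_spec H q3 h3.1).seq fun s4 h4 f4 => ?_
    have m4 : s4.mem = s3.mem := f4.2 rfl
    have q4 : s4.reg 0 = m := (f4.1 0 rfl).trans q3
    have b4 : s4.reg 17 = b := (f4.1 17 rfl).trans b3
    obtain ⟨htm, hmin⟩ := h4
    set t := s4.reg 18 with ht
    refine (Tr.of_wp (wp_coefCmd H hc hA b4 ht.symm hb4 htm (co := co) (fun p hp => ?_) hco0 i5)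
      hBc).seq fun s5 h5 f5 => ?_
    · rw [m4, k3.1 p hp, k2.1 p hp, mem1, i4 p hp]
    have q5 : s5.reg 0 = m := (f5.1 0 rfl).trans q4
    have b5 : s5.reg 17 = b := (f5.1 17 rfl).trans b4
    have t5 : s5.reg 18 = t := f5.1 18 rfl
    have hup : ∀ j f, Arr n m j s4.mem f → Arr n m j s5.mem f := fun j f hf => hf.congr fun v hv =>
      h5.2 _ (Or.inr (hA.trans (le_loc _ _)))
    have hco' : ∀ c', Function.update co b (2 ^ t) c' ≤ 2 ^ m := fun c' => by
      rw [Function.update_apply]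
      split
      · exact Nat.pow_le_pow_right (by norm_num) htm.le
      · exact i5 c'
    refine (updateCmd_spec H hc q5 b5 t5 hb4 (hup 1 X (by rw [m4]; exact k3.2 1 X (by norm_num) X2))
      (hup 2 _ (by rw [m4]; exact k3.2 2 _ (by norm_num) h2')) fun i => ?_).seq fun s6 h6 f6 => ?_
    · rw [← hsum_update hb4 hco0]; exact hsum_lt_two_pow H hco' _
    have q6 : s6.reg 0 = m := (f6.1 0 rfl).trans q5
    have b6 : s6.reg 17 = b := (f6.1 17 rfl).trans b5
    have k6 := hlow _ _ _ h6.2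
    refine Tr.of_wp ?_ le_rfl
    refine ⟨φ b, ⟨b, Function.update co b (2 ^ t), rfl, ?_, hb4.le, ?_, fun p hp => ?_, hco',
      fun c' hc' => ?_, fun v hv => ?_, ?_, fun a ha1 ha2 => ?_⟩, ?_⟩
    · rw [St.set_reg, if_pos rfl, eval_var, b6]
    · rw [St.set_reg, if_neg (by norm_num), q6]
    · rw [St.set_mem, k6.1 p hp, h5.1 p hp]
    · rw [Function.update_of_ne (by omega), i6 c' (by omega)]
    · rw [St.set_mem, h6.1 v hv]
      exact (hsum_update hb4 hco0 _).symm
    · refine bad_update H hXw hb i2 hco0 htm (fun i j hij hj hlt => ?_) hmin i8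
      obtain ⟨l, hl, hl'⟩ := exists_adj_eq_cls hXw hs hij hj
      rw [← hl'] at hlt ⊢
      exact hb1 l hl hlt
    · rw [St.set_mem, h6.2 a fun v hv => (ha2 v hv).1, h5.2 a ha1, m4,
        h3.2 a fun v hv => (ha2 v hv).2, h2.2 a fun v hv => (ha2 v hv).2, mem1, i9 a ha1 ha2]
    · have u1 := pot_lt hb hb2
      have u2 := act_add (m := m) (g := fun _ => 0) (c := c) hb
      have u3 := Nat.mul_le_mul_left (1700 * (m + 1)) u1
      rw [mul_add, mul_one] at u3
      simp only [hφ, Cond.len, Expr.len]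
      generalize pot E w m X b = pb at *
      generalize pot E w m X cur = pc at *
      generalize #(act m (fun _ => 0) c b (b + 1)) = y1 at *
      generalize #(act m (fun _ => 0) c 0 b) = y2 at *
      generalize #(act m (fun _ => 0) c 0 cur) = y3 at *
      generalize 1700 * (m + 1) * pb = z1 at *
      generalize 1700 * (m + 1) * pc = z2 at *
      omega
  · refine ⟨4 * qs E w, fun _ => 0, rfl, e2, le_rfl, p0, fun p hp => ?_, fun _ => Nat.zero_le _,
      fun _ _ => rfl, fun v hv => ?_, ?_, fun a _ h => ?_⟩
    · rw [m2, e1.2 _ fun v hv h => by have := le_loc (n := n) (m := m) 2 v; omega, hz p hp]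
      simp [multiplier, pack]
    · rw [m2, e1.1 v hv]
      simp [hsum]
    -- At the start no class is in range, so there are no pairs to consider.
    · have : bad m g (fun i => hsum E w (fun _ => 0) (X i)) c (4 * qs E w) (4 * qs E w) = ∅ := by
        refine eq_empty_of_forall_notMem ?_
        rintro ⟨i, j⟩ h
        have := mem_act.1 (mem_filter.1 h).1
        omega
      rw [this, card_empty, mul_zero]
      exact Nat.zero_le _
    · rw [m2, e1.2 a fun v hv => (h v hv).1]
  · have h1 : pot E w m X (4 * qs E w) ≤ m + 1 := by
      unfold pot
      have := card_filter_le (range m) fun l => adj E w X l < 4 * qs E w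
      rw [card_range] at this
      split <;> omega
    have h2 : #(act m (fun _ => 0) c 0 (4 * qs E w)) ≤ m * m := by
      refine (card_filter_le _ _).trans ?_
      rw [card_product, card_range]
    have h3 := Nat.mul_le_mul_left (1700 * (m + 1)) h1
    rw [mul_assoc 1700 (m + 1) (m + 1)] at h3
    simp only [hφ, Cond.len, Expr.len]
    omega
  · obtain ⟨⟨f, cur, co, -, i1, i2, i3, i4, i5, i6, i7, i8, i9⟩, hcond⟩ := hs'
    have hcur : cur = 0 := by
      simpa [Cond.holds, eval_lit (show 0 < 2 ^ w by positivity), eval_var, i1] using hcond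
    subst hcur
    exact ⟨co, i4, i5, i7, i8, i9⟩

end
end WordRam

/-! ## The preprocessing -/

namespace WordRam

open Finset

/-- Copy array `2` to array `3`. -/
def copyCmd (n : ℕ) : Cmd :=
  .for 41 (.lit 0) (.var 0) (.seq (.load 43 (arr n 2 (.var 41))) (.store (arr n 3 (.var 41)) (.var 43)))

def packHashBody (n : ℕ) : Cmd :=
  .seq (.load 24 (arr n 0 (.var 32))) (.seq (hashCmd (3 * n)) (.seq (.assign 33 (.var 25))
    (packOr (2 * n))))

def packHashCmd (n : ℕ) : Cmd := .for 32 (.lit 0) (.var 0) (packHashBody n)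

def prepCmd (n : ℕ) : Cmd :=
  .seq (initCmd n) (.seq (readCmd n) (.seq (warshallCmd n) (.seq (packCloseCmd n)
    (.seq (sortCmd n) (.seq (passCmd n (3 * n)) (.seq (copyCmd n)
      (.seq (passCmd n (3 * n + 4)) (packHashCmd n))))))))

section
variable {E w n m : ℕ} {env : RamEnv w}

theorem copyCmd_spec (H : Sizes E w n m env.space) {σ : St} {h : ℕ → ℕ} (r0 : σ.reg 0 = m)
    (hh : Arr n m 2 σ.mem h) : Tr env (copyCmd n) σ (50 * (m + 1)) (fun σ' =>
      Arr n m 3 σ'.mem h ∧ ∀ a, (∀ v < m, a ≠ loc n m 3 v) → σ'.mem a = σ.mem a) := by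
  have ha := H.addr_lt
  refine Tr.mono (Tr.for (l := 0) (n := m) (fun k s => (∀ v < k, s.mem (loc n m 3 v) = h v) ∧
      ∀ a, (∀ v < m, a ≠ loc n m 3 v) → s.mem a = σ.mem a) 30 (by omega)
    (by omega) (eval_lit (by omega)) rfl (fun σ' h => by rw [eval_var, h 0 rfl (by norm_num), r0])
    ⟨fun _ h => by omega, fun _ _ => rfl⟩ fun k s _ hk hI hi fr _ => Tr.of_wp ?_
      (Nat.le_of_ble_eq_true rfl)) (by simp only [Expr.len]; omega) fun σ' h => h.1
  have q0 := (fr 0 rfl (by norm_num)).trans r0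
  refine wp_load_arr H (by norm_num) q0 hi hk ?_
  rw [hI.2 _ fun u hu h => by simpa using ((loc_inj hk hu).1 h).1, hh k hk]
  refine wp_store_arr H (by norm_num) (by simp [St.set_reg, q0]) (v := k)
    (by simp [eval_var, St.set_reg, hi]) hk ⟨fun v hv => ?_, fun a ha => ?_⟩
  · rw [St.set_mem, St.setMem_mem, eval_var, St.set_reg, if_pos rfl]
    by_cases hvk : v = k
    · rw [if_pos (by rw [hvk]), hvk]
    · rw [if_neg fun h => hvk ((loc_inj (by omega) hk).1 h).2]
      exact hI.1 v (by omega)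
  · rw [St.set_mem, St.setMem_mem, if_neg (ha k hk)]
    exact hI.2 a ha

theorem packHashCmd_spec (H : Sizes E w n m env.space) (hc : env.const = wordConsts E w) {σ : St}
    {label co co' : ℕ → ℕ} (r0 : σ.reg 0 = m) (hl : Arr n m 0 σ.mem label)
    (hco : ∀ c, co c ≤ 2 ^ m) (hco' : ∀ c, co' c ≤ 2 ^ m)
    (hM : Multipliers E w (3 * n) σ.mem co) (hM' : Multipliers E w (3 * n + 4) σ.mem co')
    (hz : ∀ a, 2 * n ≤ a → a < 3 * n → σ.mem a = 0) :
    Tr env (packHashCmd n) σ (500 * (m + 1)) (fun σ' =>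
      Packed E w n (2 * n) σ'.mem (fun q => if q < m then hash E w co co' (label q) else 0) ∧
      ∀ a, (a < 2 * n ∨ 3 * n ≤ a) → σ'.mem a = σ.mem a) := by
  have ha := H.addr_lt
  have hsp := H.space
  have hp := H.pos
  have sco := sum_co_le H.big H.le_ck hco
  have sco' := sum_co_le H.big H.le_ck hco'
  have hB : (packHashBody n).cost ≤ 480 := Nat.le_of_ble_eq_true rfl
  have hloc : ∀ v, 3 * n ≤ loc n m 0 v := fun v => by
    have := le_loc (n := n) (m := m) 0 v; omega
  refine Tr.mono (Tr.for (l := 0) (n := m) (fun k s =>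
      Packed E w n (2 * n) s.mem (fun q => if q < k then hash E w co co' (label q) else 0) ∧
      ∀ a, (a < 2 * n ∨ 3 * n ≤ a) → s.mem a = σ.mem a) 480 (by omega) (by omega)
    (eval_lit (by omega)) rfl (fun s h => by rw [eval_var, h 0 rfl (by norm_num), r0])
    ⟨?_, fun _ _ => rfl⟩ fun k s _ hk hI hi fr _ => Tr.of_wp ?_ hB)
    (by simp only [Expr.len]; omega) fun σ' h => h.1
  · simp only [Nat.not_lt_zero, if_false]
    exact packed_zero fun a h1 h2 => hz a h1 (by omega)
  · refine wp_seq (R := fun s' => s'.reg 24 = label k) ?_ fun s1 e1 f1 => ?_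
    · refine wp_load_arr H (by norm_num) ((fr 0 rfl (by norm_num)).trans r0) hi hk ?_
      rw [St.set_reg, if_pos rfl, hI.2 _ (Or.inr (hloc k)), hl k hk]
    have m1 : s1.mem = s.mem := f1.2 rfl
    refine wp_seq (wp_hashCmd H.big hc sco sco' (by omega) (by omega)
      (fun p hp => by rw [m1, hI.2 _ (Or.inr (by omega)), hM p hp])
      (fun p hp => by rw [m1, hI.2 _ (Or.inr (by omega)), hM' p hp]) e1) fun s2 e2 f2 => ?_
    refine wp_seq (R := fun s' => s'.reg 33 = hash E w co co' (label k)) ?_ fun s3 e3 f3 => ?_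
    · show (s2.set 33 _).reg 33 = _
      rw [St.set_reg, if_pos rfl, eval_var, e2]
    have m3 : s3.mem = s.mem := ((f3.2 rfl).trans (f2.2 rfl)).trans m1
    have r32 : s3.reg 32 = k :=
      ((f3.1 32 rfl).trans (f2.1 32 rfl)).trans ((f1.1 32 rfl).trans hi)
    refine wp_mono (wp_packOr H hc (base := 2 * n) le_rfl
      (y := fun q => if q < k then hash E w co co' (label q) else 0) (by rw [m3]; exact hI.1)
      (fun q => ?_) r32 hk e3 (hash_lt sco sco' _)) fun s4 h4 _ => ⟨?_, fun a ha => ?_⟩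
    · split
      · exact hash_lt sco sco' _
      · positivity
    · refine cast (congrArg _ (funext fun q => ?_)) h4.1
      by_cases hq : q = k
      · subst hq; simp
      · rw [Function.update_of_ne hq]
        by_cases h : q < k
        · rw [if_pos h, if_pos (by omega)]
        · rw [if_neg h, if_neg (by omega)]
    · rw [St.set_mem, h4.2 a (by omega), m3, hI.2 a ha]

/-- The pairs active in the second pass are exactly those on which the first combination collides.
Dividing by `m` twice brings fewer than `m * m` pairs down to none. -/
theorem hash_injOn (H : Sizes E w n m env.space) {X co co' : ℕ → ℕ} (hX : ∀ a, X a < 2 ^ w)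
    (hco' : ∀ c, co' c ≤ 2 ^ m)
    (h1 : m * #(bad m (fun _ => 0) (fun i => hsum E w co (X i)) (fun i j => cls E w (X i) (X j)) 0
      (4 * qs E w)) ≤ #(act m (fun _ => 0) (fun i j => cls E w (X i) (X j)) 0 (4 * qs E w)))
    (h2 : m * #(bad m (fun i => hsum E w co (X i)) (fun i => hsum E w co' (X i))
      (fun i j => cls E w (X i) (X j)) 0 (4 * qs E w)) ≤
      #(act m (fun i => hsum E w co (X i)) (fun i j => cls E w (X i) (X j)) 0 (4 * qs E w)))
    {i j : ℕ} (hi : i < m) (hj : j < m)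
    (h : hash E w co co' (X i) = hash E w co co' (X j)) : X i = X j := by
  have hp := H.pos
  -- The inequality is strict because (0, 0) is not an increasing pair. This strictness is what
  -- makes the final count 0.
  have hact : #(act m (fun _ => 0) (fun i j => cls E w (X i) (X j)) 0 (4 * qs E w)) < m * m := by
    rw [← card_range m, ← card_product, card_range]
    refine card_lt_card ⟨filter_subset _ _, fun hsub => ?_⟩
    have := hsub (mem_product.2 ⟨mem_range.2 hp, mem_range.2 hp⟩ : ((0 : ℕ), (0 : ℕ)) ∈ _)
    exact absurd (mem_act.1 this).1 (lt_irrefl 0)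
  have heq : act m (fun i => hsum E w co (X i)) (fun i j => cls E w (X i) (X j)) 0 (4 * qs E w)
      = bad m (fun _ => 0) (fun i => hsum E w co (X i)) (fun i j => cls E w (X i) (X j)) 0
        (4 * qs E w) := by
    ext ⟨a, b⟩
    rw [bad, mem_filter, mem_act, mem_act]
    constructor
    · rintro ⟨a1, a2, a3, a4, a5⟩; exact ⟨⟨a1, a2, rfl, a4, a5⟩, a3⟩
    · rintro ⟨⟨a1, a2, -, a4, a5⟩, a3⟩; exact ⟨a1, a2, a3, a4, a5⟩
  have hb1 := lt_of_mul_lt_mul_left (h1.trans_lt hact) (Nat.zero_le m)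
  have hb2 : bad m (fun i => hsum E w co (X i)) (fun i => hsum E w co' (X i))
      (fun i j => cls E w (X i) (X j)) 0 (4 * qs E w) = ∅ := by
    rw [← card_eq_zero]
    rw [heq] at h2
    by_contra hne
    have := Nat.le_mul_of_pos_right m (Nat.pos_of_ne_zero hne)
    omega
  have sco' := sum_co_le H.big H.le_ck hco'
  have key : ∀ a b, a < b → b < m → hash E w co co' (X a) = hash E w co co' (X b) → X a = X b := by
    intro a b hab hb h
    by_contra hne
    -- The second combination is below `2 ^ (2 * ck E w)`, so both can be read off from the hash
    -- value.
    have d : ∀ x, hash E w co co' x / 2 ^ (2 * ck E w) = hsum E w co x ∧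
        hash E w co co' x % 2 ^ (2 * ck E w) = hsum E w co' x := fun x => by
      rw [hash, mul_comm, Nat.mul_add_div (by positivity), Nat.div_eq_of_lt (hsum_lt sco' x),
        add_zero, Nat.mul_add_mod, Nat.mod_eq_of_lt (hsum_lt sco' x)]
      exact ⟨rfl, rfl⟩
    have e1 : hsum E w co (X a) = hsum E w co (X b) := by rw [← (d _).1, ← (d _).1, h]
    have e2 : hsum E w co' (X a) = hsum E w co' (X b) := by rw [← (d _).2, ← (d _).2, h]
    have : (a, b) ∈ bad m (fun i => hsum E w co (X i)) (fun i => hsum E w co' (X i))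
        (fun i j => cls E w (X i) (X j)) 0 (4 * qs E w) := by
      rw [bad, mem_filter, mem_act]
      exact ⟨⟨hab, hb, e1, Nat.zero_le _, (cls_lt_iff H.big (hX a) (hX b)).2 hne⟩, e2⟩
    rw [hb2] at this
    simp at this
  rcases lt_trichotomy i j with hij | rfl | hij
  · exact key i j hij hj h
  · rfl
  · exact (key j i hij hi h.symm).symm

theorem prepCmd_spec (H : Sizes E w n m env.space) (hc : env.const = wordConsts E w) {σ : St}
    {N : ℕ} {tp tq tf ta : ℕ → ℕ} (hN : N ≤ m * m + m)
    (h0 : ∃ x, env.inp[0]? = some x ∧ x.toNat = m) (h1 : ∃ x, env.inp[1]? = some x ∧ x.toNat = N)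
    (hp : ∀ e < N, ∃ x, env.inp[4 + 4 * e]? = some x ∧ x.toNat = tp e)
    (hq : ∀ e < N, ∃ x, env.inp[5 + 4 * e]? = some x ∧ x.toNat = tq e)
    (hf : ∀ e < N, ∃ x, env.inp[6 + 4 * e]? = some x ∧ x.toNat = tf e)
    (ha : ∀ e < N, ∃ x, env.inp[7 + 4 * e]? = some x ∧ x.toNat = ta e)
    (hpm : ∀ e < N, tp e < m) (hqm : ∀ e < N, tq e < m)
    (hu : ∀ e < N, ∀ e' < N, tf e ≠ 0 → tf e' ≠ 0 → tq e = tq e' → ta e = ta e') :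
    Tr env (prepCmd n) σ ((300 * n + 10000) * ((m + 1) * (m + 1))) (fun σ' =>
      ∃ pred cl label co co' : ℕ → ℕ, IsDS E w n m σ'.mem pred cl label co co' ∧
      (∀ q p, (pred q).testBit p = true ↔ ∃ e < N, tf e ≠ 0 ∧ tp e = p ∧ tq e = q) ∧
      (∀ q < m, ∀ p, (cl q).testBit p = true ↔
        Relation.ReflTransGen (fun p q => ∃ e < N, tf e = 0 ∧ tp e = p ∧ tq e = q) p q) ∧
      (∀ e < N, tf e ≠ 0 → label (tq e) = ta e)) := by
  have hM : m + 1 ≤ (m + 1) * (m + 1) := Nat.le_mul_of_pos_left _ (by omega)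
  have hM1 : 1 ≤ (m + 1) * (m + 1) := by omega
  have hmm : m * m + m ≤ (m + 1) * (m + 1) := by nlinarith
  have hnM : 300 * n * 1 ≤ 300 * n * ((m + 1) * (m + 1)) := Nat.mul_le_mul_left _ hM1
  have hlo : ∀ a < 3 * n + 8, ∀ j v, a ≠ loc n m j v := fun a ha j v h => by
    have := le_loc (n := n) (m := m) j v; omega
  have hne : ∀ j j' v, j ≠ j' → v < m → ∀ u < m, loc n m j v ≠ loc n m j' u :=
    fun j j' v hj hv u hu h => hj ((loc_inj hv hu).1 h).1
  set M := (m + 1) * (m + 1) with hMdef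
  refine ((initCmd_spec H h0 h1).seq (t' := 300 * (N + 1) + (100 * M + (200 * (m + 1) +
    (400 * M + (3000 * M + (50 * (m + 1) + (3000 * M + 500 * (m + 1)))))))) fun s1 e1 f1 => ?_).mono
    (by rw [add_mul]; omega) fun _ h => h
  obtain ⟨p1, p1', z1, l1, c1⟩ := e1
  refine (readCmd_spec H hc hN hp hq hf ha hpm hqm hu p1 p1' (fun a ha => z1 a (by omega)) l1
    c1).seq fun s2 e2 f2 => ?_
  obtain ⟨col, pred, label, a1, a2, a3, a4, a5, a6, a7, a8⟩ := e2
  have p2 : s2.reg 0 = m := (f2.1 0 rfl).trans p1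
  have hRm : ∀ p q, (∃ e < N, tf e = 0 ∧ tp e = p ∧ tq e = q) → p < m := by
    rintro p q ⟨e, he, -, rfl, -⟩; exact hpm e he
  refine ((warshallCmd_spec H p2 a1 a4 hRm).mono (by rw [mul_assoc]) fun _ h => h).seq
    fun s3 e3 f3 => ?_
  obtain ⟨cl, b1, b2, b3⟩ := e3
  have p3 : s3.reg 0 = m := (f3.1 0 rfl).trans p2
  have hcl : ∀ q < m, cl q < 2 ^ m := fun q hq => lt_two_pow_of_testBit fun p h => by
    rcases Relation.ReflTransGen.cases_head ((b2 q hq p).1 h) with rfl | ⟨c, h, -⟩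
    · exact hq
    · exact hRm _ _ h
  have hm3 : ∀ a < 3 * n + 8, s3.mem a = s2.mem a := fun a ha => b3 a fun v _ => hlo a ha 5 v
  refine (packCloseCmd_spec H hc p3 b1 hcl fun a h1 h2 => ?_).seq fun s4 e4 f4 => ?_
  · rw [hm3 a (by omega), a8 a h1 (by omega), z1 a (by omega)]
  obtain ⟨d1, d2⟩ := e4
  have p4 : s4.reg 0 = m := (f4.1 0 rfl).trans p3
  have hloc2 : ∀ j v, 2 * n ≤ loc n m j v := fun j v => by
    have := le_loc (n := n) (m := m) j v; omega
  have l4 : Arr n m 0 s4.mem label := a3.congr fun v hv => by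
    rw [d2 _ (Or.inr (hloc2 _ _)), b3 _ (hne 0 5 v (by norm_num) hv)]
  refine ((sortCmd_spec H hc p4 l4 a7).mono (by rw [mul_assoc]) fun _ h => h).seq fun s5 e5 f5 => ?_
  obtain ⟨X, x1, x2, x3, x4, x5, x6⟩ := e5
  have p5 : s5.reg 0 = m := (f5.1 0 rfl).trans p4
  have hm5 : ∀ a < 3 * n + 8, s5.mem a = s4.mem a := fun a ha => x6 a fun v _ =>
    ⟨hlo a ha 1 v, hlo a ha 3 v⟩
  have xs : ∀ a b, a ≤ b → b < m → RevLe (X a) (X b) := fun a b hab hb => by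
    rcases Nat.lt_or_eq_of_le hab with h | rfl
    · exact x2 a b h hb
    · exact Or.inl rfl
  have z5 : ∀ a, 2 * n ≤ a → a < 3 * n + 8 → s5.mem a = 0 := fun a h1 h2 => by
    rw [hm5 a h2, d2 a (Or.inr h1), hm3 a h2, a8 a (by omega) h2, z1 a h2]
  refine (passCmd_spec H hc (A := 3 * n) (by omega) p5 x1 x5 x4 xs fun p hp =>
    z5 _ (by omega) (by omega)).seq fun s6 e6 f6 => ?_
  obtain ⟨co, g1, g2, g3, g4, g5⟩ := e6
  have p6 : s6.reg 0 = m := (f6.1 0 rfl).trans p5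
  refine (copyCmd_spec H p6 g3).seq fun s7 e7 f7 => ?_
  obtain ⟨i1, i2⟩ := e7
  have p7 : s7.reg 0 = m := (f7.1 0 rfl).trans p6
  have hm7 : ∀ a < 3 * n + 8, s7.mem a = s6.mem a := fun a ha => i2 a fun v _ => hlo a ha 3 v
  have hm6 : ∀ a < 3 * n + 8, a < 3 * n ∨ 3 * n + 4 ≤ a → s6.mem a = s5.mem a := fun a ha h =>
    g5 a h fun v _ => ⟨hlo a ha 2 v, hlo a ha 4 v⟩
  have x7 : Arr n m 1 s7.mem X := x1.congr fun v hv => by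
    have := le_loc (n := n) (m := m) 1 v
    rw [i2 _ (hne 1 3 v (by norm_num) hv), g5 _ (Or.inr (by omega)) fun u hu =>
      ⟨hne 1 2 v (by norm_num) hv u hu, hne 1 4 v (by norm_num) hv u hu⟩]
  refine (passCmd_spec H hc (A := 3 * n + 4) (by omega) p7 x7 i1 x4 xs fun p hp => ?_).seq
    fun s8 e8 f8 => ?_
  · rw [hm7 _ (by omega), hm6 _ (by omega) (Or.inr (by omega)), z5 _ (by omega) (by omega)]
  obtain ⟨co', j1, j2, -, j4, j5⟩ := e8
  have p8 : s8.reg 0 = m := (f8.1 0 rfl).trans p7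
  have hm8 : ∀ a < 3 * n + 4, s8.mem a = s7.mem a := fun a ha =>
    j5 a (Or.inl ha) fun v _ => ⟨hlo a (by omega) 2 v, hlo a (by omega) 4 v⟩
  have l8 : Arr n m 0 s8.mem label := l4.congr fun v hv => by
    have := le_loc (n := n) (m := m) 0 v
    have o : ∀ j, j ≠ 0 → ∀ u < m, loc n m 0 v ≠ loc n m j u := fun j hj =>
      hne 0 j v (Ne.symm hj) hv
    rw [j5 _ (Or.inr (by omega)) fun u hu => ⟨o 2 (by norm_num) u hu, o 4 (by norm_num) u hu⟩,
      i2 _ (o 3 (by norm_num)),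
      g5 _ (Or.inr (by omega)) fun u hu => ⟨o 2 (by norm_num) u hu, o 4 (by norm_num) u hu⟩,
      x6 _ fun u hu => ⟨o 1 (by norm_num) u hu, o 3 (by norm_num) u hu⟩]
  have hm85 : ∀ a < 3 * n, s8.mem a = s5.mem a := fun a ha => by
    rw [hm8 a (by omega), hm7 a (by omega), hm6 a (by omega) (Or.inl ha)]
  refine (packHashCmd_spec H hc p8 l8 g2 j2 (fun p hp => ?_) j1 fun a h1 h2 => ?_).mono le_rfl
    fun s9 h9 => ?_
  · rw [hm8 _ (by omega), hm7 _ (by omega), g1 p hp]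
  · rw [hm85 a h2, z5 a h1 (by omega)]
  obtain ⟨k1, k2⟩ := h9
  have sco := sum_co_le H.big H.le_ck g2
  have sco' := sum_co_le H.big H.le_ck j2
  have hm9 : ∀ a < 2 * n, s9.mem a = s4.mem a := fun a ha => by
    rw [k2 a (Or.inl ha), hm85 a (by omega), hm5 a (by omega)]
  refine ⟨pred, fun q => if q < m then cl q else 0, label, co, co', ?_, a5, fun q hq p => ?_, a6⟩
  · refine ⟨a2.congr fun a _ ha => ?_, d1.congr fun a _ ha => hm9 a (by omega),
      ⟨_, k1, fun q => ?_, fun q hq => if_pos hq⟩, fun p hp => ?_, fun p hp => ?_, fun q hq => ?_,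
      fun q => ?_, fun q => ?_, fun q hq => ?_, fun q hq => if_neg (by omega), sco, sco', ?_⟩
    · rw [hm9 a (by omega), d2 a (Or.inl (by omega)), hm3 a (by omega)]
    · split
      · exact hash_lt sco sco' _
      · positivity
    · rw [k2 _ (Or.inr (by omega)), hm8 _ (by omega), hm7 _ (by omega), g1 p hp]
    · rw [k2 _ (Or.inr (by omega)), j1 p hp]
    · have := l8 q hq
      unfold loc at this
      rw [k2 _ (Or.inr (by omega)), ← this, zero_mul, add_zero]
    · refine lt_two_pow_of_testBit fun p h => ?_
      obtain ⟨e, he, -, rfl, -⟩ := (a5 q p).1 h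
      exact hpm e he
    · split
      · exact hcl q ‹_›
      · positivity
    · refine Nat.eq_of_testBit_eq fun p => ?_
      rw [Nat.zero_testBit]
      by_contra h
      obtain ⟨e, he, -, -, rfl⟩ := (a5 q p).1 (by simpa using h)
      exact absurd (hqm e he) (by omega)
    -- Every label is one of the sorted keys, on which the hash function is injective.
    · intro p hp q hq h
      obtain ⟨i, hi, hi'⟩ := x3 p hp
      obtain ⟨j, hj, hj'⟩ := x3 q hq
      rw [← hi', ← hj'] at h ⊢
      exact hash_injOn H x4 j2 g4 j4 hi hj h
  · beta_reduce
    rw [if_pos hq]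
    exact b2 q hq p

end
end WordRam

/-! ## Thompson automata as inputs -/

/-- In a Thompson automaton each state has at most one incoming character transition. -/
theorem RegExp.thompson_step_unique {α : Type} (R : RegExp α) {p p' q : R.State} {a a' : α}
    (h : R.thompson.step p (some a) q) (h' : R.thompson.step p' (some a') q) : p = p' ∧ a = a' := by
  induction R with
  | char b =>
    cases (show Automaton.CharStep b p (some a) q from h)
    cases (show Automaton.CharStep _ p' (some a') _ from h')
    exact ⟨rfl, rfl⟩
  | cat R S ihR ihS =>
    cases (show Automaton.CatStep R.thompson S.thompson p (some a) q from h) with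
    | left s =>
      cases (show Automaton.CatStep R.thompson S.thompson p' (some a') _ from h') with
      | left s' => obtain ⟨rfl, rfl⟩ := ihR s s'; exact ⟨rfl, rfl⟩
    | right s =>
      cases (show Automaton.CatStep R.thompson S.thompson p' (some a') _ from h') with
      | right s' => obtain ⟨rfl, rfl⟩ := ihS s s'; exact ⟨rfl, rfl⟩
  | union R S ihR ihS =>
    cases (show Automaton.UnionStep R.thompson S.thompson p (some a) q from h) with
    | left s =>
      cases (show Automaton.UnionStep R.thompson S.thompson p' (some a') _ from h') with
      | left s' => obtain ⟨rfl, rfl⟩ := ihR s s'; exact ⟨rfl, rfl⟩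
    | right s =>
      cases (show Automaton.UnionStep R.thompson S.thompson p' (some a') _ from h') with
      | right s' => obtain ⟨rfl, rfl⟩ := ihS s s'; exact ⟨rfl, rfl⟩
  | star R ih =>
    cases (show Automaton.StarStep R.thompson p (some a) q from h) with
    | inner s =>
      cases (show Automaton.StarStep R.thompson p' (some a') _ from h') with
      | inner s' => obtain ⟨rfl, rfl⟩ := ih s s'; exact ⟨rfl, rfl⟩

theorem Automaton.IsTNFA.step_unique {V α : Type} {A : Automaton V α} (hA : A.IsTNFA) {p p' q : V}
    {a a' : α} (h : A.step p (some a) q) (h' : A.step p' (some a') q) : p = p' ∧ a = a' := by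
  obtain ⟨R, e, he, -, -⟩ := hA
  have h1 := (he (e.symm p) (some a) (e.symm q)).2 (by simpa using h)
  have h2 := (he (e.symm p') (some a') (e.symm q)).2 (by simpa using h')
  obtain ⟨h3, h4⟩ := R.thompson_step_unique h1 h2
  exact ⟨e.symm.injective h3, h4⟩

/-- An ε-transition is determined by its two ends and a character transition by its target alone, so
the input can be read in O(m²) steps. -/
theorem Automaton.IsTransitionList.length_le {m : ℕ} {α : Type} {A : Automaton (Fin m) α}
    {E : List (Fin m × Option α × Fin m)} (hE : A.IsTransitionList E) (hA : A.IsTNFA) :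
    E.length ≤ m * m + m := by
  set f : Fin m × Option α × Fin m → (Fin m × Fin m) ⊕ Fin m := fun x =>
    if x.2.1.isSome then .inr x.2.2 else .inl (x.1, x.2.2) with hf
  have hnd : (E.map f).Nodup := by
    refine List.Nodup.map_on ?_ hE.1
    rintro ⟨p, l, q⟩ hx ⟨p', l', q'⟩ hy hxy
    have h1 := (hE.2 p l q).1 hx
    have h2 := (hE.2 p' l' q').1 hy
    cases l with
    | none =>
      cases l' with
      | none => simp only [hf] at hxy; simpa using hxy
      | some a' => simp [hf] at hxy
    | some a =>
      cases l' with
      | none => simp [hf] at hxy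
      | some a' =>
        obtain rfl : q = q' := by simpa [hf] using hxy
        obtain ⟨rfl, rfl⟩ := hA.step_unique h1 h2
        rfl
  have := hnd.length_le_card
  simpa using this

namespace WordRam

theorem getElem?_flatMap_four {α β : Type} (f : α → List β) (hf : ∀ x, (f x).length = 4)
    (E : List α) (e k : ℕ) (hk : k < 4) :
    (E.flatMap f)[4 * e + k]? = E[e]?.bind fun x => (f x)[k]? := by
  induction E generalizing e with
  | nil => simp
  | cons x E ih =>
    rw [List.flatMap_cons]
    cases e with
    | zero =>
      rw [List.getElem?_append_left (by rw [hf]; omega)]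
      simp
    | succ e =>
      rw [List.getElem?_append_right (by rw [hf]; omega), hf,
        show 4 * (e + 1) + k - 4 = 4 * e + k by omega, ih]
      simp

theorem getElem?_automatonInput {w m : ℕ} (A : Automaton (Fin m) (BitVec w))
    (E : List (Fin m × Option (BitVec w) × Fin m)) {e k : ℕ} (hk : k < 4)
    {x : Fin m × Option (BitVec w) × Fin m} (hx : E[e]? = some x) :
    (automatonInput A E)[4 + k + 4 * e]? =
      [BitVec.ofNat w x.1, BitVec.ofNat w x.2.2, if x.2.1.isSome then 1 else 0, x.2.1.getD 0][k]? := by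
  rw [automatonInput, List.getElem?_append_right (by simp; omega)]
  simp only [List.length_cons, List.length_nil]
  rw [show 4 + k + 4 * e - (0 + 1 + 1 + 1 + 1) = 4 * e + k by omega,
    getElem?_flatMap_four _ (fun _ => rfl) _ _ _ hk, hx]
  rfl

open Classical in
theorem testBit_stateWord {m w : ℕ} (hm : m ≤ w) (S : Set (Fin m)) (i : ℕ) :
    (stateWord w (Equiv.refl _) S).toNat.testBit i = true ↔ ∃ h : i < m, (⟨i, h⟩ : Fin m) ∈ S := by
  rw [BitVec.testBit_toNat, stateWord, BitVec.getLsbD_ofFnLE]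
  constructor
  · intro h
    split at h
    · obtain ⟨s, hs, hsi⟩ := (decide_eq_true_iff (p := ∃ s ∈ S, _)).1 h
      obtain rfl : (s : ℕ) = i := hsi
      exact ⟨s.2, hs⟩
    · simp at h
  · rintro ⟨h, hS⟩
    rw [dif_pos (by omega)]
    exact decide_eq_true ⟨_, hS, rfl⟩

/-- The initial state of the variables. -/
def callSt {w : ℕ} (args : List (BitVec w)) (μ : ℕ → BitVec w) : St :=
  ⟨fun r => if r < 2 then (args.getD r 0).toNat else (args.getD (2 * r) 0).toNat,
    fun a => (μ a).toNat⟩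

theorem Tr.halts {w : ℕ} {env : RamEnv w} {cmd : Cmd} {args : List (BitVec w)}
    {μ : ℕ → BitVec w} {t T : ℕ} {Q : St → Prop} (h : Tr env cmd (callSt args μ) t Q)
    (ht : t + 1 ≤ T) :
    ∃ c' σ', RamHalts env cmd.program (RamConfig.call args μ) T c' ∧ Rep c' σ' ∧ Q σ' := by
  obtain ⟨n, hn, σ', e, q⟩ := h
  obtain ⟨c', h1, h2⟩ := e.halts (t := T) (args := args) (μ := μ) (by omega) (by simp [callSt])
    (by simp [callSt]) (fun r hr => (if_neg (Nat.not_lt.2 hr)).symm) (fun a => rfl)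
  exact ⟨c', σ', h1, h2, q⟩

theorem Tr.computes {w : ℕ} {env : RamEnv w} {cmd : Cmd} {args : List (BitVec w)}
    {μ : ℕ → BitVec w} {t T : ℕ} {out : BitVec w}
    (h : Tr env cmd (callSt args μ) t fun σ' => σ'.mem = (callSt args μ).mem ∧
      ∀ i, (σ'.reg 0).testBit i = true ↔ out.toNat.testBit i = true)
    (ht : t + 1 ≤ T) : RamComputes env cmd.program μ T args out := by
  obtain ⟨c', σ', h1, h2, h3, h4⟩ := h.halts ht
  refine ⟨c', h1, BitVec.eq_of_toNat_eq ?_, funext fun a => BitVec.eq_of_toNat_eq ?_⟩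
  · refine Nat.eq_of_testBit_eq fun i => ?_
    rw [show (c'.reg 0).toNat = σ'.reg 0 from h2.1 0]
    exact Bool.eq_iff_iff.2 (h4 i)
  · rw [h2.2 a, h3]; rfl

end WordRam

/-! ## The simulation data structure -/

namespace WordRam

theorem sq_lt_two_pow {w : ℕ} (hw : 16 ≤ w) : 16 * (w * w) < 2 ^ w := by
  induction w, hw using Nat.le_induction with
  | base => norm_num
  | succ w hw ih => rw [pow_succ]; nlinarith

/-- The chunk width is `2 ^ E * rt w`, which by `hE` has room for `2 * c * rt w ≥ m` and one more
`rt w`. Since `2 ^ (E + 3) * gs E w ≥ rt w`, the chosen number of words offers at least `m` fields.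
-/
theorem sizes_of_le {c E w m sp : ℕ} (hE : 2 * c + 1 ≤ 2 ^ E) (hw : 2 ^ (2 * E + 6) ≤ w)
    (hn : 3 * (2 * c * 2 ^ (E + 3)) + 9 ≤ w) (hm0 : 0 < m) (hm : m ≤ 2 * c * rt w)
    (hsp : (3 * (2 * c * 2 ^ (E + 3)) + 14) * m ≤ sp) :
    Sizes E w (2 * c * 2 ^ (E + 3)) m sp := by
  have h64 : 64 ≤ w := by
    refine le_trans ?_ hw
    rw [pow_add]
    have := Nat.one_le_two_pow (n := 2 * E)
    omega
  have hbig : E + 3 ≤ lgS w := by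
    have : 2 * E + 6 ≤ lgN w := by
      exact Nat.le_log_of_pow_le (by norm_num) hw
    unfold lgS; omega
  have hck : m + rt w ≤ ck E w := by
    calc m + rt w ≤ (2 * c + 1) * rt w := by rw [add_mul, one_mul]; omega
      _ ≤ 2 ^ E * rt w := Nat.mul_le_mul_right _ hE
      _ = ck E w := by rw [ck, rt, pow_add, mul_comm]
  have hckw := four_ck_le hbig
  have hgs := gs_le hbig
  have hrt : rt w ≤ ck E w := rt_le_ck
  set n := 2 * c * 2 ^ (E + 3) with hndef
  have hsq : 16 * (w * w) < 2 ^ w := sq_lt_two_pow (by omega)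
  refine ⟨hbig, hm0, hck, ?_, ?_, ?_, ?_, hsq⟩
  · refine hm.trans ?_
    rw [hndef, mul_assoc (2 * c)]
    refine Nat.mul_le_mul_left _ ?_
    rw [rt, gs, ← pow_add]
    refine Nat.pow_le_pow_right (by norm_num) ?_
    have : 2 * lgS w ≤ lgN w := by unfold lgS; omega
    omega
  · nlinarith
  · refine lt_of_le_of_lt ?_ hsq
    calc (3 * n + 9) * (gs E w + 6 * m) ≤ w * (16 * w) := Nat.mul_le_mul hn (by omega)
      _ = _ := by ring
  · have : m + 1 ≤ w := by omega
    nlinarith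

/-! ### Correctness of the operations and of the preprocessing for automata. -/

theorem memberCmd_spec {w : ℕ} {env : RamEnv w} (hw : 1 < 2 ^ w) (σ : St) :
    Tr env memberCmd σ memberCmd.cost fun σ' => σ'.mem = σ.mem ∧
      σ'.reg 0 = if (σ.reg 0).testBit (σ.reg 1) then 1 else 0 := by
  refine wp_sound ⟨rfl, ?_⟩
  rw [St.set_reg, if_pos rfl, eval_and, eval_shr, eval_lit hw, eval_var, eval_var,
    Nat.and_one_is_mod, Nat.shiftRight_eq_div_pow, ← Nat.toNat_testBit]
  cases (σ.reg 0).testBit (σ.reg 1) <;> rfl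

theorem insertCmd_spec {w : ℕ} {env : RamEnv w} (hw : 1 < 2 ^ w) (σ : St) (h1 : σ.reg 1 < w) :
    Tr env insertCmd σ insertCmd.cost fun σ' => σ'.mem = σ.mem ∧
      σ'.reg 0 = σ.reg 0 ||| 2 ^ σ.reg 1 := by
  refine wp_sound ⟨rfl, ?_⟩
  rw [St.set_reg, if_pos rfl, eval_or, eval_shl, eval_lit hw, eval_var, eval_var,
    Nat.shiftLeft_eq, one_mul, Nat.mod_eq_of_lt (Nat.pow_lt_pow_right (by norm_num) h1)]

theorem and_ne_zero_iff (x y : ℕ) :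
    x &&& y ≠ 0 ↔ ∃ p, x.testBit p = true ∧ y.testBit p = true := by
  constructor
  · intro h
    obtain ⟨p, hp⟩ := Nat.exists_testBit_of_ne_zero h
    rw [Nat.testBit_land, Bool.and_eq_true] at hp
    exact ⟨p, hp⟩
  · rintro ⟨p, h⟩ h0
    have := Nat.testBit_land x y p
    rw [h0, h.1, h.2] at this
    simp at this

section
variable {E w n m : ℕ} {A : Automaton (Fin m) (BitVec w)} {μ : ℕ → BitVec w}

/-- Memory holds a data structure for the automaton `A`. -/
def IsDSFor (E n : ℕ) (A : Automaton (Fin m) (BitVec w)) (μ : ℕ → BitVec w) : Prop :=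
  ∃ pred cl label co co' : ℕ → ℕ, IsDS E w n m (fun a => (μ a).toNat) pred cl label co co' ∧
    (∀ q p, (pred q).testBit p = true ↔
      ∃ (hp : p < m) (hq : q < m) (a : BitVec w), A.step ⟨p, hp⟩ (some a) ⟨q, hq⟩) ∧
    (∀ (p q : Fin m), (cl q).testBit p = true ↔
      Relation.ReflTransGen (fun x y => A.step x none y) p q) ∧
    ∀ p a (q : Fin m), A.step p (some a) q → label q = a.toNat

def programs (n : ℕ) : SimulationPrograms :=
  ⟨(prepCmd n).program, (moveCmd n).program, (closeCmd n).program, memberCmd.program,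
    insertCmd.program⟩

theorem stateWord_lt (hm : m ≤ w) (S : Set (Fin m)) :
    (stateWord w (Equiv.refl _) S).toNat < 2 ^ m :=
  lt_two_pow_of_testBit fun p h => ((testBit_stateWord hm S p).1 h).1

/-- The order of the states is the identity, so a state's number is its bit position and Member and
Insert need no table. -/
theorem supports {env : RamEnv w} {t : ℕ} (H : Sizes E w n m env.space)
    (hc : env.const = wordConsts E w) (D : IsDSFor E n A μ) (h1 : moveCost n + 1 ≤ t)
    (h2 : closeCost n + 1 ≤ t) (h3 : 20 ≤ t) :
    (programs n).Supports env A t μ := by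
  have hck := H.ck_le
  have hmw : m ≤ w := by have := H.m_lt; omega
  have hw1 := H.one_lt
  have hww : w < 2 ^ w := Nat.lt_two_pow_self
  obtain ⟨pred, cl, label, co, co', D, hpred, hcl, hlabel⟩ := D
  refine ⟨hmw, Equiv.refl _, fun S => ⟨fun a => ?_, ?_, fun s => ?_, fun s => ?_⟩⟩
  · refine Tr.computes (cmd := moveCmd n) ((moveCmd_spec H hc
      (σ := callSt [stateWord w (Equiv.refl _) S, a] μ) D
      (stateWord_lt hmw S)).mono le_rfl fun σ' h => ⟨h.1, fun q => ?_⟩) h1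
    rw [h.2 q, testBit_stateWord hmw, decide_eq_true_iff, and_ne_zero_iff]
    constructor
    · rintro ⟨hq, ⟨p, hp, hp'⟩, hl⟩
      obtain ⟨hpm, hpS⟩ := (testBit_stateWord hmw S p).1 hp
      obtain ⟨_, _, b, hb⟩ := (hpred q p).1 hp'
      refine ⟨hq, ⟨p, hpm⟩, hpS, ?_⟩
      have : b = a := BitVec.eq_of_toNat_eq ((hlabel _ _ _ hb).symm.trans hl)
      exact this ▸ hb
    · rintro ⟨hq, p, hpS, hstep⟩
      exact ⟨hq, ⟨p, (testBit_stateWord hmw S p).2 ⟨p.2, hpS⟩, (hpred q p).2 ⟨p.2, hq, a, hstep⟩⟩,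
        hlabel _ _ _ hstep⟩
  · refine Tr.computes (cmd := closeCmd n) ((closeCmd_spec H hc
      (σ := callSt [stateWord w (Equiv.refl _) S] μ) D
      (stateWord_lt hmw S)).mono le_rfl fun σ' h => ⟨h.1, fun q => ?_⟩) h2
    rw [h.2 q, testBit_stateWord hmw, decide_eq_true_iff, and_ne_zero_iff]
    constructor
    · rintro ⟨hq, p, hp, hp'⟩
      obtain ⟨hpm, hpS⟩ := (testBit_stateWord hmw S p).1 hp
      exact ⟨hq, ⟨p, hpm⟩, hpS, (hcl ⟨p, hpm⟩ ⟨q, hq⟩).1 hp'⟩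
    · rintro ⟨hq, p, hpS, hp⟩
      exact ⟨hq, p, (testBit_stateWord hmw S p).2 ⟨p.2, hpS⟩, (hcl p ⟨q, hq⟩).2 hp⟩
  · have hs : (BitVec.ofNat w s).toNat = s := by
      rw [BitVec.toNat_ofNat, Nat.mod_eq_of_lt (by omega)]
    refine Tr.computes (cmd := memberCmd) ((memberCmd_spec hw1 (callSt _ μ)).mono le_rfl
      fun σ' h => ⟨h.1, fun q => ?_⟩) (le_trans (Nat.le_of_ble_eq_true rfl) h3)
    have key : (stateWord w (Equiv.refl _) S).toNat.testBit s = true ↔ s ∈ S := by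
      rw [testBit_stateWord hmw]
      exact ⟨fun h => h.2, fun h => ⟨s.2, h⟩⟩
    have e : σ'.reg 0 = if (stateWord w (Equiv.refl _) S).toNat.testBit
        (BitVec.ofNat w s).toNat then 1 else 0 := h.2
    rw [e, hs]
    have h1' : (1 : BitVec w).toNat = 1 := Nat.mod_eq_of_lt hw1
    have h0' : (0 : BitVec w).toNat = 0 := by simp
    by_cases hS : s ∈ S
    · rw [if_pos (key.2 hS), if_pos hS, h1']
    · rw [if_neg fun h => hS (key.1 h), if_neg hS, h0']
  · have hs : (BitVec.ofNat w s).toNat = s := by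
      rw [BitVec.toNat_ofNat, Nat.mod_eq_of_lt (by omega)]
    have hr : (callSt [stateWord w (Equiv.refl _) S, BitVec.ofNat w s] μ).reg 1 = s := hs
    refine Tr.computes (cmd := insertCmd) ((insertCmd_spec hw1 (callSt _ μ) (by omega)).mono le_rfl
      fun σ' h => ⟨h.1, fun q => ?_⟩) (le_trans (Nat.le_of_ble_eq_true rfl) h3)
    rw [h.2, hr, testBit_or_two_pow, testBit_stateWord hmw]
    show (stateWord w (Equiv.refl _) S).toNat.testBit q = true ∨ q = s ↔ _
    rw [testBit_stateWord hmw]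
    constructor
    · rintro (⟨h, hS⟩ | rfl)
      · exact ⟨h, Or.inl hS⟩
      · exact ⟨s.2, Or.inr rfl⟩
    · rintro ⟨h, hS | hS⟩
      · exact Or.inl ⟨h, hS⟩
      · exact Or.inr (congrArg Fin.val hS)

theorem preprocess_halts (hA : A.IsTNFA) {L : List (Fin m × Option (BitVec w) × Fin m)}
    (hL : A.IsTransitionList L) {sp T : ℕ} (H : Sizes E w n m sp)
    (hT : (300 * n + 10000) * ((m + 1) * (m + 1)) + 1 ≤ T) (mem₀ : ℕ → BitVec w) :
    ∃ c : RamConfig w, RamHalts ⟨wordConsts E w, automatonInput A L, sp⟩ (prepCmd n).program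
      (RamConfig.call [] mem₀) T c ∧ IsDSFor E n A c.mem := by
  have hlen := hL.length_le hA
  have hsq := H.sq_lt
  have hsq' := H.sq_lt_pow
  have hck := four_ck_le H.big
  have hmk := H.le_ck
  have hww : w < 2 ^ w := Nat.lt_two_pow_self
  have hw1 : 1 < 2 ^ w := by omega
  have tn : ∀ k, k < 2 ^ w → (BitVec.ofNat w k).toNat = k := fun k hk => by
    rw [BitVec.toNat_ofNat, Nat.mod_eq_of_lt hk]
  -- The columns of the transition list as functions on ℕ. The default 0 beyond the end of the list
  -- is never used.
  set tp : ℕ → ℕ := fun e => (L[e]?.map fun x => (x.1 : ℕ)).getD 0 with htp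
  set tq : ℕ → ℕ := fun e => (L[e]?.map fun x => (x.2.2 : ℕ)).getD 0 with htq
  set tf : ℕ → ℕ := fun e => (L[e]?.map fun x => if x.2.1.isSome then 1 else 0).getD 0 with htf
  set ta : ℕ → ℕ := fun e => (L[e]?.map fun x => (x.2.1.getD 0).toNat).getD 0 with hta
  have get : ∀ e < L.length, ∃ x, L[e]? = some x ∧ x ∈ L ∧ tp e = x.1 ∧ tq e = x.2.2 ∧
      (tf e = if x.2.1.isSome then 1 else 0) ∧ ta e = (x.2.1.getD 0).toNat := fun e he => by
    have hx := List.getElem?_eq_getElem he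
    refine ⟨_, hx, List.getElem_mem he, ?_, ?_, ?_, ?_⟩ <;> simp [htp, htq, htf, hta, hx]
  have ex : ∀ x ∈ L, ∃ e < L.length, L[e]? = some x := fun x hx => by
    obtain ⟨e, he, rfl⟩ := List.mem_iff_getElem.1 hx
    exact ⟨e, he, List.getElem?_eq_getElem he⟩
  have char : ∀ e < L.length, tf e ≠ 0 → ∃ p a q, A.step p (some a) q ∧ tp e = p ∧ tq e = q ∧
      ta e = a.toNat := fun e he hf => by
    obtain ⟨⟨p, l, q⟩, -, hmem, h1, h2, h3, h4⟩ := get e he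
    cases l with
    | none => simp [h3] at hf
    | some a => exact ⟨p, a, q, (hL.2 _ _ _).1 hmem, h1, h2, h4⟩
  have eps : ∀ e < L.length, tf e = 0 → ∃ p q, A.step p none q ∧ tp e = p ∧ tq e = q :=
      fun e he hf => by
    obtain ⟨⟨p, l, q⟩, -, hmem, h1, h2, h3, h4⟩ := get e he
    cases l with
    | none => exact ⟨p, q, (hL.2 _ _ _).1 hmem, h1, h2⟩
    | some a => simp [h3] at hf
  have conv : ∀ p l q, A.step p l q → ∃ e < L.length, tp e = p ∧ tq e = q ∧
      (tf e = if l.isSome then 1 else 0) ∧ ta e = (l.getD 0).toNat := fun p l q h => by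
    obtain ⟨e, he, hx⟩ := ex _ ((hL.2 p l q).2 h)
    refine ⟨e, he, ?_, ?_, ?_, ?_⟩ <;> simp [htp, htq, htf, hta, hx]
  have spec := prepCmd_spec (env := ⟨wordConsts E w, automatonInput A L, sp⟩) (E := E) (n := n)
    (m := m) (N := L.length) (tp := tp) (tq := tq) (tf := tf) (ta := ta)
    (σ := callSt [] mem₀) H rfl hlen ⟨_, rfl, tn _ (by omega)⟩ ⟨_, rfl, tn _ (by omega)⟩
    (fun e he => ?_) (fun e he => ?_) (fun e he => ?_) (fun e he => ?_) (fun e he => ?_)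
    (fun e he => ?_) (fun e he e' he' hf hf' hq => ?_)
  · obtain ⟨c, σ', h1, h2, pred, cl, label, co, co', D, d1, d2, d3⟩ := spec.halts hT
    refine ⟨c, h1, pred, cl, label, co, co', ?_, fun q p => ?_, fun p q => ?_, fun p a q h => ?_⟩
    · rw [show (fun a => (c.mem a).toNat) = σ'.mem from funext h2.2]; exact D
    · rw [d1]
      constructor
      · rintro ⟨e, he, hf, rfl, rfl⟩
        obtain ⟨p, a, q, hs, h3, h4, -⟩ := char e he hf
        exact ⟨h3 ▸ p.2, h4 ▸ q.2, a, by simpa only [h3, h4] using hs⟩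
      · rintro ⟨hp, hq, a, hs⟩
        obtain ⟨e, he, h3, h4, h5, -⟩ := conv _ _ _ hs
        exact ⟨e, he, by simp [h5], h3, h4⟩
    · rw [d2 q q.2]
      -- The preprocessing knows reachability between natural numbers. A path that starts below `m`
      -- stays below `m`, because it follows listed transitions.
      have fwd : ∀ x y : ℕ, Relation.ReflTransGen
          (fun p q => ∃ e < L.length, tf e = 0 ∧ tp e = p ∧ tq e = q) x y →
          ∀ hx : x < m, ∃ hy : y < m,
            Relation.ReflTransGen (fun x y => A.step x none y) ⟨x, hx⟩ ⟨y, hy⟩ := by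
        intro x y h hx
        induction h with
        | refl => exact ⟨hx, .refl⟩
        | tail _ hstep ih =>
          obtain ⟨hy, ih⟩ := ih
          obtain ⟨e, he, hf, h3, h4⟩ := hstep
          obtain ⟨p', q', hs, h5, h6⟩ := eps e he hf
          have e1 : p' = ⟨_, hy⟩ := Fin.ext (h5.symm.trans h3)
          have e2 : (q' : ℕ) = _ := h6.symm.trans h4
          refine ⟨e2 ▸ q'.2, ih.tail ?_⟩
          rw [e1] at hs
          have e3 : q' = ⟨_, e2 ▸ q'.2⟩ := Fin.ext e2
          rw [← e3]; exact hs
      constructor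
      · intro h
        exact (fwd p q h p.2).2
      · intro h
        refine Relation.ReflTransGen.lift (fun x : Fin m => (x : ℕ)) (fun x y hs => ?_) _ _ h
        obtain ⟨e, he, h3, h4, h5, -⟩ := conv _ _ _ hs
        exact ⟨e, he, by simp [h5], h3, h4⟩
    · obtain ⟨e, he, h3, h4, h5, h6⟩ := conv _ _ _ h
      rw [← h4, d3 e he (by simp [h5]), h6]; rfl
  · obtain ⟨x, hx, -, h1, h2, h3, h4⟩ := get e he
    exact ⟨_, getElem?_automatonInput A L (k := 0) (by norm_num) hx,
      (tn _ (by omega)).trans h1.symm⟩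
  · obtain ⟨x, hx, -, h1, h2, h3, h4⟩ := get e he
    exact ⟨_, getElem?_automatonInput A L (k := 1) (by norm_num) hx,
      (tn _ (by omega)).trans h2.symm⟩
  · obtain ⟨x, hx, -, h1, h2, h3, h4⟩ := get e he
    refine ⟨_, getElem?_automatonInput A L (k := 2) (by norm_num) hx, ?_⟩
    rw [h3]
    split
    · exact Nat.mod_eq_of_lt hw1
    · simp
  · obtain ⟨x, hx, -, h1, h2, h3, h4⟩ := get e he
    exact ⟨_, getElem?_automatonInput A L (k := 3) (by norm_num) hx, h4.symm⟩
  · obtain ⟨x, hx, -, h1, h2, h3, h4⟩ := get e he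
    rw [h1]; exact x.1.2
  · obtain ⟨x, hx, -, h1, h2, h3, h4⟩ := get e he
    rw [h2]; exact x.2.2.2
  · obtain ⟨p, a, q, hs, h1, h2, h3⟩ := char e he hf
    obtain ⟨p', a', q', hs', h1', h2', h3'⟩ := char e' he' hf'
    obtain rfl : q = q' := Fin.ext (by rw [← h2, ← h2', hq])
    rw [h3, h3', (hA.step_unique hs hs').2]

end
end WordRam

open WordRam in
theorem lemma7 (C : ℝ) :
    ∃ (K w₀ : ℕ) (κ : (w : ℕ) → ℕ → BitVec w) (Q : SimulationPrograms),
      ∀ w : ℕ, w₀ ≤ w → ∀ m : ℕ, (m : ℝ) ≤ C * Real.sqrt w →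
        ∀ A : Automaton (Fin m) (BitVec w), A.IsTNFA →
          ∀ E : List (Fin m × Option (BitVec w) × Fin m), A.IsTransitionList E →
            ∀ mem₀ : ℕ → BitVec w, ∃ c : RamConfig w,
              RamHalts ⟨κ w, automatonInput A E, K * m⟩ Q.preprocess
                (RamConfig.call [] mem₀) (K * m ^ 2) c ∧
              Q.Supports ⟨κ w, [], K * m⟩ A K c.mem := by
  set c := ⌈C⌉₊ with hc
  -- Only `2 * c + 1 ≤ 2 ^ E` matters.
  set E := 2 * c + 1 with hE
  set n := 2 * c * 2 ^ (E + 3) with hn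
  -- The factor 4 comes from `(m + 1) * (m + 1) ≤ 4 * (m * m)`. This constant also exceeds `3 * n +
  -- 14`, which covers the space, and 20, which covers Member and Insert.
  obtain ⟨K, hK1, hK2, hK3⟩ : ∃ K, 4 * (300 * n + 10000) + 1 ≤ K ∧ moveCost n + 1 ≤ K ∧
      closeCost n + 1 ≤ K :=
    ⟨4 * (300 * n + 10000) + 1 + (moveCost n + 1) + (closeCost n + 1), Nat.le_add_right _ _ |>.trans
      (Nat.le_add_right _ _), (Nat.le_add_left _ _).trans (Nat.le_add_right _ _), Nat.le_add_left _ _⟩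
  refine ⟨K, max (2 ^ (2 * E + 6)) (3 * n + 9), wordConsts E, programs n,
    fun w hw m hm A hA L hL mem₀ => ?_⟩
  have hw1 : 2 ^ (2 * E + 6) ≤ w := (le_max_left _ _).trans hw
  have hw2 : 3 * n + 9 ≤ w := (le_max_right _ _).trans hw
  -- The start state shows that there is at least one state.
  have hm0 : 0 < m := (Nat.zero_le _).trans_lt A.start.2
  have hmr : m ≤ 2 * c * rt w := by
    have h1 : Real.sqrt w ≤ 2 * rt w := by
      refine Real.sqrt_le_iff.2 ⟨by positivity, ?_⟩
      have : (w : ℝ) ≤ ((4 * (rt w * rt w) : ℕ) : ℝ) := Nat.cast_le.2 lt_rt_mul_rt.le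
      push_cast at this
      nlinarith
    have h2 : (m : ℝ) ≤ c * (2 * rt w) :=
      hm.trans (mul_le_mul (Nat.le_ceil C) h1 (Real.sqrt_nonneg _) (Nat.cast_nonneg _))
    have h3 : (m : ℝ) ≤ ((2 * c * rt w : ℕ) : ℝ) := by push_cast; linarith
    exact_mod_cast h3
  have H : Sizes E w n m (K * m) := sizes_of_le Nat.lt_two_pow_self.le hw1 hw2 hm0 hmr
    (Nat.mul_le_mul_right _ (by omega))
  have hT : (300 * n + 10000) * ((m + 1) * (m + 1)) + 1 ≤ K * m ^ 2 := by
    have h4 : (m + 1) * (m + 1) ≤ 4 * (m * m) := by nlinarith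
    have h5 : 1 ≤ m * m := Nat.mul_pos hm0 hm0
    calc (300 * n + 10000) * ((m + 1) * (m + 1)) + 1
        ≤ (300 * n + 10000) * (4 * (m * m)) + 1 * (m * m) :=
          Nat.add_le_add (Nat.mul_le_mul_left _ h4) (by omega)
      _ = (4 * (300 * n + 10000) + 1) * (m * m) := by ring
      _ ≤ K * (m * m) := Nat.mul_le_mul_right _ hK1
      _ = K * m ^ 2 := by ring
  obtain ⟨σ, h1, h2⟩ := preprocess_halts hA hL H hT mem₀
  exact ⟨σ, h1, supports H rfl h2 hK2 hK3 (by omega)⟩
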